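/- Let $K(z)=e^{-z}$ for $z>0$ and $K(z)=0$ for $z\le 0$, and consider the augmented Burgers equation $$u_t = u\,u_x + u_{xx} + K*u - u + u_x \quad\text{in } (0,\infty)\times\mathbb{R},\qquad u(0,\cdot)=u_0, \tag{1}$$ where $*$ is convolution in $x$ and $u$ is real-valued. For $u_0\in L^1(\mathbb{R})$, a solution of (1) in $C([0,\infty),L^1(\mathbb{R}))$ is a function $u\in C([0,\infty),L^1(\mathbb{R}))$ with $u(0)=u_0$ and $u^2\in L^1_{\mathrm{loc}}((0,\infty)\times\mathbb{R})$ that satisfies the equation in the sense of distributions on $(0,\infty)\times\mathbb{R}$, with $u\,u_x$ read as $(u^2/2)_x$. **Theorem.** For every $u_0\in L^1(\mathbb{R})$ there exists a unique solution $u\in C([0,\infty),L^1(\mathbb{R}))$ of (1). Moreover, $$u\in C((0,\infty),W^{2,p}(\mathbb{R}))\cap C^1((0,\infty),L^p(\mathbb{R}))\qquad\text{for all } p\in(1,\infty).$$ Additionally, equation (1) generates a contractive semigroup in $L^1(\mathbb{R})$: there are maps $S(t):L^1(\mathbb{R})\to L^1(\mathbb{R})$, $t\ge 0$, such that $S(0)=\mathrm{Id}$,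 $S(s+t)=S(s)S(t)$ for all $s,t\ge0$, $t\mapsto S(t)u_0$ is continuous on $[0,\infty)$ for every $u_0 \in L^1(\mathbb{R})$, $\|S(t)u_0-S(t)v_0\|_1\le\|u_0-v_0\|_1$ for all $t\ge0$ and $u_0,v_0\in L^1(\mathbb{R})$, and $t\mapsto S(t)u_0$ is the solution of (1) with initial datum $u_0$. -/

import Mathlib

open MeasureTheory Set
open scoped NNReal ENNReal ContDiff Convolution

noncomputable section

namespace AugmentedBurgers

/-- The Banach space `L¹(ℝ)` of (classes of) real-valued integrable functions. -/
abbrev L1 : Type := Lp ℝ 1 (volume : Measure ℝ)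

/-- The relaxation kernel: `K z = exp (-z)` for `z > 0` and `K z = 0` elsewhere. -/
def K (z : ℝ) : ℝ := if 0 < z then Real.exp (-z) else 0

/-- `(K * f)(x) = ∫ K y f (x - y) dy`, convolution on the real line. -/
def convK (f : ℝ → ℝ) : ℝ → ℝ :=
  K ⋆[ContinuousLinearMap.lsmul ℝ ℝ, (volume : Measure ℝ)] f

/-- Test functions of `(t, x)` on the open half plane `(0, ∞) × ℝ`. -/
structure IsTestFunction (φ : ℝ × ℝ → ℝ) : Prop where
  smooth : ContDiff ℝ ∞ φ
  compact : HasCompactSupport φ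
  support : tsupport φ ⊆ Ioi (0 : ℝ) ×ˢ (univ : Set ℝ)

/-- `u` is locally square integrable on the open half plane `(0, ∞) × ℝ`. This is what makes
`u u_x = (u² / 2)_x` meaningful as a distribution. (For a continuous curve `u` in `L¹` the inner
integral is lower semicontinuous, hence measurable, in `t`.) -/
def IsLocallySquareIntegrable (u : ℝ≥0 → L1) : Prop :=
  ∀ a b R : ℝ, 0 < a →
    ∫⁻ t in Icc a b, ∫⁻ x in Icc (-R) R, ‖u t.toNNReal x‖ₑ ^ 2 < ⊤

/-- `u ∈ C([0, ∞), L¹(ℝ))` is a solution, in the sense of distributions on `(0, ∞) × ℝ`, of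
`u_t = u u_x + u_xx + K * u - u + u_x` with `u(0) = u₀`. -/
structure IsSolution (u₀ : L1) (u : ℝ≥0 → L1) : Prop where
  continuous : Continuous u
  initial : u 0 = u₀
  locallySquareIntegrable : IsLocallySquareIntegrable u
  equation : ∀ φ : ℝ × ℝ → ℝ, IsTestFunction φ →
    ∫ t in Ioi (0 : ℝ), ∫ x : ℝ,
      (u t.toNNReal x * deriv (fun s => φ (s, x)) t
        - u t.toNNReal x ^ 2 / 2 * deriv (fun y => φ (t, y)) x
        + u t.toNNReal x * iteratedDeriv 2 (fun y => φ (t, y)) x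
        + (convK (u t.toNNReal) x - u t.toNNReal x) * φ (t, x)
        - u t.toNNReal x * deriv (fun y => φ (t, y)) x) = 0

/-- `g` is the weak derivative of `f` on the real line. -/
def HasWeakDeriv (f g : ℝ → ℝ) : Prop :=
  ∀ ψ : ℝ → ℝ, ContDiff ℝ ∞ ψ → HasCompactSupport ψ →
    ∫ x, f x * deriv ψ x = - ∫ x, g x * ψ x

/-- The Sobolev space `W^{2,p}(ℝ)`, an element `f` being stored together with its first two weak
derivatives as `(f, f', f'')`. The topology is that of `Lᵖ × Lᵖ × Lᵖ`, which is the topology of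
the usual Sobolev norm. -/
abbrev W2 (p : ℝ≥0∞) [Fact (1 ≤ p)] : Type :=
  {f : Lp ℝ p (volume : Measure ℝ) × Lp ℝ p (volume : Measure ℝ) × Lp ℝ p (volume : Measure ℝ) //
    HasWeakDeriv f.1 f.2.1 ∧ HasWeakDeriv f.2.1 f.2.2}

/-- `u ∈ C((0, ∞), W^{2,p}(ℝ))`. -/
def IsContinuousIntoW2 (u : ℝ≥0 → L1) (p : ℝ≥0∞) [Fact (1 ≤ p)] : Prop :=
  ∃ v : ℝ → W2 p, ContinuousOn v (Ioi 0) ∧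
    ∀ t : ℝ, 0 < t → ((v t).1.1 : ℝ → ℝ) =ᵐ[volume] u t.toNNReal

/-- `u ∈ C¹((0, ∞), Lᵖ(ℝ))`. -/
def IsC1IntoLp (u : ℝ≥0 → L1) (p : ℝ≥0∞) [Fact (1 ≤ p)] : Prop :=
  ∃ v : ℝ → Lp ℝ p (volume : Measure ℝ), ContDiffOn ℝ 1 v (Ioi 0) ∧
    ∀ t : ℝ, 0 < t → (v t : ℝ → ℝ) =ᵐ[volume] u t.toNNReal

/-- A strongly continuous semigroup of (nonlinear) contractions of `L¹(ℝ)`. -/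
structure IsContractionSemigroup (S : ℝ≥0 → L1 → L1) : Prop where
  zero : ∀ f, S 0 f = f
  add : ∀ s t f, S (s + t) f = S s (S t f)
  continuous : ∀ f, Continuous fun t => S t f
  contraction : ∀ t f g, ‖S t f - S t g‖ ≤ ‖f - g‖

end AugmentedBurgers

end

noncomputable section

namespace AugmentedBurgers

open Filter Topology ProbabilityTheory
open scoped BoundedContinuousFunction

/-! The Hopf–Cole substitution turns the equation into a semilinear heat equation in $L^1$. Put
$w(x)=\exp(\frac12\int_{-\infty}^x u)$ and $q=w_x$, so that $w=1+\int_{-\infty}^x q$ and $u=2q/w$.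
Since $(K*f)_x=f-K*f$, the primitive of $K*u-u$ is $-K*u$, and with $r=q/w=u/2$ one finds
$q_t=q_{xx}+q_x+N(q)$, $N(q)=w\,(K*r)-(K*r)\,q-q$. No derivative of $q$ enters $N$. It is smooth on
the open set where $w$ is invertible, and it commutes with translations.

Spatial derivatives are taken in the sense of the translation group (`IsD`). An element of the
domain is a.e. the primitive of its derivative (`isD_ae_eq`), so it has a bounded continuous
representative; this makes products and integration by parts available inside $L^1$.

Existence. A contraction argument gives local mild solutions for $q$ (`exists_mildSol`). The heat
semigroup gains a derivative at the integrable cost $t^{-1/2}$, and $(q,q_x)$ solves a system of the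
same type, so the gain can be iterated (`TransGroup.mild_smoothing`). Undoing the substitution gives
classical solutions $u$ (`MildSol.classical`). Testing the difference of two of them with its own
sign shows that their $L^1$ distance does not increase (`ClassicalOn.contraction`). Comparison with
the zero solution bounds $\|u(t)\|_1$, hence $q$ and $1/w$, so the local existence time is uniform
and solutions are global (`exists_global`).

Uniqueness. A distributional solution only has $u^2$ locally integrable. Its potential is mollified,
and the chain rule for the exponential is applied. The error is the Jensen defect
$\rho*u^2-(\rho*u)^2$, which tends to zero locally in $L^1$ (`tendsto_defect`). The potential
equation is known up to a function of time, which is constant because $w\to1$ at $-\infty$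
(`WeakSol.potential_const`). Hence the transform of every distributional solution is a mild solution
(`WeakSol.mildSol`). Mild solutions are unique by contraction (`MildSol.unique`), and the transform
has a left inverse (`two_rL_hc`).

Regularity in $L^p$ follows from $u=K*(u+u_x)$ (`Kc_add_isD`) and the boundedness of convolution
with $K$ from $L^1$ to $L^p$ (`KLp`). -/

/-- A strongly continuous one-parameter group of isometries of a Banach space. -/
structure TransGroup (E : Type*) [NormedAddCommGroup E] [NormedSpace ℝ E] where
  τ : ℝ → E →L[ℝ] E
  zero : ∀ f, τ 0 f = f
  add : ∀ s t f, τ (s + t) f = τ s (τ t f)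
  norm_le : ∀ s f, ‖τ s f‖ ≤ ‖f‖
  cont : ∀ f, Continuous fun s => τ s f

/-- `g` is the derivative of `f` along the translations `τ`. -/
def IsD {E : Type*} [NormedAddCommGroup E] [NormedSpace ℝ E] (τ : ℝ → E →L[ℝ] E) (f g : E) : Prop :=
  HasDerivAt (fun y => τ y f) g 0

/-! ### The standard Gaussian: exponential moments and shifts -/

/-- The standard Gaussian measure on the line. -/
abbrev stdGauss : Measure ℝ := gaussianReal 0 1

/-- A uniform bound upgrades strong continuity to joint continuity: write `A x f'` as `A x f + A x
(f' - f)`. -/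
lemma continuous_clm_apply {X E F : Type*} [TopologicalSpace X] [NormedAddCommGroup E]
    [NormedSpace ℝ E] [NormedAddCommGroup F] [NormedSpace ℝ F] {A : X → E →L[ℝ] F} {C : ℝ}
    (hA : ∀ x f, ‖A x f‖ ≤ C * ‖f‖) (hc : ∀ f, Continuous fun x => A x f) :
    Continuous fun p : X × E => A p.1 p.2 := by
  rw [continuous_iff_continuousAt]
  rintro ⟨x, f⟩
  have h1 : Tendsto (fun p : X × E => A p.1 f) (𝓝 (x, f)) (𝓝 (A x f)) :=
    ((hc f).tendsto x).comp (continuous_fst.tendsto (x, f))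
  have h2 : Tendsto (fun p : X × E => A p.1 (p.2 - f)) (𝓝 (x, f)) (𝓝 0) := by
    have h3 : Tendsto (fun p : X × E => C * ‖p.2 - f‖) (𝓝 (x, f)) (𝓝 0) := by
      have : Continuous fun p : X × E => C * ‖p.2 - f‖ := by fun_prop
      simpa using this.tendsto (x, f)
    exact squeeze_zero_norm (fun p => hA _ _) h3
  have := h1.add h2
  simpa [ContinuousAt] using this

lemma integrable_exp_mul_abs (c : ℝ) : Integrable (fun z : ℝ => Real.exp (c * |z|)) stdGauss := by
  have h1 : Integrable (fun z : ℝ => Real.exp (c * z) + Real.exp (-c * z)) stdGauss :=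
    (integrable_exp_mul_gaussianReal c).add (integrable_exp_mul_gaussianReal (-c))
  refine h1.mono' (by fun_prop) (Eventually.of_forall fun z => ?_)
  rw [Real.norm_eq_abs, abs_of_pos (Real.exp_pos _)]
  rcases abs_cases z with ⟨h, _⟩ | ⟨h, _⟩ <;> rw [h]
  · linarith [Real.exp_pos (-c * z)]
  · rw [mul_neg, ← neg_mul]; linarith [Real.exp_pos (c * z)]

lemma integrable_id_stdGauss : Integrable (fun z : ℝ => z) stdGauss := by
  refine (integrable_exp_mul_abs 1).mono' (by fun_prop) (Eventually.of_forall fun z => ?_)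
  rw [Real.norm_eq_abs, one_mul]
  linarith [Real.add_one_le_exp |z|]

/-- The Cameron–Martin formula on the line. -/
lemma integral_stdGauss_shift {E : Type*} [NormedAddCommGroup E] [NormedSpace ℝ E]
    (F : ℝ → E) (a : ℝ) :
    ∫ z, F (z + a) ∂stdGauss = ∫ z, Real.exp (a * z - a ^ 2 / 2) • F z ∂stdGauss := by
  rw [integral_gaussianReal_eq_integral_smul (by simp), integral_gaussianReal_eq_integral_smul (by simp)]
  rw [← integral_sub_right_eq_self (fun z => gaussianPDFReal 0 1 z • F (z + a)) a]
  refine integral_congr_ae (Eventually.of_forall fun z => ?_)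
  simp only [sub_add_cancel, smul_smul]
  congr 1
  simp only [gaussianPDFReal]
  rw [mul_assoc _ (Real.exp _) (Real.exp _), ← Real.exp_add]
  congr 2
  simp only [NNReal.coe_one]
  ring

/-! ### Isometry groups and the semigroup generated by D² + D -/

namespace TransGroup

variable {E : Type*} [NormedAddCommGroup E] [NormedSpace ℝ E] (G : TransGroup E)

lemma continuous_τ : Continuous fun p : ℝ × E => G.τ p.1 p.2 :=
  continuous_clm_apply (C := 1) (by simpa using G.norm_le) G.cont

lemma norm_τ (s : ℝ) (f : E) : ‖G.τ s f‖ = ‖f‖ := by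
  refine le_antisymm (G.norm_le s f) ?_
  calc ‖f‖ = ‖G.τ (-s) (G.τ s f)‖ := by rw [← G.add, neg_add_cancel, G.zero]
    _ ≤ _ := G.norm_le _ _

/-- The diagonal action on a product. -/
def prod {F : Type*} [NormedAddCommGroup F] [NormedSpace ℝ F] (G' : TransGroup F) :
    TransGroup (E × F) where
  τ s := (G.τ s).prodMap (G'.τ s)
  zero f := by ext <;> simp [G.zero, G'.zero]
  add s t f := by ext <;> simp [G.add, G'.add]
  norm_le s f := by
    exact max_le_max (G.norm_le _ _) (G'.norm_le _ _)
  cont f := by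
    exact (G.cont f.1).prodMk (G'.cont f.2)

lemma isD_prod {F : Type*} [NormedAddCommGroup F] [NormedSpace ℝ F] (G' : TransGroup F)
    {f g : E × F} : IsD (G.prod G').τ f g ↔ IsD G.τ f.1 g.1 ∧ IsD G'.τ f.2 g.2 := by
  constructor
  · intro h
    exact ⟨hasFDerivAt_fst.comp_hasDerivAt (f := fun y => (G.prod G').τ y f) 0 h,
      hasFDerivAt_snd.comp_hasDerivAt (f := fun y => (G.prod G').τ y f) 0 h⟩
  · rintro ⟨h1, h2⟩
    exact HasDerivAt.prodMk h1 h2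

variable {G}

lemma hasDerivAt_τ {f g : E} (h : IsD G.τ f g) (y : ℝ) :
    HasDerivAt (fun y => G.τ y f) (G.τ y g) y := by
  have h1 : HasDerivAt (fun x => G.τ (x - y) f) g y := by
    have h2 : HasDerivAt (fun y => G.τ y f) g (y - y) := by rw [sub_self]; exact h
    have h3 := HasDerivAt.scomp (h := fun x => x - y) y h2 ((hasDerivAt_id' y).sub_const y)
    rw [one_smul] at h3
    exact h3
  have h3 := (G.τ y).hasFDerivAt.comp_hasDerivAt (f := fun x => G.τ (x - y) f) y h1
  refine h3.congr_of_eventuallyEq (Eventually.of_forall fun x => ?_)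
  simp [← G.add]

lemma isD_unique {f g g' : E} (h : IsD G.τ f g) (h' : IsD G.τ f g') : g = g' := HasDerivAt.unique h h'

/-- The derivative along translations. -/
def D (G : TransGroup E) (f : E) : E := deriv (fun y => G.τ y f) 0

lemma D_eq {f g : E} (h : IsD G.τ f g) : G.D f = g := HasDerivAt.deriv h

lemma isD_clm {A : E →L[ℝ] E} (hA : ∀ s f, A (G.τ s f) = G.τ s (A f)) {f g : E}
    (h : IsD G.τ f g) : IsD G.τ (A f) (A g) := by
  have h3 := A.hasFDerivAt.comp_hasDerivAt (f := fun x => G.τ x f) 0 h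
  refine h3.congr_of_eventuallyEq (Eventually.of_forall fun x => ?_)
  simp [hA]

lemma isD_add {f g f' g' : E} (h : IsD G.τ f g) (h' : IsD G.τ f' g') :
    IsD G.τ (f + f') (g + g') := by
  simpa [IsD] using HasDerivAt.fun_add h h'

variable (G)

lemma integrable_avg {k : ℝ → ℝ} (hk : Integrable k stdGauss) (a b : ℝ) (f : E) :
    Integrable (fun z => k z • G.τ (a + b * z) f) stdGauss := by
  have hc : Continuous fun z => G.τ (a + b * z) f := (G.cont f).comp (by fun_prop)
  refine (hk.norm.mul_const ‖f‖).mono' (hk.1.smul hc.aestronglyMeasurable)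
    (Eventually.of_forall fun z => ?_)
  rw [norm_smul]
  exact mul_le_mul_of_nonneg_left (G.norm_le _ _) (norm_nonneg _)

/-- The weighted Gaussian average `∫ k z • τ (a + b z) f dγ(z)`. -/
def avg (k : ℝ → ℝ) (hk : Integrable k stdGauss) (a b : ℝ) : E →L[ℝ] E :=
  LinearMap.mkContinuous
    { toFun := fun f => ∫ z, k z • G.τ (a + b * z) f ∂stdGauss
      map_add' := fun f g => by
        simp only [map_add, smul_add]
        exact integral_add (G.integrable_avg hk a b f) (G.integrable_avg hk a b g)
      map_smul' := fun c f => by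
        simp only [map_smul, smul_comm _ c, RingHom.id_apply]
        exact integral_smul _ _ }
    (∫ z, |k z| ∂stdGauss) fun f => by
      simp only [LinearMap.coe_mk, AddHom.coe_mk]
      rw [← integral_mul_const]
      refine norm_integral_le_of_norm_le (hk.norm.mul_const ‖f‖) (Eventually.of_forall fun z => ?_)
      rw [norm_smul]
      exact mul_le_mul_of_nonneg_left (G.norm_le _ _) (norm_nonneg _)

lemma avg_apply (k : ℝ → ℝ) (hk : Integrable k stdGauss) (a b : ℝ) (f : E) :
    G.avg k hk a b f = ∫ z, k z • G.τ (a + b * z) f ∂stdGauss := rfl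

lemma norm_avg_le (k : ℝ → ℝ) (hk : Integrable k stdGauss) (a b : ℝ) (f : E) :
    ‖G.avg k hk a b f‖ ≤ (∫ z, |k z| ∂stdGauss) * ‖f‖ :=
  (G.avg k hk a b).le_of_opNorm_le (LinearMap.mkContinuous_norm_le _ (integral_nonneg fun _ => abs_nonneg _) _) f

lemma continuous_avg (k : ℝ → ℝ) (hk : Integrable k stdGauss) :
    Continuous fun p : (ℝ × ℝ) × E => G.avg k hk p.1.1 p.1.2 p.2 := by
  refine continuous_clm_apply (A := fun x : ℝ × ℝ => G.avg k hk x.1 x.2)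
    (fun x f => G.norm_avg_le k hk x.1 x.2 f) fun f => ?_
  simp only [avg_apply]
  refine continuous_of_dominated (fun x => (G.integrable_avg hk x.1 x.2 f).1)
    (bound := fun z => ‖k z‖ * ‖f‖) (fun x => Eventually.of_forall fun z => ?_) (hk.norm.mul_const _)
    (Eventually.of_forall fun z => ?_)
  · rw [norm_smul]
    exact mul_le_mul_of_nonneg_left (G.norm_le _ _) (norm_nonneg _)
  · exact ((G.cont f).comp (by fun_prop)).const_smul _

lemma avg_commute [CompleteSpace E] (k : ℝ → ℝ) (hk : Integrable k stdGauss) (a b : ℝ) {A : E →L[ℝ] E}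
    (hA : ∀ s f, A (G.τ s f) = G.τ s (A f)) (f : E) :
    A (G.avg k hk a b f) = G.avg k hk a b (A f) := by
  rw [avg_apply, avg_apply, ← ContinuousLinearMap.integral_comp_comm _ (G.integrable_avg hk a b f)]
  simp [hA]

/-- The semigroup generated by `D² + D`. -/
def heat (t : ℝ) : E →L[ℝ] E := G.avg (fun _ => 1) (integrable_const _) t (√(2 * t))

/-- `D` composed with `heat t`, for `t > 0`. -/
def dheat (t : ℝ) : E →L[ℝ] E := (√(2 * t))⁻¹ • G.avg (fun z => z) integrable_id_stdGauss t (√(2 * t))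

/-- The first absolute moment of the standard Gaussian. -/
def gaussMoment : ℝ := ∫ z, |z| ∂stdGauss

lemma gaussMoment_nonneg : 0 ≤ gaussMoment := integral_nonneg fun _ => abs_nonneg _

lemma heat_apply (t : ℝ) (f : E) : G.heat t f = ∫ z, G.τ (t + √(2 * t) * z) f ∂stdGauss := by
  simp [heat, avg_apply]

lemma norm_heat_le (t : ℝ) (f : E) : ‖G.heat t f‖ ≤ ‖f‖ := by
  have := G.norm_avg_le (fun _ => 1) (integrable_const _) t (√(2 * t)) f
  simp only [abs_one, integral_const, probReal_univ, smul_eq_mul, mul_one, one_mul] at this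
  exact this

lemma heat_zero [CompleteSpace E] (f : E) : G.heat 0 f = f := by simp [heat_apply, G.zero]

lemma continuous_heat : Continuous fun p : ℝ × E => G.heat p.1 p.2 :=
  (G.continuous_avg (fun _ => 1) (integrable_const _)).comp
    (f := fun p : ℝ × E => ((p.1, √(2 * p.1)), p.2)) (by fun_prop)

lemma norm_dheat_le (t : ℝ) (f : E) : ‖G.dheat t f‖ ≤ (√(2 * t))⁻¹ * gaussMoment * ‖f‖ := by
  rw [dheat, smul_apply, norm_smul, Real.norm_eq_abs,
    abs_of_nonneg (by positivity), mul_assoc]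
  exact mul_le_mul_of_nonneg_left (G.norm_avg_le _ _ _ _ _) (by positivity)

lemma continuousOn_dheat : ContinuousOn (fun p : ℝ × E => G.dheat p.1 p.2) (Ioi 0 ×ˢ univ) := by
  have h1 : Continuous fun p : ℝ × E => G.avg (fun z => z) integrable_id_stdGauss p.1 (√(2 * p.1)) p.2 :=
    (G.continuous_avg (fun z => z) integrable_id_stdGauss).comp
      (f := fun p : ℝ × E => ((p.1, √(2 * p.1)), p.2)) (by fun_prop)
  refine ContinuousOn.smul (f := fun p : ℝ × E => (√(2 * p.1))⁻¹) ?_ h1.continuousOn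
  refine ContinuousOn.inv₀ (by fun_prop) ?_
  rintro ⟨t, f⟩ ⟨ht, -⟩
  have : (0:ℝ) < t := ht
  positivity

lemma heat_commute [CompleteSpace E] (t : ℝ) {A : E →L[ℝ] E}
    (hA : ∀ s f, A (G.τ s f) = G.τ s (A f)) (f : E) : A (G.heat t f) = G.heat t (A f) :=
  G.avg_commute _ _ _ _ hA f

lemma heat_τ [CompleteSpace E] (t s : ℝ) (f : E) : G.heat t (G.τ s f) = G.τ s (G.heat t f) :=
  (G.heat_commute t (fun a f => by rw [← G.add, ← G.add, add_comm]) f).symm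

/-- The mean `t` comes from the drift `D`, the variance `2 t` from `D²`. In this form the semigroup
law is the convolution rule for Gaussians. -/
lemma heat_eq_gauss (t : ℝ) (ht : 0 ≤ t) (f : E) :
    G.heat t f = ∫ y, G.τ y f ∂(gaussianReal t (2 * t).toNNReal) := by
  have h1 : gaussianReal t (2 * t).toNNReal = stdGauss.map (fun z => t + √(2 * t) * z) := by
    have := gaussianReal_map_const_mul (μ := 0) (v := 1) (√(2 * t))
    rw [show (fun z : ℝ => t + √(2 * t) * z) = (fun x => t + x) ∘ (fun z => √(2 * t) * z) from rfl,
      ← Measure.map_map (by fun_prop) (by fun_prop), this, gaussianReal_map_const_add]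
    congr 1
    · simp
    · ext; simp only [mul_one, NNReal.coe_mk, Real.coe_toNNReal _ (show (0:ℝ) ≤ 2 * t by positivity), Real.sq_sqrt (show (0:ℝ) ≤ 2 * t by positivity)]
  rw [h1, integral_map (by fun_prop) (G.cont f).aestronglyMeasurable, heat_apply]

lemma heat_add [CompleteSpace E] (s t : ℝ) (hs : 0 ≤ s) (ht : 0 ≤ t) (f : E) :
    G.heat (s + t) f = G.heat s (G.heat t f) := by
  have hb : ∀ (ν : Measure ℝ) [IsProbabilityMeasure ν], Integrable (fun y => G.τ y f) ν := fun ν _ =>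
    (integrable_const ‖f‖).mono' (G.cont f).aestronglyMeasurable
      (Eventually.of_forall fun y => G.norm_le y f)
  rw [G.heat_eq_gauss (s + t) (by positivity), G.heat_eq_gauss s hs, G.heat_eq_gauss t ht]
  have h : gaussianReal (s + t) (2 * (s + t)).toNNReal =
      gaussianReal s (2 * s).toNNReal ∗ gaussianReal t (2 * t).toNNReal := by
    rw [gaussianReal_conv_gaussianReal]
    congr 1
    rw [← Real.toNNReal_add (by positivity) (by positivity)]; congr 1; ring
  rw [h, integral_conv (h ▸ hb _)]
  refine integral_congr_ae (Eventually.of_forall fun x => ?_)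
  simp only [G.add]
  exact (ContinuousLinearMap.integral_comp_comm _ (hb _))

/-- Translating by `y` shifts the Gaussian variable by `a = y / b`, `b = √(2 t)`. By Cameron–Martin
the shift moves onto the density `exp (a z - a² / 2)`, whose derivative at `a = 0` is `z`. Nothing
is differentiated in `f`, which may be arbitrary. -/
lemma isD_heat [CompleteSpace E] {t : ℝ} (ht : 0 < t) (f : E) : IsD G.τ (G.heat t f) (G.dheat t f) := by
  set b := √(2 * t) with hbdef
  have hb : 0 < b := by positivity
  set v : ℝ → E := fun z => G.τ (t + b * z) f with hv
  have hvc : Continuous v := (G.cont f).comp (by fun_prop)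
  have hvn : ∀ z, ‖v z‖ ≤ ‖f‖ := fun z => G.norm_le _ _
  have key : ∀ y, G.τ y (G.heat t f) =
      ∫ z, Real.exp (y / b * z - (y / b) ^ 2 / 2) • v z ∂stdGauss := by
    intro y
    rw [← integral_stdGauss_shift, heat_apply, ← ContinuousLinearMap.integral_comp_comm]
    · refine integral_congr_ae (Eventually.of_forall fun z => ?_)
      simp only [hv, ← G.add]
      rw [show y + (t + √(2 * t) * z) = t + b * (z + y / b) by rw [← hbdef]; field_simp; ring]
    · simpa only [one_smul] using G.integrable_avg (k := fun _ => 1) (integrable_const _) t b f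
  have hbound : ∀ z : ℝ, ∀ a ∈ Metric.ball (0:ℝ) 1,
      ‖((z - a) * Real.exp (a * z - a ^ 2 / 2)) • v z‖ ≤ Real.exp (2 * |z|) * ‖f‖ := by
    intro z a ha
    rw [Metric.mem_ball, dist_zero_right, Real.norm_eq_abs] at ha
    rw [norm_smul, norm_mul, Real.norm_eq_abs, Real.norm_eq_abs, abs_of_pos (Real.exp_pos _)]
    refine mul_le_mul ?_ (hvn z) (norm_nonneg _) (Real.exp_pos _).le
    have h1 : |z - a| ≤ Real.exp |z| := by
      calc |z - a| ≤ |z| + |a| := abs_sub _ _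
        _ ≤ |z| + 1 := by linarith
        _ ≤ _ := Real.add_one_le_exp _
    have h2 : Real.exp (a * z - a ^ 2 / 2) ≤ Real.exp |z| := by
      apply Real.exp_le_exp.2
      have : a * z ≤ |z| := by
        calc a * z ≤ |a * z| := le_abs_self _
          _ = |a| * |z| := abs_mul _ _
          _ ≤ 1 * |z| := by gcongr
          _ = _ := one_mul _
      nlinarith [sq_nonneg a]
    calc _ ≤ Real.exp |z| * Real.exp |z| := by gcongr
      _ = _ := by rw [← Real.exp_add]; ring_nf
  have hd := hasDerivAt_integral_of_dominated_loc_of_deriv_le (𝕜 := ℝ) (μ := stdGauss) (x₀ := (0:ℝ))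
    (F := fun a z => Real.exp (a * z - a ^ 2 / 2) • v z)
    (F' := fun a z => ((z - a) * Real.exp (a * z - a ^ 2 / 2)) • v z)
    (bound := fun z => Real.exp (2 * |z|) * ‖f‖) (Metric.ball_mem_nhds 0 one_pos)
    (Eventually.of_forall fun a => by fun_prop)
    (by simpa using G.integrable_avg (k := fun _ => 1) (integrable_const _) t b f)
    (by fun_prop) (Eventually.of_forall hbound) ((integrable_exp_mul_abs 2).mul_const _)
    (Eventually.of_forall fun z a _ => by
      have h1 : HasDerivAt (fun a : ℝ => a * z - a ^ 2 / 2) (z - a) a := by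
        have := ((hasDerivAt_id a).mul_const z).sub (((hasDerivAt_id a).pow 2).div_const 2)
        refine this.congr_deriv ?_
        simp
      have h2 := h1.exp.smul_const (v z)
      rw [mul_comm] at h2
      exact h2)
  have h3 := hd.2
  have h4 : HasDerivAt (fun y : ℝ => y / b) (1 / b) 0 := (hasDerivAt_id (0:ℝ)).div_const b
  have h5 : HasDerivAt (fun n => ∫ z, Real.exp (n * z - n ^ 2 / 2) • v z ∂stdGauss)
      (∫ z, ((z - 0) * Real.exp (0 * z - 0 ^ 2 / 2)) • v z ∂stdGauss) ((fun y : ℝ => y / b) 0) := by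
    simpa using h3
  have h6 := h5.scomp (𝕜 := ℝ) (0:ℝ) h4
  unfold IsD
  simp only [key]
  refine h6.congr_deriv ?_
  simp [dheat, avg_apply, ← hbdef, hv]

lemma isD_heat_of_isD [CompleteSpace E] (t : ℝ) {f g : E} (h : IsD G.τ f g) :
    IsD G.τ (G.heat t f) (G.heat t g) :=
  isD_clm (fun s f => G.heat_τ t s f) h

lemma dheat_eq [CompleteSpace E] {t : ℝ} (ht : 0 < t) {f g : E} (h : IsD G.τ f g) :
    G.dheat t f = G.heat t g :=
  isD_unique (G.isD_heat ht f) (G.isD_heat_of_isD t h)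

/-- Differentiating `t + √(2 t) z` under the integral produces the weight `1 + z / √(2 t)` on `f'`.
The part with `z` is `dheat t f'`, which equals `heat t f''`. The derivatives are dominated on `a >
t / 2`, where `√(2 a) ≥ √t`. -/
lemma hasDerivAt_heat [CompleteSpace E] {t : ℝ} (ht : 0 < t) {f f' f'' : E} (h : IsD G.τ f f')
    (h' : IsD G.τ f' f'') : HasDerivAt (fun t => G.heat t f) (G.heat t (f'' + f')) t := by
  have hd := hasDerivAt_integral_of_dominated_loc_of_deriv_le (𝕜 := ℝ) (μ := stdGauss) (x₀ := t)
    (F := fun t z => G.τ (t + √(2 * t) * z) f)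
    (F' := fun t z => (1 + (√(2 * t))⁻¹ * z) • G.τ (t + √(2 * t) * z) f')
    (bound := fun z => (1 + (√t)⁻¹ * |z|) * ‖f'‖) (Ioi_mem_nhds (show t / 2 < t by linarith))
    (Eventually.of_forall fun a => ((G.cont f).comp (by fun_prop)).aestronglyMeasurable)
    (by simpa only [one_smul] using G.integrable_avg (k := fun _ => 1) (integrable_const _) t (√(2 * t)) f)
    (by
      have := (G.cont f').comp (show Continuous fun z => t + √(2 * t) * z by fun_prop)
      exact Continuous.aestronglyMeasurable (by fun_prop))
    (Eventually.of_forall fun z a ha => by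
      have ha' : t / 2 < a := ha
      rw [norm_smul]
      refine mul_le_mul ?_ (G.norm_le _ _) (norm_nonneg _) (by positivity)
      refine (norm_add_le _ _).trans ?_
      rw [norm_one, norm_mul, Real.norm_eq_abs, Real.norm_eq_abs, abs_of_nonneg (by positivity)]
      have : √t ≤ √(2 * a) := Real.sqrt_le_sqrt (by linarith)
      gcongr)
    (((integrable_const _).add (integrable_id_stdGauss.abs.const_mul _)).mul_const _)
    (Eventually.of_forall fun z a ha => by
      have ha' : 0 < a := lt_trans (by linarith) (show t / 2 < a from ha)
      have h1 : HasDerivAt (fun a : ℝ => a + √(2 * a) * z) (1 + (√(2 * a))⁻¹ * z) a := by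
        have h2 : HasDerivAt (fun a : ℝ => √(2 * a)) ((√(2 * a))⁻¹) a := by
          have := ((hasDerivAt_id a).const_mul 2).sqrt (by simp; positivity)
          refine this.congr_deriv ?_
          rw [mul_one, div_mul_eq_div_div, div_self two_ne_zero, one_div]
          rfl
        exact (hasDerivAt_id a).add (h2.mul_const z)
      exact (hasDerivAt_τ h (a + √(2 * a) * z)).scomp a h1)
  have h3 := hd.2
  simp only [← heat_apply] at h3
  refine h3.congr_deriv ?_
  have h4 : G.heat t (f'' + f') = G.heat t f' + G.dheat t f' := by
    rw [map_add, G.dheat_eq ht h', add_comm]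
  rw [h4, heat, dheat, smul_apply, avg_apply, avg_apply, ← integral_smul]
  have h5 := integral_add (G.integrable_avg (integrable_const (1:ℝ)) t (√(2 * t)) f')
      ((G.integrable_avg integrable_id_stdGauss t (√(2 * t)) f').smul ((√(2 * t))⁻¹))
  refine Eq.trans ?_ h5
  refine integral_congr_ae (Eventually.of_forall fun z => ?_)
  simp only [add_smul, smul_smul, one_smul, Pi.smul_apply]

/-- The time derivative is available only for positive times; continuity at `0` suffices for the
fundamental theorem. -/
lemma heat_sub_eq [CompleteSpace E] {t : ℝ} (ht : 0 ≤ t) {f f' f'' : E} (h : IsD G.τ f f')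
    (h' : IsD G.τ f' f'') : ∫ s in (0:ℝ)..t, G.heat s (f'' + f') = G.heat t f - f := by
  have hc : ∀ g, Continuous fun s => G.heat s g := fun g =>
    G.continuous_heat.comp (f := fun s => (s, g)) (by fun_prop)
  rw [intervalIntegral.integral_eq_sub_of_hasDerivAt_of_le ht (hc f).continuousOn
    (fun x hx => G.hasDerivAt_heat hx.1 h h') ((hc _).intervalIntegrable _ _), G.heat_zero]

end TransGroup

/-! ### Mild solutions of w' = D²w + Dw + f and their gain of derivatives -/

namespace TransGroup

variable {E : Type*} [NormedAddCommGroup E] [NormedSpace ℝ E] (G : TransGroup E)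

/-- Differentiation along translations commutes with integration. -/
lemma isD_integral [CompleteSpace E] {α : Type*} [MeasurableSpace α] {μ : Measure α} {g g' : α → E}
    {bound : α → ℝ} (hg : Integrable g μ) (hg' : AEStronglyMeasurable g' μ)
    (hb : ∀ᵐ s ∂μ, ‖g' s‖ ≤ bound s) (hbi : Integrable bound μ)
    (hd : ∀ᵐ s ∂μ, IsD G.τ (g s) (g' s)) : IsD G.τ (∫ s, g s ∂μ) (∫ s, g' s ∂μ) := by
  have h := hasDerivAt_integral_of_dominated_loc_of_deriv_le (𝕜 := ℝ) (μ := μ) (x₀ := (0:ℝ))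
    (F := fun y s => G.τ y (g s)) (F' := fun y s => G.τ y (g' s)) (bound := bound) univ_mem
    (Eventually.of_forall fun y => (G.τ y).continuous.comp_aestronglyMeasurable hg.1)
    (by simpa only [G.zero] using hg) ((G.τ 0).continuous.comp_aestronglyMeasurable hg')
    (hb.mono fun s hs y _ => (G.norm_le _ _).trans hs) hbi
    (hd.mono fun s hs y _ => hasDerivAt_τ hs y)
  have h2 := h.2
  simp only [G.zero] at h2
  refine h2.congr_of_eventuallyEq (Eventually.of_forall fun y => ?_)
  exact (ContinuousLinearMap.integral_comp_comm _ hg).symm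

lemma continuousOn_heat_duhamel {a t b : ℝ} {f : ℝ → E} (hf : ContinuousOn f (Icc a b))
    (htb : t ≤ b) : ContinuousOn (fun s => G.heat (t - s) (f s)) (Icc a t) :=
  G.continuous_heat.comp_continuousOn (f := fun s => (t - s, f s))
    ((by fun_prop : ContinuousOn (fun s : ℝ => t - s) (Icc a t)).prodMk
      (hf.mono (Icc_subset_Icc_right htb)))

lemma intervalIntegrable_heat_duhamel {a t b : ℝ} {f : ℝ → E} (hf : ContinuousOn f (Icc a b))
    (hat : a ≤ t) (htb : t ≤ b) : IntervalIntegrable (fun s => G.heat (t - s) (f s)) volume a t :=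
  (G.continuousOn_heat_duhamel hf htb).intervalIntegrable_of_Icc hat

/-- `w` is the mild solution of `w' = D² w + D w + f` on `[a, b]`. -/
def Mild (a b : ℝ) (w f : ℝ → E) : Prop :=
  ∀ t ∈ Icc a b, w t = G.heat (t - a) (w a) + ∫ s in a..t, G.heat (t - s) (f s)

-- The semigroup law carries `heat (t - a')` through the formula at time `a'`, and the two Duhamel
-- integrals join.
variable {G} in
lemma Mild.restart [CompleteSpace E] {a a' b : ℝ} {w f : ℝ → E} (h : G.Mild a b w f)
    (hf : ContinuousOn f (Icc a b)) (ha : a ≤ a') : G.Mild a' b w f := by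
  intro t ht
  have h1 := h t ⟨ha.trans ht.1, ht.2⟩
  have h2 := h a' ⟨ha, ht.1.trans ht.2⟩
  have i1 := G.intervalIntegrable_heat_duhamel hf (ha.trans ht.1) ht.2
  have i2 := G.intervalIntegrable_heat_duhamel hf ha (ht.1.trans ht.2)
  rw [h1, h2, map_add, ← G.heat_add _ _ (by linarith [ht.1]) (by linarith),
    ← ContinuousLinearMap.intervalIntegral_comp_comm _ i2]
  have h3 : ∫ s in a..a', G.heat (t - a') (G.heat (a' - s) (f s)) =
      ∫ s in a..a', G.heat (t - s) (f s) := by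
    refine intervalIntegral.integral_congr fun s hs => ?_
    rw [uIcc_of_le ha] at hs
    rw [← G.heat_add _ _ (by linarith [ht.1]) (by linarith [hs.2])]
    congr 2; ring
  have hsub : ∀ c ∈ Icc a t, c ∈ uIcc a t := fun c hc => by rwa [uIcc_of_le (ha.trans ht.1)]
  rw [h3, add_assoc, intervalIntegral.integral_add_adjacent_intervals]
  · congr 3; ring
  · exact i1.mono_set (uIcc_subset_uIcc (hsub _ ⟨le_rfl, ha.trans ht.1⟩) (hsub _ ⟨ha, ht.1⟩))
  · exact i1.mono_set (uIcc_subset_uIcc (hsub _ ⟨ha, ht.1⟩) (hsub _ ⟨ha.trans ht.1, le_rfl⟩))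

/-- The derivative along translations of a mild solution. -/
def dmild (a : ℝ) (w f : ℝ → E) (t : ℝ) : E :=
  G.dheat (t - a) (w a) + ∫ s in a..t, G.dheat (t - s) (f s)

/-- This is the singularity in `norm_dheat_le`. Its integrability is what lets a Duhamel integral
gain a full derivative. -/
lemma integrableOn_inv_sqrt (t a : ℝ) (hat : a ≤ t) :
    IntegrableOn (fun s => (√(2 * (t - s)))⁻¹) (Ioc a t) := by
  have h1 : IntervalIntegrable (fun x : ℝ => x ^ (-(1/2) : ℝ)) volume 0 (2 * (t - a)) :=
    intervalIntegral.intervalIntegrable_rpow' (by norm_num)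
  have h2 := (h1.comp_sub_left (2 * t)).comp_mul_left (c := 2)
  rw [show (2 * t - 0) / 2 = t by ring, show (2 * t - 2 * (t - a)) / 2 = a by ring] at h2
  have h3 := (intervalIntegrable_iff_integrableOn_Ioc_of_le hat).1 h2.symm
  refine h3.congr_fun (fun s hs => ?_) measurableSet_Ioc
  simp only
  rw [Real.sqrt_eq_rpow, ← Real.rpow_neg (by linarith [hs.2])]
  congr 1; ring

lemma continuousOn_dheat_duhamel {a t b : ℝ} {f : ℝ → E} (hf : ContinuousOn f (Icc a b))
    (htb : t ≤ b) : ContinuousOn (fun s => G.dheat (t - s) (f s)) (Ioo a t) := by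
  refine G.continuousOn_dheat.comp (f := fun s => (t - s, f s))
    ((by fun_prop : ContinuousOn (fun s : ℝ => t - s) (Ioo a t)).prodMk
      (hf.mono fun s hs => ⟨hs.1.le, hs.2.le.trans htb⟩)) fun s hs => ⟨?_, mem_univ _⟩
  exact sub_pos.2 hs.2

/-- The source need not lie in the domain of `D`: the semigroup regularizes it at every `s < t`,
with the integrable bound `(t - s)^(-1/2)`. The endpoint `s = t`, where `dheat` is no derivative, is
dropped. -/
lemma isD_duhamel [CompleteSpace E] {a t b : ℝ} {f : ℝ → E} (hf : ContinuousOn f (Icc a b))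
    (hat : a ≤ t) (htb : t ≤ b) :
    IsD G.τ (∫ s in a..t, G.heat (t - s) (f s)) (∫ s in a..t, G.dheat (t - s) (f s)) := by
  obtain ⟨C, hC⟩ := isCompact_Icc.exists_bound_of_continuousOn hf
  have hC' : ∀ s ∈ Ioo a t, ‖f s‖ ≤ C := fun s hs => hC s ⟨hs.1.le, hs.2.le.trans htb⟩
  rw [intervalIntegral.integral_of_le hat, intervalIntegral.integral_of_le hat,
    integral_Ioc_eq_integral_Ioo, integral_Ioc_eq_integral_Ioo]
  have hI := (integrableOn_inv_sqrt t a hat).mono_set Ioo_subset_Ioc_self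
  refine G.isD_integral (bound := fun s => (√(2 * (t - s)))⁻¹ * gaussMoment * C) ?_ ?_ ?_ ?_ ?_
  · exact ((intervalIntegrable_iff_integrableOn_Ioc_of_le hat).1
      (G.intervalIntegrable_heat_duhamel hf hat htb)).mono_set Ioo_subset_Ioc_self
  · exact (G.continuousOn_dheat_duhamel hf htb).aestronglyMeasurable measurableSet_Ioo
  · refine (ae_restrict_mem measurableSet_Ioo).mono fun s hs => (G.norm_dheat_le _ _).trans ?_
    have := gaussMoment_nonneg
    exact mul_le_mul_of_nonneg_left (hC' s hs) (by positivity)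
  · exact (hI.mul_const _).mul_const _
  · exact (ae_restrict_mem measurableSet_Ioo).mono fun s hs => G.isD_heat (sub_pos.2 hs.2) _

lemma isD_mild [CompleteSpace E] {a b : ℝ} {w f : ℝ → E} (h : G.Mild a b w f)
    (hf : ContinuousOn f (Icc a b)) {t : ℝ} (ht : t ∈ Ioc a b) :
    IsD G.τ (w t) (G.dmild a w f t) := by
  rw [h t ⟨ht.1.le, ht.2⟩]
  exact isD_add (G.isD_heat (sub_pos.2 ht.1) _) (G.isD_duhamel hf ht.1.le ht.2)

/-- Both the interval and the location of the singularity depend on `t`. The substitution `s = t -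
(t - a) ρ` fixes them, and dominated convergence applies with a multiple of `ρ^(-1/2)`. -/
lemma continuousOn_dmild {a b : ℝ} {w f : ℝ → E} (hf : ContinuousOn f (Icc a b)) :
    ContinuousOn (G.dmild a w f) (Ioc a b) := by
  rcases le_or_gt b a with hba | hab
  · rw [Ioc_eq_empty (not_lt.2 hba)]; exact continuousOn_empty _
  refine ContinuousOn.add ?_ ?_
  · refine G.continuousOn_dheat.comp (f := fun t => (t - a, w a)) (by fun_prop) fun t ht => ⟨?_, mem_univ _⟩
    exact sub_pos.2 ht.1
  obtain ⟨C, hC⟩ := isCompact_Icc.exists_bound_of_continuousOn hf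
  have hC0 : 0 ≤ C := (norm_nonneg _).trans (hC a ⟨le_rfl, hab.le⟩)
  have hsub : ∀ t ∈ Ioc a b, (∫ s in a..t, G.dheat (t - s) (f s)) =
      ∫ ρ in Ioc (0:ℝ) 1, (t - a) • G.dheat ((t - a) * ρ) (f (t - (t - a) * ρ)) := by
    intro t ht
    rw [← intervalIntegral.integral_of_le zero_le_one, intervalIntegral.integral_smul]
    have := intervalIntegral.smul_integral_comp_sub_mul (a := 0) (b := 1)
      (fun s => G.dheat (t - s) (f s)) (t - a) t
    simp only [sub_sub_cancel, mul_one, mul_zero, sub_zero] at this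
    exact this.symm
  refine ContinuousOn.congr ?_ hsub
  have h1 : IntegrableOn (fun x : ℝ => x ^ (-(1/2) : ℝ)) (Ioc 0 1) :=
    (intervalIntegrable_iff_integrableOn_Ioc_of_le zero_le_one).1
      (intervalIntegral.intervalIntegrable_rpow' (by norm_num))
  have hmem : ∀ t ∈ Ioc a b, ∀ ρ ∈ Ioc (0:ℝ) 1, t - (t - a) * ρ ∈ Icc a b := by
    intro t ht ρ hρ
    have h0 := sub_pos.2 ht.1
    constructor <;> nlinarith [hρ.1, hρ.2, ht.1, ht.2]
  have hcont : ∀ t ∈ Ioc a b, ContinuousOn (fun ρ => (t - a) • G.dheat ((t - a) * ρ) (f (t - (t - a) * ρ)))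
      (Ioc (0:ℝ) 1) := by
    intro t ht
    refine ContinuousOn.const_smul ?_ _
    refine G.continuousOn_dheat.comp (f := fun ρ => ((t - a) * ρ, f (t - (t - a) * ρ)))
      (ContinuousOn.prodMk (by fun_prop) (hf.comp (by fun_prop) fun ρ hρ => hmem t ht ρ hρ))
      fun ρ hρ => ⟨?_, mem_univ _⟩
    exact mul_pos (sub_pos.2 ht.1) hρ.1
  refine continuousOn_of_dominated
    (bound := fun ρ => (√(b - a) * gaussMoment * C) * ρ ^ (-(1/2) : ℝ)) ?_ ?_ (h1.const_mul _) ?_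
  · exact fun t ht => (hcont t ht).aestronglyMeasurable measurableSet_Ioc
  · intro t ht
    refine (ae_restrict_mem measurableSet_Ioc).mono fun ρ hρ => ?_
    have hta := sub_pos.2 ht.1
    have hm := gaussMoment_nonneg
    have e1 : (t - a) * (√(2 * ((t - a) * ρ)))⁻¹ ≤ √(b - a) * ρ ^ (-(1/2) : ℝ) := by
      rw [Real.rpow_neg hρ.1.le, ← Real.sqrt_eq_rpow, Real.sqrt_mul (by norm_num), Real.sqrt_mul hta.le,
        mul_inv, mul_inv]
      have e2 : (t - a) * (√(t - a))⁻¹ = √(t - a) := by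
        rw [← div_eq_mul_inv]; exact Real.div_sqrt
      have e3 : (√2)⁻¹ ≤ 1 := inv_le_one_of_one_le₀ (Real.one_le_sqrt.2 (by norm_num))
      have e4 : √(t - a) ≤ √(b - a) := Real.sqrt_le_sqrt (by linarith [ht.2])
      calc (t - a) * ((√2)⁻¹ * ((√(t - a))⁻¹ * (√ρ)⁻¹))
          = (√2)⁻¹ * (((t - a) * (√(t - a))⁻¹) * (√ρ)⁻¹) := by ring
        _ ≤ 1 * (√(b - a) * (√ρ)⁻¹) := by rw [e2]; gcongr
        _ = _ := one_mul _
    rw [norm_smul, Real.norm_eq_abs, abs_of_pos hta]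
    calc (t - a) * ‖G.dheat ((t - a) * ρ) (f (t - (t - a) * ρ))‖
        ≤ (t - a) * ((√(2 * ((t - a) * ρ)))⁻¹ * gaussMoment * C) := by
          gcongr
          refine (G.norm_dheat_le _ _).trans ?_
          exact mul_le_mul_of_nonneg_left (hC _ (hmem t ht ρ hρ)) (by positivity)
      _ = ((t - a) * (√(2 * ((t - a) * ρ)))⁻¹) * (gaussMoment * C) := by ring
      _ ≤ (√(b - a) * ρ ^ (-(1/2) : ℝ)) * (gaussMoment * C) := by gcongr
      _ = _ := by ring
  · refine (ae_restrict_mem measurableSet_Ioc).mono fun ρ hρ => ?_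
    refine ContinuousOn.smul (by fun_prop) ?_
    refine G.continuousOn_dheat.comp (f := fun t => ((t - a) * ρ, f (t - (t - a) * ρ)))
      (ContinuousOn.prodMk (by fun_prop) (hf.comp (by fun_prop) fun t ht => hmem t ht ρ hρ))
      fun t ht => ⟨?_, mem_univ _⟩
    exact mul_pos (sub_pos.2 ht.1) hρ.1

/-- Applying `D` to a mild solution whose source lies in the domain of `D`. -/
lemma mild_deriv [CompleteSpace E] {a b : ℝ} {w f v f' : ℝ → E} (h : G.Mild a b w f)
    (hf : ContinuousOn f (Icc a b)) (hf' : ContinuousOn f' (Icc a b))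
    (hv : ∀ t ∈ Icc a b, IsD G.τ (w t) (v t)) (hff : ∀ t ∈ Icc a b, IsD G.τ (f t) (f' t)) :
    G.Mild a b v f' := by
  intro t ht
  have h1 := hv t ht
  rw [h t ht] at h1
  refine isD_unique h1 (isD_add (G.isD_heat_of_isD _ (hv a ⟨le_rfl, ht.1.trans ht.2⟩)) ?_)
  obtain ⟨C, hC⟩ := isCompact_Icc.exists_bound_of_continuousOn hf'
  rw [intervalIntegral.integral_of_le ht.1, intervalIntegral.integral_of_le ht.1]
  have hint : ∀ g : ℝ → E, ContinuousOn g (Icc a b) →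
      IntegrableOn (fun s => G.heat (t - s) (g s)) (Ioc a t) := fun g hg =>
    (intervalIntegrable_iff_integrableOn_Ioc_of_le ht.1).1
      (G.intervalIntegrable_heat_duhamel hg ht.1 ht.2)
  refine G.isD_integral (bound := fun _ => C) (hint f hf) (hint f' hf').1 ?_ (integrable_const _) ?_
  · exact (ae_restrict_mem measurableSet_Ioc).mono fun s hs =>
      (G.norm_heat_le _ _).trans (hC s ⟨hs.1.le, hs.2.trans ht.2⟩)
  · exact (ae_restrict_mem measurableSet_Ioc).mono fun s hs =>
      G.isD_heat_of_isD _ (hff s ⟨hs.1.le, hs.2.trans ht.2⟩)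

/-- The tangent map of a nonlinearity. -/
def tangent (F : E → E) (p : E × E) : E × E := (F p.1, fderiv ℝ F p.1 p.2)

variable {G}

/-- By equivariance, `τ y (F f) = F (τ y f)`, so this is the chain rule at `y = 0`. -/
lemma isD_comp {F : E → E} {Ω : Set E} (hΩ : IsOpen Ω) (hF : DifferentiableOn ℝ F Ω)
    (hequi : ∀ s, ∀ f ∈ Ω, F (G.τ s f) = G.τ s (F f)) {f g : E} (hf : f ∈ Ω) (h : IsD G.τ f g) :
    IsD G.τ (F f) (fderiv ℝ F f g) := by
  have h1 : HasFDerivAt F (fderiv ℝ F f) (G.τ 0 f) := by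
    rw [G.zero]; exact (hF.differentiableAt (hΩ.mem_nhds hf)).hasFDerivAt
  have h2 := h1.comp_hasDerivAt (f := fun y => G.τ y f) 0 h
  refine h2.congr_of_eventuallyEq (Eventually.of_forall fun y => ?_)
  exact (hequi y f hf).symm

lemma contDiffOn_tangent {F : E → E} {Ω : Set E} (hΩ : IsOpen Ω) (hF : ContDiffOn ℝ ∞ F Ω) :
    ContDiffOn ℝ ∞ (tangent F) (Ω ×ˢ univ) := by
  refine ContDiffOn.prodMk (hF.comp contDiffOn_fst fun p hp => hp.1) ?_
  refine ContDiffOn.clm_apply ?_ contDiffOn_snd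
  exact (hF.fderiv_of_isOpen hΩ (by simp)).comp contDiffOn_fst fun p hp => hp.1

/-- Differentiate the identity `F ∘ τ s = τ s ∘ F`, valid on an open set. The tangent system is
therefore of the same kind as the original equation, which allows smoothing to be iterated. -/
lemma tangent_equivariant {F : E → E} {Ω : Set E} (hΩ : IsOpen Ω) (hF : DifferentiableOn ℝ F Ω)
    (hτ : ∀ s, ∀ f ∈ Ω, G.τ s f ∈ Ω)
    (hequi : ∀ s, ∀ f ∈ Ω, F (G.τ s f) = G.τ s (F f)) (s : ℝ) (p : E × E) (hp : p ∈ Ω ×ˢ univ) :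
    tangent F ((G.prod G).τ s p) = (G.prod G).τ s (tangent F p) := by
  have hp1 : p.1 ∈ Ω := hp.1
  refine Prod.ext (hequi s _ hp1) ?_
  have h1 : HasFDerivAt (fun f => F (G.τ s f)) ((fderiv ℝ F (G.τ s p.1)).comp (G.τ s)) p.1 :=
    ((hF.differentiableAt (hΩ.mem_nhds (hτ s _ hp1))).hasFDerivAt).comp p.1 (G.τ s).hasFDerivAt
  have h2 : HasFDerivAt (fun f => G.τ s (F f)) ((G.τ s).comp (fderiv ℝ F p.1)) p.1 :=
    (G.τ s).hasFDerivAt.comp p.1 (hF.differentiableAt (hΩ.mem_nhds hp1)).hasFDerivAt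
  have h3 := (h2.congr_of_eventuallyEq ((hΩ.eventually_mem hp1).mono fun f hf => hequi s f hf)).unique h1
  exact (DFunLike.congr_fun h3 p.2).symm

/-- A mild solution of a smooth translation invariant equation gains one derivative. -/
theorem mild_smoothing [CompleteSpace E] {F : E → E} {Ω : Set E} (hΩ : IsOpen Ω)
    (hF : ContDiffOn ℝ ∞ F Ω) (hequi : ∀ s, ∀ f ∈ Ω, F (G.τ s f) = G.τ s (F f)) {a b : ℝ}
    {w : ℝ → E} (hw : ContinuousOn w (Icc a b)) (hwΩ : ∀ t ∈ Icc a b, w t ∈ Ω)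
    (h : G.Mild a b w fun t => F (w t)) :
    (∀ t ∈ Ioc a b, IsD G.τ (w t) (G.D (w t))) ∧ ContinuousOn (fun t => G.D (w t)) (Ioc a b) ∧
    ∀ a' ∈ Ioo a b, (G.prod G).Mild a' b (fun t => (w t, G.D (w t)))
      fun t => tangent F (w t, G.D (w t)) := by
  have hf : ContinuousOn (fun t => F (w t)) (Icc a b) := hF.continuousOn.comp hw hwΩ
  have h1 : ∀ t ∈ Ioc a b, G.D (w t) = G.dmild a w (fun t => F (w t)) t := fun t ht =>
    D_eq (G.isD_mild h hf ht)
  have h2 : ∀ t ∈ Ioc a b, IsD G.τ (w t) (G.D (w t)) := fun t ht => by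
    rw [h1 t ht]; exact G.isD_mild h hf ht
  have h3 : ContinuousOn (fun t => G.D (w t)) (Ioc a b) := (G.continuousOn_dmild hf).congr h1
  have hFd : DifferentiableOn ℝ F Ω := hF.differentiableOn (by simp)
  refine ⟨h2, h3, fun a' ha' => ?_⟩
  have hsub : Icc a' b ⊆ Ioc a b := fun t ht => ⟨ha'.1.trans_le ht.1, ht.2⟩
  have hsub' : Icc a' b ⊆ Icc a b := hsub.trans Ioc_subset_Icc_self
  -- The initial value `w a` need not be differentiable, so the system for the pair starts at a
  -- later time `a'`.
  have h4 := h.restart hf ha'.1.le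
  have hT : ContinuousOn (fun t => tangent F (w t, G.D (w t))) (Icc a' b) :=
    (contDiffOn_tangent hΩ hF).continuousOn.comp ((hw.mono hsub').prodMk (h3.mono hsub))
      fun t ht => ⟨hwΩ t (hsub' ht), mem_univ _⟩
  have h5 : G.Mild a' b (fun t => G.D (w t)) fun t => fderiv ℝ F (w t) (G.D (w t)) :=
    G.mild_deriv h4 (hf.mono hsub') (continuous_snd.comp_continuousOn hT) (fun t ht => h2 t (hsub ht))
      fun t ht => isD_comp hΩ hFd hequi (hwΩ t (hsub' ht)) (h2 t (hsub ht))
  have hheat : ∀ r (p : E × E), (G.prod G).heat r p = (G.heat r p.1, G.heat r p.2) := by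
    intro r p
    have hi : ∀ f : E, Integrable (fun z => G.τ (r + √(2 * r) * z) f) stdGauss := fun f => by
      simpa only [one_smul] using G.integrable_avg (k := fun _ => 1) (integrable_const _) r (√(2 * r)) f
    simp only [heat_apply]
    exact integral_pair (hi p.1) (hi p.2)
  intro t ht
  simp only [hheat, tangent]
  have i1 := G.intervalIntegrable_heat_duhamel (hf.mono hsub') ht.1 ht.2
  have i2 := G.intervalIntegrable_heat_duhamel (continuous_snd.comp_continuousOn hT) ht.1 ht.2
  rw [intervalIntegral.integral_of_le ht.1]
  have i3 := integral_pair ((intervalIntegrable_iff_integrableOn_Ioc_of_le ht.1).1 i1)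
    ((intervalIntegrable_iff_integrableOn_Ioc_of_le ht.1).1 i2)
  refine Eq.trans ?_ (congrArg _ i3.symm)
  rw [← intervalIntegral.integral_of_le ht.1, ← intervalIntegral.integral_of_le ht.1]
  exact Prod.ext (h4 t ht) (h5 t ht)

/-- Mild solutions with a source in the domain of `D` are differentiable in time. -/
theorem hasDerivAt_mild [CompleteSpace E] {a b : ℝ} {w w' w'' f : ℝ → E} (h : G.Mild a b w f)
    (hf : ContinuousOn f (Icc a b)) (hw : ∀ t ∈ Icc a b, IsD G.τ (w t) (w' t))
    (hw' : ∀ t ∈ Icc a b, IsD G.τ (w' t) (w'' t)) (hwc : ContinuousOn w' (Icc a b))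
    (hwc' : ContinuousOn w'' (Icc a b)) {t : ℝ} (ht : t ∈ Ioo a b) :
    HasDerivAt w (w'' t + w' t + f t) t := by
  set g : ℝ → E := fun t => w'' t + w' t with hg
  have hgc : ContinuousOn g (Icc a b) := hwc'.add hwc
  -- The free part `heat (t - s) (w s) - w s` is itself the integral of `heat (r - s) (g s)`. The
  -- increment is thus one integral, whose integrand is close to `g t + f t` for nearby times.
  have key : ∀ s ∈ Icc a b, ∀ t ∈ Icc a b, s ≤ t →
      IntervalIntegrable (fun r => G.heat (r - s) (g s) + G.heat (t - r) (f r)) volume s t ∧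
      w t - w s = ∫ r in s..t, (G.heat (r - s) (g s) + G.heat (t - r) (f r)) := by
    intro s hs t ht hst
    have hsub : Icc s b ⊆ Icc a b := Icc_subset_Icc_left hs.1
    have i1 : Continuous fun r => G.heat (r - s) (g s) :=
      G.continuous_heat.comp (f := fun r => (r - s, g s)) (by fun_prop)
    have i2 := G.intervalIntegrable_heat_duhamel (hf.mono hsub) hst ht.2
    refine ⟨(i1.intervalIntegrable _ _).add i2, ?_⟩
    rw [intervalIntegral.integral_add (i1.intervalIntegrable _ _) i2,
      (h.restart hf hs.1) t ⟨hst, ht.2⟩,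
      intervalIntegral.integral_comp_sub_right (fun r => G.heat r (g s)), sub_self,
      G.heat_sub_eq (sub_nonneg.2 hst) (hw s hs) (hw' s hs)]
    abel
  have hmem := Icc_mem_nhds ht.1 ht.2
  have hL1 : ContinuousAt (fun p : ℝ × ℝ => G.heat p.1 (g p.2)) (0, t) := by
    refine G.continuous_heat.continuousAt.comp (f := fun p : ℝ × ℝ => (p.1, g p.2)) ?_
    have h2 : ContinuousAt g ((0, t) : ℝ × ℝ).2 := hgc.continuousAt hmem
    exact continuousAt_fst.prodMk (h2.comp continuousAt_snd)
  have hL2 : ContinuousAt (fun p : ℝ × ℝ => G.heat p.1 (f p.2)) (0, t) := by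
    refine G.continuous_heat.continuousAt.comp (f := fun p : ℝ × ℝ => (p.1, f p.2)) ?_
    have h2 : ContinuousAt f ((0, t) : ℝ × ℝ).2 := hf.continuousAt hmem
    exact continuousAt_fst.prodMk (h2.comp continuousAt_snd)
  rw [hasDerivAt_iff_isLittleO, Asymptotics.isLittleO_iff]
  intro ε hε
  obtain ⟨δ₁, hδ₁, h1⟩ := Metric.continuousAt_iff.1 hL1 (ε / 2) (by positivity)
  obtain ⟨δ₂, hδ₂, h2⟩ := Metric.continuousAt_iff.1 hL2 (ε / 2) (by positivity)
  simp only [G.heat_zero] at h1 h2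
  have hnear : ∀ r σ : ℝ, |r| < min δ₁ δ₂ → |σ - t| < min δ₁ δ₂ →
      ‖G.heat r (g σ) - g t‖ < ε / 2 ∧ ‖G.heat r (f σ) - f t‖ < ε / 2 := by
    intro r σ hr hσ
    rw [← dist_eq_norm, ← dist_eq_norm]
    refine ⟨h1 (x := (r, σ)) ?_, h2 (x := (r, σ)) ?_⟩ <;>
      · rw [Prod.dist_eq, max_lt_iff, Real.dist_eq, Real.dist_eq, sub_zero]
        constructor <;> [skip; skip] <;>
        first
        | exact hr.trans_le (min_le_left _ _)
        | exact hσ.trans_le (min_le_left _ _)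
        | exact hr.trans_le (min_le_right _ _)
        | exact hσ.trans_le (min_le_right _ _)
  -- The base point `t` sits between `s` and `t'`; taking it equal to either end gives the two
  -- one-sided estimates.
  have main : ∀ s ∈ Icc a b, ∀ t' ∈ Icc a b, s ≤ t → t ≤ t' → t' - s < min δ₁ δ₂ →
      ‖w t' - w s - (t' - s) • (w'' t + w' t + f t)‖ ≤ ε * (t' - s) := by
    intro s hs t' ht' hst htt hd
    obtain ⟨hi, he⟩ := key s hs t' ht' (hst.trans htt)
    rw [he, ← intervalIntegral.integral_const, ← intervalIntegral.integral_sub hi (by simp)]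
    have := intervalIntegral.norm_integral_le_of_norm_le_const (a := s) (b := t') (C := ε)
      (f := fun r => G.heat (r - s) (g s) + G.heat (t' - r) (f r) - (w'' t + w' t + f t)) ?_
    · rwa [abs_of_nonneg (by linarith)] at this
    intro r hr
    rw [uIoc_of_le (hst.trans htt)] at hr
    have n1 := (hnear (r - s) s (by rw [abs_of_nonneg (by linarith [hr.1])]; linarith [hr.2])
      (by rw [abs_of_nonpos (by linarith)]; linarith)).1
    have n2 := (hnear (t' - r) r (by rw [abs_of_nonneg (by linarith [hr.2])]; linarith [hr.1])
      (by rw [abs_lt]; constructor <;> linarith [hr.1, hr.2])).2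
    calc _ = ‖(G.heat (r - s) (g s) - g t) + (G.heat (t' - r) (f r) - f t)‖ := by
          simp only [hg]; congr 1; abel
      _ ≤ _ := norm_add_le _ _
      _ ≤ ε := by linarith
  have hδ : 0 < min δ₁ δ₂ := lt_min hδ₁ hδ₂
  filter_upwards [hmem, Metric.ball_mem_nhds t hδ] with y hy hyd
  rw [Metric.mem_ball, Real.dist_eq] at hyd
  have htm : t ∈ Icc a b := ⟨ht.1.le, ht.2.le⟩
  rw [Real.norm_eq_abs]
  rcases le_total t y with hty | hty
  · have := main t htm y hy le_rfl hty (by rwa [abs_of_nonneg (by linarith)] at hyd)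
    rwa [abs_of_nonneg (by linarith)]
  · have := main y hy t htm hty le_rfl (by rw [abs_of_nonpos (by linarith)] at hyd; linarith)
    rw [abs_of_nonpos (by linarith), neg_sub]
    refine le_trans (le_of_eq ?_) this
    rw [← norm_neg]
    congr 1
    rw [← neg_sub t y, neg_smul]
    abel

end TransGroup

/-! ### L¹ and bounded continuous functions: translation, primitive, product -/

/-- Bounded continuous functions on the line. -/
abbrev BC : Type := ℝ →ᵇ ℝ

lemma L1.integrable (f : L1) : Integrable (f : ℝ → ℝ) := L1.integrable_coeFn f

lemma L1.norm_eq (f : L1) : ‖f‖ = ∫ x, |f x| := by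
  simpa using L1.norm_eq_integral_norm f

lemma measurePreserving_add (y : ℝ) : MeasurePreserving (fun x : ℝ => x + y) volume volume :=
  measurePreserving_add_right volume y

/-- Translation on `L¹`. -/
def trL : TransGroup L1 where
  τ y := (Lp.compMeasurePreservingₗᵢ ℝ (fun x : ℝ => x + y) (measurePreserving_add y)).toContinuousLinearMap
  zero f := by
    refine Lp.ext ?_
    refine (Lp.coeFn_compMeasurePreserving f (measurePreserving_add 0)).trans ?_
    simp [Function.comp_def]
  add s t f := by
    refine Lp.ext ?_
    refine (Lp.coeFn_compMeasurePreserving f (measurePreserving_add (s + t))).trans ?_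
    have h1 := Lp.coeFn_compMeasurePreserving
      (Lp.compMeasurePreserving _ (measurePreserving_add t) f) (measurePreserving_add s)
    have h2 := (measurePreserving_add s).quasiMeasurePreserving.ae_eq_comp
      (Lp.coeFn_compMeasurePreserving f (measurePreserving_add t))
    refine EventuallyEq.trans ?_ (h1.trans h2).symm
    refine Eventually.of_forall fun x => ?_
    simp [add_assoc]
  norm_le s f := (Lp.norm_compMeasurePreserving f (measurePreserving_add s)).le
  cont f := by
    have h : Continuous fun y : ℝ => (⟨fun x : ℝ => x + y, by fun_prop⟩ : C(ℝ, ℝ)) :=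
      (ContinuousMap.mk (fun p : ℝ × ℝ => p.2 + p.1) (by fun_prop)).curry.continuous
    exact Continuous.compMeasurePreservingLp (f := fun _ => f) continuous_const h
      measurePreserving_add ENNReal.one_ne_top

lemma trL_ae (y : ℝ) (f : L1) : trL.τ y f =ᵐ[volume] fun x => f (x + y) :=
  Lp.coeFn_compMeasurePreserving f (measurePreserving_add y)

/-- Translation on bounded continuous functions. -/
def trB (y : ℝ) : BC →L[ℝ] BC :=
  LinearMap.mkContinuous
    { toFun := fun f => f.compContinuous ⟨fun x => x + y, by fun_prop⟩
      map_add' := fun _ _ => rfl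
      map_smul' := fun _ _ => rfl } 1 fun f => by
    rw [one_mul]
    exact (BoundedContinuousFunction.norm_le (norm_nonneg _)).2 fun x => f.norm_coe_le_norm _

@[simp] lemma trB_apply (y : ℝ) (f : BC) (x : ℝ) : trB y f x = f (x + y) := rfl

lemma trB_zero (f : BC) : trB 0 f = f := by ext; simp
lemma trB_one (y : ℝ) : trB y 1 = 1 := rfl
lemma trB_mul (y : ℝ) (f g : BC) : trB y (f * g) = trB y f * trB y g := rfl

lemma norm_setIntegral_le (f : L1) (s : Set ℝ) : |∫ y in s, f y| ≤ ‖f‖ := by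
  rw [L1.norm_eq]
  calc |∫ y in s, f y| ≤ ∫ y in s, |f y| := abs_integral_le_integral_abs
    _ ≤ ∫ y, |f y| := setIntegral_le_integral f.integrable.abs (Eventually.of_forall fun _ => abs_nonneg _)

lemma continuous_primitive_Iic {f : ℝ → ℝ} (hf : Integrable f) :
    Continuous fun x => ∫ y in Iic x, f y := by
  have h : ∀ x, ∫ y in Iic x, f y = (∫ y in Iic (0:ℝ), f y) + ∫ y in (0:ℝ)..x, f y := fun x => by
    rw [← intervalIntegral.integral_Iic_sub_Iic hf.integrableOn hf.integrableOn]; ring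
  rw [funext h]
  exact continuous_const.add (intervalIntegral.continuous_primitive (fun a b => hf.intervalIntegrable) 0)

/-- The primitive vanishing at `-∞`. -/
def I : L1 →L[ℝ] BC :=
  LinearMap.mkContinuous
    { toFun := fun f => BoundedContinuousFunction.ofNormedAddCommGroup (fun x => ∫ y in Iic x, f y)
        (continuous_primitive_Iic f.integrable) ‖f‖ fun x => norm_setIntegral_le f _
      map_add' := fun f g => by
        ext x
        simp only [BoundedContinuousFunction.coe_ofNormedAddCommGroup, BoundedContinuousFunction.coe_add,
          Pi.add_apply]
        rw [← integral_add f.integrable.integrableOn g.integrable.integrableOn]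
        exact integral_congr_ae (ae_restrict_of_ae (Lp.coeFn_add f g))
      map_smul' := fun c f => by
        ext x
        simp only [BoundedContinuousFunction.coe_ofNormedAddCommGroup, BoundedContinuousFunction.coe_smul,
          RingHom.id_apply]
        rw [← integral_smul]
        exact integral_congr_ae (ae_restrict_of_ae (Lp.coeFn_smul c f)) } 1 fun f => by
    rw [one_mul]
    exact (BoundedContinuousFunction.norm_le (norm_nonneg _)).2 fun x => norm_setIntegral_le f _

lemma I_apply (f : L1) (x : ℝ) : I f x = ∫ y in Iic x, f y := rfl

lemma abs_I_le (f : L1) (x : ℝ) : |I f x| ≤ ‖f‖ := norm_setIntegral_le f _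

lemma I_τ (y : ℝ) (f : L1) : I (trL.τ y f) = trB y (I f) := by
  ext x
  rw [trB_apply, I_apply, I_apply, integral_congr_ae (ae_restrict_of_ae (trL_ae y f))]
  have := (measurePreserving_add y).setIntegral_preimage_emb (measurableEmbedding_addRight y) f (Iic (x + y))
  rw [← this]
  congr 2
  ext z; simp

lemma tendsto_I_atBot (f : L1) : Tendsto (I f) atBot (𝓝 0) :=
  tendsto_integral_Iic_zero tendsto_id

lemma hasDerivAt_I_ae (f : L1) : ∀ᵐ x, HasDerivAt (I f) (f x) x := by
  filter_upwards [LocallyIntegrable.ae_hasDerivAt_integral f.integrable.locallyIntegrable] with x hx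
  have h : ∀ x, I f x = (∫ y in Iic (0:ℝ), f y) + ∫ y in (0:ℝ)..x, f y := fun x => by
    rw [← intervalIntegral.integral_Iic_sub_Iic f.integrable.integrableOn f.integrable.integrableOn,
      I_apply]; ring
  exact ((hx 0).const_add _).congr_of_eventuallyEq (Eventually.of_forall h)

lemma integrable_BC_mul (b : BC) (f : L1) : Integrable fun x => b x * f x :=
  f.integrable.bdd_mul (c := ‖b‖) b.continuous.aestronglyMeasurable
    (Eventually.of_forall fun x => b.norm_coe_le_norm x)

/-- Multiplication of an integrable function by a bounded continuous one. -/
def mul : BC →L[ℝ] L1 →L[ℝ] L1 :=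
  LinearMap.mkContinuous₂
    (LinearMap.mk₂ ℝ (fun b f => (integrable_BC_mul b f).toL1 _)
      (fun b c f => by
        rw [← Integrable.toL1_add]
        congr 1
        ext x; simp [add_mul])
      (fun a b f => by
        rw [← Integrable.toL1_smul]
        congr 1
        ext x; simp [mul_assoc])
      (fun b f g => by
        rw [← Integrable.toL1_add, Integrable.toL1_eq_toL1_iff]
        filter_upwards [Lp.coeFn_add f g] with x hx
        rw [hx, Pi.add_apply, Pi.add_apply, mul_add])
      (fun a b f => by
        rw [← Integrable.toL1_smul, Integrable.toL1_eq_toL1_iff]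
        filter_upwards [Lp.coeFn_smul a f] with x hx
        rw [hx, Pi.smul_apply, smul_eq_mul, smul_eq_mul, mul_left_comm])) 1 fun b f => by
    rw [one_mul, LinearMap.mk₂_apply, L1.norm_eq, L1.norm_eq, ← integral_const_mul,
      integral_congr_ae ((Integrable.coeFn_toL1 (integrable_BC_mul b f)).mono fun x hx => congrArg abs hx)]
    refine integral_mono_ae (integrable_BC_mul b f).norm (f.integrable.abs.const_mul _)
      (Eventually.of_forall fun x => ?_)
    simp only [abs_mul]
    exact mul_le_mul_of_nonneg_right (b.norm_coe_le_norm x) (abs_nonneg _)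

/-- Integration against a bounded measurable function. -/
def pairM (s : ℝ → ℝ) (hs : Measurable s) (h1 : ∀ x, |s x| ≤ 1) : L1 →L[ℝ] ℝ :=
  have hi : ∀ f : L1, Integrable fun x => s x * f x := fun f =>
    f.integrable.bdd_mul (c := 1) hs.aestronglyMeasurable (Eventually.of_forall h1)
  LinearMap.mkContinuous
    { toFun := fun f => ∫ x, s x * f x
      map_add' := fun f g => by
        rw [← integral_add (hi f) (hi g)]
        refine integral_congr_ae ?_
        filter_upwards [Lp.coeFn_add f g] with x hx
        rw [hx, Pi.add_apply, mul_add]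
      map_smul' := fun c f => by
        rw [RingHom.id_apply, smul_eq_mul, ← integral_const_mul]
        refine integral_congr_ae ?_
        filter_upwards [Lp.coeFn_smul c f] with x hx
        rw [hx, Pi.smul_apply, smul_eq_mul]; ring } 1 fun f => by
    rw [one_mul, L1.norm_eq]
    refine norm_integral_le_of_norm_le f.integrable.abs (Eventually.of_forall fun x => ?_)
    rw [norm_mul]
    exact mul_le_of_le_one_left (abs_nonneg _) (h1 x)

lemma pairM_apply (s : ℝ → ℝ) (hs : Measurable s) (h1 : ∀ x, |s x| ≤ 1) (f : L1) :
    pairM s hs h1 f = ∫ x, s x * f x := rfl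

lemma pairM_le (s : ℝ → ℝ) (hs : Measurable s) (h1 : ∀ x, |s x| ≤ 1) (f : L1) :
    pairM s hs h1 f ≤ ‖f‖ := by
  rw [pairM_apply, L1.norm_eq]
  refine (Real.le_norm_self _).trans (norm_integral_le_of_norm_le f.integrable.abs (Eventually.of_forall fun x => ?_))
  rw [norm_mul]
  exact mul_le_of_le_one_left (abs_nonneg _) (h1 x)

lemma mul_ae (b : BC) (f : L1) : mul b f =ᵐ[volume] fun x => b x * f x :=
  Integrable.coeFn_toL1 (integrable_BC_mul b f)

lemma norm_mul_le' (b : BC) (f : L1) : ‖mul b f‖ ≤ ‖b‖ * ‖f‖ := by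
  have := (mul b).le_opNorm f
  refine this.trans (mul_le_mul_of_nonneg_right ?_ (norm_nonneg _))
  have := mul.le_of_opNorm_le (LinearMap.mkContinuous₂_norm_le _ zero_le_one _) b
  simpa using this

lemma mul_τ (y : ℝ) (b : BC) (f : L1) : trL.τ y (mul b f) = mul (trB y b) (trL.τ y f) := by
  refine Lp.ext ?_
  filter_upwards [trL_ae y (mul b f), trL_ae y f, mul_ae (trB y b) (trL.τ y f),
    (measurePreserving_add y).quasiMeasurePreserving.ae_eq_comp (mul_ae b f)] with x h1 h2 h3 h4
  rw [h1, h3, h2]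
  exact h4

lemma mul_mul_apply (b c : BC) (f : L1) : mul b (mul c f) = mul (b * c) f := by
  refine Lp.ext ?_
  filter_upwards [mul_ae b (mul c f), mul_ae c f, mul_ae (b * c) f] with x h1 h2 h3
  rw [h1, h2, h3, BoundedContinuousFunction.mul_apply, mul_assoc]

lemma one_mul_apply (f : L1) : mul 1 f = f := by
  refine Lp.ext ?_
  filter_upwards [mul_ae 1 f] with x h1
  rw [h1]; simp

/-- Evaluation of `I (τ y f)` at `x` is `I f (x + y)`, so differentiability along translations in
`L¹` becomes classical differentiability of the primitive at every point. Lebesgue differentiation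
gives the derivative `f x` almost everywhere, whence `f = I g`. -/
lemma hasDerivAt_I {f g : L1} (h : IsD trL.τ f g) (x : ℝ) : HasDerivAt (I f) (I g x) x := by
  have h1 := (I.hasFDerivAt (x := trL.τ 0 f)).comp_hasDerivAt (f := fun y => trL.τ y f) 0 h
  have h2 := (BoundedContinuousFunction.evalCLM ℝ x).hasFDerivAt.comp_hasDerivAt
    (f := I ∘ fun y => trL.τ y f) 0 h1
  have h3 : HasDerivAt (fun y => I f (x + y)) (I g x) (x - x) := by
    rw [sub_self]
    refine h2.congr_of_eventuallyEq (Eventually.of_forall fun y => ?_)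
    simp [I_τ]
  have h4 := HasDerivAt.scomp (h := fun z => z - x) x h3 ((hasDerivAt_id' x).sub_const x)
  rw [one_smul] at h4
  refine h4.congr_of_eventuallyEq (Eventually.of_forall fun z => ?_)
  simp

/-- An element of the domain of `D` is the primitive of its derivative. -/
lemma isD_ae_eq {f g : L1} (h : IsD trL.τ f g) : f =ᵐ[volume] I g := by
  filter_upwards [hasDerivAt_I_ae f] with x hx
  exact hx.unique (hasDerivAt_I h x)

lemma isD_I {f g : L1} (h : IsD trL.τ f g) : IsD trB (I f) (I g) := by
  have h1 := (I.hasFDerivAt (x := trL.τ 0 f)).comp_hasDerivAt (f := fun y => trL.τ y f) 0 h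
  refine h1.congr_of_eventuallyEq (Eventually.of_forall fun y => ?_)
  simp [I_τ]

lemma isD_one_add_I {f g : L1} (h : IsD trL.τ f g) : IsD trB (1 + I f) (I g) := by
  have h1 := (isD_I h).const_add (1 : BC)
  refine h1.congr_of_eventuallyEq (Eventually.of_forall fun y => ?_)
  simp [trB_one]

lemma isD_mul {b b' : BC} {f f' : L1} (hb : IsD trB b b') (hf : IsD trL.τ f f') :
    IsD trL.τ (mul b f) (mul b' f + mul b f') := by
  have h1 : HasDerivAt (fun y => mul (trB y b)) (mul b') 0 :=
    mul.hasFDerivAt.comp_hasDerivAt (f := fun y => trB y b) 0 hb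
  have h2 := h1.clm_apply hf
  simp only [trL.zero, trB_zero] at h2
  refine h2.congr_of_eventuallyEq (Eventually.of_forall fun y => ?_)
  exact mul_τ y b f

lemma inverse_eq_of_mul_eq_one {R : Type*} [CommRing R] {b c : R} (h : c * b = 1) :
    Ring.inverse b = c := by
  have hu : IsUnit b := IsUnit.of_mul_eq_one c (by rw [mul_comm, h])
  rw [← one_mul (Ring.inverse b), ← h, mul_assoc, Ring.mul_inverse_cancel _ hu, mul_one]

lemma isD_inverse {b b' : BC} (hb : IsD trB b b') (hu : IsUnit b) :
    IsD trB (Ring.inverse b) (-(Ring.inverse b * Ring.inverse b * b')) := by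
  obtain ⟨v, rfl⟩ := hu
  have h1 : HasFDerivAt (𝕜 := ℝ) (E := BC) (F := BC) Ring.inverse
      (-ContinuousLinearMap.mulLeftRight ℝ BC ↑v⁻¹ ↑v⁻¹) (trB 0 (v : BC)) := by
    rw [trB_zero]; exact hasFDerivAt_ringInverse (𝕜 := ℝ) v
  have h2 := h1.comp_hasDerivAt (f := fun y => trB y (v : BC)) 0 hb
  have h3 : IsD trB (Ring.inverse (v : BC)) (-(↑v⁻¹ * b' * ↑v⁻¹)) := by
    refine h2.congr_of_eventuallyEq (Eventually.of_forall fun y => ?_)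
    have e1 : trB y (Ring.inverse (v : BC)) * trB y (v : BC) = 1 := by
      rw [← trB_mul, Ring.inverse_mul_cancel _ v.isUnit, trB_one]
    exact (inverse_eq_of_mul_eq_one e1).symm
  rw [Ring.inverse_unit] at h3 ⊢
  convert h3 using 2
  ring

lemma isD_BC_mul {b b' c c' : BC} (hb : IsD trB b b') (hc : IsD trB c c') :
    IsD trB (b * c) (b' * c + b * c') := by
  have h := HasDerivAt.fun_mul hb hc
  simp only [trB_zero] at h
  exact h.congr_of_eventuallyEq (Eventually.of_forall fun y => trB_mul y b c)

/-! ### The relaxation kernel -/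

lemma K_nonneg (z : ℝ) : 0 ≤ K z := by
  unfold K; split_ifs <;> positivity

lemma K_eq_indicator : K = (Ioi (0:ℝ)).indicator fun z => Real.exp (-z) := by
  ext z; simp [K, indicator]

lemma integrable_K : Integrable K := by
  rw [K_eq_indicator, integrable_indicator_iff measurableSet_Ioi]
  exact integrableOn_exp_neg_Ioi 0

lemma integral_K : ∫ z, K z = 1 := by
  rw [K_eq_indicator, integral_indicator measurableSet_Ioi, integral_exp_neg_Ioi_zero]

lemma integrable_K_smul (f : L1) : Integrable fun y => K y • trL.τ (-y) f := by
  have hc : Continuous fun y => trL.τ (-y) f := (trL.cont f).comp (by fun_prop)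
  refine (integrable_K.mul_const ‖f‖).mono' (integrable_K.1.smul hc.aestronglyMeasurable)
    (Eventually.of_forall fun y => ?_)
  rw [norm_smul, Real.norm_eq_abs, abs_of_nonneg (K_nonneg y)]
  exact mul_le_mul_of_nonneg_left (trL.norm_le _ _) (K_nonneg y)

/-- Convolution with `K`, as an operator on `L¹`. -/
def Kc : L1 →L[ℝ] L1 :=
  LinearMap.mkContinuous
    { toFun := fun f => ∫ y, K y • trL.τ (-y) f
      map_add' := fun f g => by
        simp only [map_add, smul_add]
        exact integral_add (integrable_K_smul f) (integrable_K_smul g)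
      map_smul' := fun c f => by
        simp only [map_smul, smul_comm _ c, RingHom.id_apply]
        exact integral_smul _ _ } 1 fun f => by
    rw [← integral_K, ← integral_mul_const]
    refine norm_integral_le_of_norm_le (integrable_K.mul_const ‖f‖) (Eventually.of_forall fun y => ?_)
    rw [norm_smul, Real.norm_eq_abs, abs_of_nonneg (K_nonneg y)]
    exact mul_le_mul_of_nonneg_left (trL.norm_le _ _) (K_nonneg y)

lemma Kc_apply (f : L1) : Kc f = ∫ y, K y • trL.τ (-y) f := rfl

lemma norm_Kc_le (f : L1) : ‖Kc f‖ ≤ ‖f‖ := by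
  simpa using Kc.le_of_opNorm_le (LinearMap.mkContinuous_norm_le _ zero_le_one _) f

lemma Kc_τ (s : ℝ) (f : L1) : Kc (trL.τ s f) = trL.τ s (Kc f) := by
  rw [Kc_apply, Kc_apply, ← ContinuousLinearMap.integral_comp_comm _ (integrable_K_smul f)]
  simp only [map_smul, ← trL.add, add_comm]

/-- The substitution `v = s - y` gives $\tau_s(K*f)=e^{-s}\int_{-\infty}^s e^v\,\tau_v f\,dv$, and
the product rule at `s = 0` yields `f - K * f`. Convolution with `K` thus gains a derivative for
every `f` in `L¹`. -/
lemma isD_Kc (f : L1) : IsD trL.τ (Kc f) (f - Kc f) := by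
  have hc : Continuous fun v => Real.exp v • trL.τ v f := Real.continuous_exp.smul (trL.cont f)
  have key : ∀ s, trL.τ s (Kc f) =
      Real.exp (-s) • (Kc f + ∫ v in (0:ℝ)..s, Real.exp v • trL.τ v f) := by
    intro s
    have h0 : ∀ s, ∫ y, K y • trL.τ (s - y) f = Real.exp (-s) • ∫ v in Iic s, Real.exp v • trL.τ v f := by
      intro s
      rw [← integral_sub_left_eq_self _ volume s, ← integral_smul, ← integral_indicator measurableSet_Iic]
      refine integral_congr_ae ?_
      -- The point `v = s` is excluded: `K 0 = 0`, while the indicator of `Iic s` is `1` there.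
      filter_upwards [compl_mem_ae_iff.2 (measure_singleton s)] with v hv
      have hv' : v ≠ s := hv
      by_cases h : v < s
      · rw [indicator_of_mem (show v ∈ Iic s from h.le), K, if_pos (by linarith), smul_smul, ← Real.exp_add]
        congr 1
        · congr 1; ring
        · congr 2; ring
      · rw [indicator_of_notMem (by simp; exact lt_of_le_of_ne (not_lt.1 h) hv'.symm), K,
          if_neg (by linarith), zero_smul]
    have hint : ∀ s, IntegrableOn (fun v => Real.exp v • trL.τ v f) (Iic s) := by
      intro s
      refine ((integrableOn_exp_Iic s).mul_const ‖f‖).mono' hc.aestronglyMeasurable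
        (Eventually.of_forall fun v => ?_)
      rw [norm_smul, Real.norm_eq_abs, abs_of_pos (Real.exp_pos _)]
      exact mul_le_mul_of_nonneg_left (trL.norm_le _ _) (Real.exp_pos _).le
    have h1 : Kc f = ∫ v in Iic (0:ℝ), Real.exp v • trL.τ v f := by
      simpa [Kc_apply] using h0 0
    rw [h1, ← intervalIntegral.integral_Iic_sub_Iic (hint 0) (hint s), add_sub_cancel, ← h0, ← h1,
      ← Kc_τ, Kc_apply]
    simp only [← trL.add]
    refine integral_congr_ae (Eventually.of_forall fun y => ?_)
    simp only [sub_eq_add_neg, add_comm]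
  have h1 : HasDerivAt (fun s => Kc f + ∫ v in (0:ℝ)..s, Real.exp v • trL.τ v f)
      (Real.exp 0 • trL.τ 0 f) 0 :=
    (intervalIntegral.integral_hasDerivAt_right (hc.intervalIntegrable _ _)
      (hc.stronglyMeasurableAtFilter _ _) hc.continuousAt).const_add _
  have h2 : HasDerivAt (fun s : ℝ => Real.exp (-s)) (-1) 0 := by
    have := (hasDerivAt_neg (0:ℝ)).exp
    simpa using this
  have h3 := h2.smul h1
  unfold IsD
  refine (h3.congr_of_eventuallyEq (Eventually.of_forall key)).congr_deriv ?_
  simp [trL.zero]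
  abel

/-- Links the vector-valued integral with the pointwise convolution in the definition of a solution:
both have the same integral over every measurable set, by Fubini. -/
lemma Kc_ae (f : L1) : Kc f =ᵐ[volume] convK f := by
  have hint := f.integrable
  have hconv : Integrable (fun p : ℝ × ℝ => K p.2 * f (p.1 - p.2)) (volume.prod volume) := by
    simpa using integrable_K.convolution_integrand (ContinuousLinearMap.lsmul ℝ ℝ) hint
  have hconv' : Integrable (convK f) := integrable_K.integrable_convolution _ hint
  refine Integrable.ae_eq_of_forall_setIntegral_eq _ _ (Kc f).integrable hconv' fun s hs _ => ?_
  have e1 : ∫ x in s, Kc f x = ∫ y, ∫ x in s, (K y • trL.τ (-y) f : L1) x := by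
    let A : L1 →L[ℝ] ℝ := pairM (s.indicator 1) (measurable_one.indicator hs) fun x => by
      by_cases h : x ∈ s <;> simp [h]
    have hA : ∀ g : L1, A g = ∫ x in s, g x := fun g => by
      rw [pairM_apply, ← integral_indicator hs]
      congr 1; ext x
      by_cases h : x ∈ s <;> simp [h]
    rw [← hA, Kc_apply, ← ContinuousLinearMap.integral_comp_comm _ (integrable_K_smul f)]
    simp only [hA]
  have e2 : ∀ y, ∫ x in s, (K y • trL.τ (-y) f : L1) x = ∫ x in s, K y * f (x - y) := fun y => by
    refine integral_congr_ae (ae_restrict_of_ae ?_)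
    filter_upwards [Lp.coeFn_smul (K y) (trL.τ (-y) f), trL_ae (-y) f] with x h1 h2
    rw [h1, Pi.smul_apply, h2, smul_eq_mul, sub_eq_add_neg]
  rw [e1]
  simp only [e2]
  rw [integral_integral_swap]
  · rfl
  · have h := hconv.mono_measure (Measure.prod_mono (Measure.restrict_le_self (s := s))
      (le_refl (volume : Measure ℝ)))
    exact h.swap

/-! ### Pointwise representatives -/

/-- The `rep` lemmas carry an identity in `L¹` to almost every point, where it becomes ring algebra.
-/
lemma rep_add {f g : L1} {f' g' : ℝ → ℝ} (hf : f =ᵐ[volume] f') (hg : g =ᵐ[volume] g') :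
    (f + g : L1) =ᵐ[volume] fun x => f' x + g' x := by
  filter_upwards [Lp.coeFn_add f g, hf, hg] with x h1 h2 h3
  rw [h1, Pi.add_apply, h2, h3]

lemma rep_sub {f g : L1} {f' g' : ℝ → ℝ} (hf : f =ᵐ[volume] f') (hg : g =ᵐ[volume] g') :
    (f - g : L1) =ᵐ[volume] fun x => f' x - g' x := by
  filter_upwards [Lp.coeFn_sub f g, hf, hg] with x h1 h2 h3
  rw [h1, Pi.sub_apply, h2, h3]

lemma rep_neg {f : L1} {f' : ℝ → ℝ} (hf : f =ᵐ[volume] f') :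
    (-f : L1) =ᵐ[volume] fun x => -f' x := by
  filter_upwards [Lp.coeFn_neg f, hf] with x h1 h2
  rw [h1, Pi.neg_apply, h2]

lemma rep_smul (c : ℝ) {f : L1} {f' : ℝ → ℝ} (hf : f =ᵐ[volume] f') :
    (c • f : L1) =ᵐ[volume] fun x => c * f' x := by
  filter_upwards [Lp.coeFn_smul c f, hf] with x h1 h2
  rw [h1, Pi.smul_apply, h2, smul_eq_mul]

lemma rep_mul (b : BC) {f : L1} {f' : ℝ → ℝ} (hf : f =ᵐ[volume] f') :
    mul b f =ᵐ[volume] fun x => b x * f' x := by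
  filter_upwards [mul_ae b f, hf] with x h1 h2
  rw [h1, h2]

lemma BC_ext_ae {b c : BC} (h : b =ᵐ[volume] c) : b = c :=
  DFunLike.coe_injective ((b.continuous.ae_eq_iff_eq volume c.continuous).1 h)

/-! ### Curves differentiable along translations -/

/-- `f'` is the derivative of the curve `f` along the translations `τ`, both being continuous. -/
structure DCurve {E : Type*} [NormedAddCommGroup E] [NormedSpace ℝ E] (τ : ℝ → E →L[ℝ] E) (s : Set ℝ)
    (f f' : ℝ → E) : Prop where
  cont : ContinuousOn f s
  cont' : ContinuousOn f' s
  isD : ∀ t ∈ s, IsD τ (f t) (f' t)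

section DCurve

variable {E : Type*} [NormedAddCommGroup E] [NormedSpace ℝ E] {τ : ℝ → E →L[ℝ] E} {s : Set ℝ}

lemma DCurve.add {f f' g g' : ℝ → E} (hf : DCurve τ s f f') (hg : DCurve τ s g g') :
    DCurve τ s (fun t => f t + g t) fun t => f' t + g' t where
  cont := hf.cont.add hg.cont
  cont' := hf.cont'.add hg.cont'
  isD t ht := by simpa [IsD] using HasDerivAt.fun_add (hf.isD t ht) (hg.isD t ht)

lemma DCurve.sub {f f' g g' : ℝ → E} (hf : DCurve τ s f f') (hg : DCurve τ s g g') :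
    DCurve τ s (fun t => f t - g t) fun t => f' t - g' t where
  cont := hf.cont.sub hg.cont
  cont' := hf.cont'.sub hg.cont'
  isD t ht := by simpa [IsD] using HasDerivAt.fun_sub (hf.isD t ht) (hg.isD t ht)

lemma DCurve.neg {f f' : ℝ → E} (hf : DCurve τ s f f') :
    DCurve τ s (fun t => -f t) fun t => -f' t where
  cont := hf.cont.neg
  cont' := hf.cont'.neg
  isD t ht := by simpa [IsD] using HasDerivAt.fun_neg (hf.isD t ht)

lemma DCurve.smul (c : ℝ) {f f' : ℝ → E} (hf : DCurve τ s f f') :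
    DCurve τ s (fun t => c • f t) fun t => c • f' t where
  cont := hf.cont.const_smul c
  cont' := hf.cont'.const_smul c
  isD t ht := by simpa [IsD] using HasDerivAt.fun_const_smul c (hf.isD t ht)

lemma DCurve.mono {f f' : ℝ → E} (hf : DCurve τ s f f') {s' : Set ℝ} (h : s' ⊆ s) :
    DCurve τ s' f f' :=
  ⟨hf.cont.mono h, hf.cont'.mono h, fun t ht => hf.isD t (h ht)⟩

lemma DCurve.I {f f' : ℝ → L1} (hf : DCurve trL.τ s f f') :
    DCurve trB s (fun t => I (f t)) fun t => I (f' t) where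
  cont := AugmentedBurgers.I.continuous.comp_continuousOn hf.cont
  cont' := AugmentedBurgers.I.continuous.comp_continuousOn hf.cont'
  isD t ht := isD_I (hf.isD t ht)

lemma DCurve.BC_mul {b b' c c' : ℝ → BC} (hb : DCurve trB s b b') (hc : DCurve trB s c c') :
    DCurve trB s (fun t => b t * c t) fun t => b' t * c t + b t * c' t where
  cont := hb.cont.mul hc.cont
  cont' := (hb.cont'.mul hc.cont).add (hb.cont.mul hc.cont')
  isD t ht := isD_BC_mul (hb.isD t ht) (hc.isD t ht)

lemma continuousOn_mul {b : ℝ → BC} {f : ℝ → L1} (hb : ContinuousOn b s) (hf : ContinuousOn f s) :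
    ContinuousOn (fun t => mul (b t) (f t)) s :=
  (mul.continuous.comp_continuousOn hb).clm_apply hf

lemma DCurve.mul {b b' : ℝ → BC} {f f' : ℝ → L1} (hb : DCurve trB s b b') (hf : DCurve trL.τ s f f') :
    DCurve trL.τ s (fun t => mul (b t) (f t)) fun t => mul (b' t) (f t) + mul (b t) (f' t) where
  cont := continuousOn_mul hb.cont hf.cont
  cont' := (continuousOn_mul hb.cont' hf.cont).add (continuousOn_mul hb.cont hf.cont')
  isD t ht := isD_mul (hb.isD t ht) (hf.isD t ht)

lemma DCurve.inverse {b b' : ℝ → BC} (hb : DCurve trB s b b') (hu : ∀ t ∈ s, IsUnit (b t)) :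
    DCurve trB s (fun t => Ring.inverse (b t))
      fun t => -(Ring.inverse (b t) * Ring.inverse (b t) * b' t) := by
  have hc : ContinuousOn (fun t => Ring.inverse (b t)) s := fun t ht => by
    obtain ⟨v, hv⟩ := hu t ht
    have h1 : ContinuousAt Ring.inverse (b t) := by
      rw [← hv]; exact NormedRing.inverse_continuousAt v
    exact h1.comp_continuousWithinAt (hb.cont t ht)
  exact ⟨hc, ((hc.mul hc).mul hb.cont').neg, fun t ht => isD_inverse (hb.isD t ht) (hu t ht)⟩

end DCurve

/-! ### The nonlinearity after the Hopf–Cole transformation -/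

/-- The Hopf–Cole variable with derivative `q`. -/
def wB (q : L1) : BC := 1 + I q

/-- The domain of the nonlinearity. -/
def Om : Set L1 := {q | IsUnit (wB q)}

/-- Half of the solution, in terms of the derivative `q` of the Hopf–Cole variable. -/
def rL (q : L1) : L1 := mul (Ring.inverse (wB q)) q

/-- `K * rL q`, as a bounded continuous function. -/
def kB (q : L1) : BC := I (rL q - Kc (rL q))

/-- The nonlinearity of the equation for the derivative of the Hopf–Cole variable. -/
def nonlin (q : L1) : L1 := mul (wB q) (Kc (rL q)) - mul (kB q) q - q

lemma contDiff_wB : ContDiff ℝ ∞ wB := contDiff_const.add I.contDiff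

lemma continuous_wB : Continuous wB := continuous_const.add I.continuous

lemma isOpen_Om : IsOpen Om := Units.isOpen.preimage continuous_wB

lemma contDiffOn_mul {b : L1 → BC} {f : L1 → L1} {s : Set L1} (hb : ContDiffOn ℝ ∞ b s)
    (hf : ContDiffOn ℝ ∞ f s) : ContDiffOn ℝ ∞ (fun q => mul (b q) (f q)) s :=
  (mul.contDiff.comp_contDiffOn hb).clm_apply hf

lemma contDiffOn_inverse_wB : ContDiffOn ℝ ∞ (fun q => Ring.inverse (wB q)) Om := by
  intro q hq
  obtain ⟨v, hv⟩ := hq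
  have h1 : ContDiffAt ℝ ∞ Ring.inverse (wB q) := by
    rw [← hv]; exact contDiffAt_ringInverse ℝ v
  exact (h1.comp q contDiff_wB.contDiffAt).contDiffWithinAt

lemma contDiffOn_rL : ContDiffOn ℝ ∞ rL Om := contDiffOn_mul contDiffOn_inverse_wB contDiffOn_id

lemma contDiffOn_nonlin : ContDiffOn ℝ ∞ nonlin Om := by
  have h1 : ContDiffOn ℝ ∞ (fun q => Kc (rL q)) Om := Kc.contDiff.comp_contDiffOn contDiffOn_rL
  exact ((contDiffOn_mul contDiff_wB.contDiffOn h1).sub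
    (contDiffOn_mul (I.contDiff.comp_contDiffOn (contDiffOn_rL.sub h1)) contDiffOn_id)).sub contDiffOn_id

lemma wB_τ (s : ℝ) (q : L1) : wB (trL.τ s q) = trB s (wB q) := by
  simp [wB, I_τ, trB_one]

lemma inverse_trB (s : ℝ) {b : BC} (hb : IsUnit b) :
    Ring.inverse (trB s b) = trB s (Ring.inverse b) :=
  inverse_eq_of_mul_eq_one (by rw [← trB_mul, Ring.inverse_mul_cancel _ hb, trB_one])

lemma Om_τ (s : ℝ) (q : L1) (hq : q ∈ Om) : trL.τ s q ∈ Om := by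
  refine IsUnit.of_mul_eq_one (trB s (Ring.inverse (wB q))) ?_
  rw [wB_τ, ← trB_mul, Ring.mul_inverse_cancel _ hq, trB_one]

lemma rL_τ (s : ℝ) {q : L1} (hq : q ∈ Om) : rL (trL.τ s q) = trL.τ s (rL q) := by
  rw [rL, rL, mul_τ, wB_τ, inverse_trB s hq]

lemma nonlin_τ (s : ℝ) (q : L1) (hq : q ∈ Om) : nonlin (trL.τ s q) = trL.τ s (nonlin q) := by
  have h1 : kB (trL.τ s q) = trB s (kB q) := by
    rw [kB, kB, rL_τ s hq, Kc_τ, ← map_sub, I_τ]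
  rw [nonlin, nonlin, h1, map_sub, map_sub, mul_τ, mul_τ, rL_τ s hq, Kc_τ, wB_τ]

lemma inverse_mul_apply {b : BC} (hb : IsUnit b) (x : ℝ) : Ring.inverse b x * b x = 1 := by
  rw [← BoundedContinuousFunction.mul_apply, Ring.inverse_mul_cancel _ hb]; rfl

lemma kB_ae (q : L1) : Kc (rL q) =ᵐ[volume] kB q := isD_ae_eq (isD_Kc (rL q))

lemma rL_ae (q : L1) : rL q =ᵐ[volume] fun x => Ring.inverse (wB q) x * q x := mul_ae _ _

/-- The nonlinearity is the exact derivative `-(w (K * r))_x`: expand with `w_x = q` and `(K * r)_x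
= r - K * r`, then use `w r = q`. -/
lemma isD_neg_nonlin {q q' : L1} (hq : q ∈ Om) (h : IsD trL.τ q q') :
    IsD trL.τ (mul (wB q) (Kc (rL q))) (-nonlin q) := by
  have h1 := isD_mul (isD_one_add_I h) (isD_Kc (rL q))
  have h2 : -nonlin q = mul (I q') (Kc (rL q)) + mul (wB q) (rL q - Kc (rL q)) := ?_
  · rw [h2]; exact h1
  refine Lp.ext ?_
  filter_upwards [kB_ae q, isD_ae_eq h,
    rep_neg (rep_sub (rep_sub (rep_mul (wB q) (kB_ae q)) (mul_ae (kB q) q)) (EventuallyEq.refl _ (q : ℝ → ℝ))),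
    rep_add (rep_mul (I q') (kB_ae q)) (rep_mul (wB q) (rep_sub (rL_ae q) (kB_ae q)))] with x h1 h2 h3 h4
  rw [show -nonlin q = -(mul (wB q) (Kc (rL q)) - mul (kB q) q - q) from rfl, h3]
  refine Eq.trans ?_ h4.symm
  have h5 := inverse_mul_apply hq x
  rw [← h2]
  linear_combination (-q x) * h5

/-- Integrating the exact derivative gives the source `-w (K * r)` in the equation for `w` itself.
-/
lemma I_nonlin {q q' : L1} (hq : q ∈ Om) (h : IsD trL.τ q q') : I (nonlin q) = -(wB q * kB q) := by
  have h1 := isD_ae_eq (isD_neg_nonlin hq h)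
  rw [map_neg] at h1
  have : wB q * kB q = -I (nonlin q) := by
    refine BC_ext_ae ?_
    filter_upwards [h1, rep_mul (wB q) (kB_ae q)] with x h2 h3
    rw [← h2, h3]; rfl
  rw [this, neg_neg]

/-! ### Regularity of mild solutions and the inverse Hopf–Cole transformation -/

/-- A classical solution on `(0, T]` of the augmented Burgers equation, with its derivatives. -/
structure ClassicalOn (T : ℝ) (u u1 u2 u3 : ℝ → L1) : Prop where
  d1 : DCurve trL.τ (Ioc 0 T) u u1
  d2 : DCurve trL.τ (Ioc 0 T) u1 u2
  d3 : DCurve trL.τ (Ioc 0 T) u2 u3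
  time : ∀ t ∈ Ioo 0 T, HasDerivAt u (mul (I (u1 t)) (u1 t) + u2 t + u1 t + Kc (u t) - u t) t

/-- A mild solution of the equation for the derivative of the Hopf–Cole variable. -/
structure MildSol (T : ℝ) (q : ℝ → L1) : Prop where
  cont : ContinuousOn q (Icc 0 T)
  mem : ∀ t ∈ Icc 0 T, q t ∈ Om
  mild : trL.Mild 0 T q fun t => nonlin (q t)

/-- Mild solutions are three times differentiable along translations for positive times. -/
lemma MildSol.regular {T : ℝ} {q : ℝ → L1} (h : MildSol T q) : ∃ q1 q2 q3 : ℝ → L1,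
    DCurve trL.τ (Ioc 0 T) q q1 ∧ DCurve trL.τ (Ioc 0 T) q1 q2 ∧ DCurve trL.τ (Ioc 0 T) q2 q3 := by
  -- Three rounds of smoothing, on `L1`, on pairs and on quadruples; the newest derivative of `q` is
  -- always the last component.
  obtain ⟨a1, a2, a3⟩ := TransGroup.mild_smoothing isOpen_Om contDiffOn_nonlin nonlin_τ h.cont h.mem h.mild
  set G1 := trL
  set G2 := trL.prod trL
  set p : ℝ → L1 × L1 := fun t => (q t, trL.D (q t))
  have hO1 : IsOpen (Om ×ˢ (univ : Set L1)) := isOpen_Om.prod isOpen_univ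
  have eq1 : ∀ s, ∀ f ∈ Om ×ˢ (univ : Set L1), TransGroup.tangent nonlin (G2.τ s f) =
      G2.τ s (TransGroup.tangent nonlin f) := fun s f hf =>
    TransGroup.tangent_equivariant isOpen_Om (contDiffOn_nonlin.differentiableOn (by simp)) Om_τ
      nonlin_τ s f hf
  have hτ1 : ∀ s, ∀ f ∈ Om ×ˢ (univ : Set L1), G2.τ s f ∈ Om ×ˢ (univ : Set L1) := fun s f hf =>
    ⟨Om_τ s _ hf.1, mem_univ _⟩
  have cd1 := TransGroup.contDiffOn_tangent isOpen_Om contDiffOn_nonlin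
  have hp : ContinuousOn p (Ioc 0 T) := (h.cont.mono Ioc_subset_Icc_self).prodMk a2
  have pair_reg : ∀ a ∈ Ioo 0 T, (∀ t ∈ Ioc a T, IsD G2.τ (p t) (G2.D (p t))) ∧
      ContinuousOn (fun t => G2.D (p t)) (Ioc a T) ∧
      ∀ a' ∈ Ioo a T, (G2.prod G2).Mild a' T (fun t => (p t, G2.D (p t)))
        fun t => TransGroup.tangent (TransGroup.tangent nonlin) (p t, G2.D (p t)) := fun a ha =>
    TransGroup.mild_smoothing hO1 cd1 eq1
      (hp.mono fun t ht => ⟨ha.1.trans_le ht.1, ht.2⟩)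
      (fun t ht => ⟨h.mem t ⟨ha.1.le.trans ht.1, ht.2⟩, mem_univ _⟩) (a3 a ha)
  have mem_iff : ∀ t ∈ Ioc 0 T, ∃ a ∈ Ioo 0 T, t ∈ Ioc a T := fun t ht =>
    ⟨t / 2, ⟨by linarith [ht.1], by linarith [ht.1, ht.2]⟩, by linarith [ht.1], ht.2⟩
  -- Every round gives up an initial time slab of arbitrary length; continuity on all `(a, T]`
  -- yields continuity on `(0, T]`.
  have glue : ∀ {X : Type} [TopologicalSpace X] (g : ℝ → X),
      (∀ a ∈ Ioo 0 T, ContinuousOn g (Ioc a T)) → ContinuousOn g (Ioc 0 T) := by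
    intro X _ g hg t ht
    obtain ⟨a, ha, hta⟩ := mem_iff t ht
    refine (hg a ha t hta).mono_of_mem_nhdsWithin ?_
    filter_upwards [self_mem_nhdsWithin, mem_nhdsWithin_of_mem_nhds (lt_mem_nhds hta.1)] with s h1 h2
    exact ⟨h2, h1.2⟩
  have b1 : ∀ t ∈ Ioc 0 T, IsD G2.τ (p t) (G2.D (p t)) := fun t ht => by
    obtain ⟨a, ha, hta⟩ := mem_iff t ht
    exact (pair_reg a ha).1 t hta
  have b2 : ContinuousOn (fun t => G2.D (p t)) (Ioc 0 T) := glue _ fun a ha => (pair_reg a ha).2.1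
  set G4 := G2.prod G2
  set r : ℝ → (L1 × L1) × (L1 × L1) := fun t => (p t, G2.D (p t))
  have hr : ContinuousOn r (Ioc 0 T) := hp.prodMk b2
  have quad_reg : ∀ a ∈ Ioo 0 T, (∀ t ∈ Ioc a T, IsD G4.τ (r t) (G4.D (r t))) ∧
      ContinuousOn (fun t => G4.D (r t)) (Ioc a T) := fun a ha => by
    have ha2 : a / 2 ∈ Ioo 0 T := ⟨by linarith [ha.1], by linarith [ha.1, ha.2]⟩
    have := TransGroup.mild_smoothing (G := G4) (hO1.prod isOpen_univ)
      (TransGroup.contDiffOn_tangent hO1 cd1)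
      (fun s f hf => TransGroup.tangent_equivariant hO1 (cd1.differentiableOn (by simp)) hτ1
        eq1 s f hf) (hr.mono fun t ht => ⟨ha.1.trans_le ht.1, ht.2⟩)
      (fun t ht => ⟨⟨h.mem t ⟨ha.1.le.trans ht.1, ht.2⟩, mem_univ _⟩, mem_univ _⟩)
      ((pair_reg (a / 2) ha2).2.2 a ⟨by linarith [ha.1], ha.2⟩)
    exact ⟨this.1, this.2.1⟩
  have c1 : ∀ t ∈ Ioc 0 T, IsD G4.τ (r t) (G4.D (r t)) := fun t ht => by
    obtain ⟨a, ha, hta⟩ := mem_iff t ht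
    exact (quad_reg a ha).1 t hta
  have c2 : ContinuousOn (fun t => G4.D (r t)) (Ioc 0 T) := glue _ fun a ha => (quad_reg a ha).2
  refine ⟨fun t => trL.D (q t), fun t => (G2.D (p t)).2, fun t => (G4.D (r t)).2.2,
    ⟨h.cont.mono Ioc_subset_Icc_self, a2, a1⟩, ⟨a2, continuous_snd.comp_continuousOn b2, fun t ht =>
      ((trL.isD_prod trL).1 (b1 t ht)).2⟩, ⟨continuous_snd.comp_continuousOn b2,
      continuous_snd.comp_continuousOn (continuous_snd.comp_continuousOn c2), fun t ht => ?_⟩⟩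
  exact ((trL.isD_prod trL).1 ((G2.isD_prod G2).1 (c1 t ht)).2).2

/-- The inverse Hopf–Cole transform of a mild solution is a classical solution. -/
theorem MildSol.classical {T : ℝ} {q : ℝ → L1} (h : MildSol T q) :
    ∃ u1 u2 u3 : ℝ → L1, ClassicalOn T (fun t => (2:ℝ) • rL (q t)) u1 u2 u3 := by
  obtain ⟨q1, q2, q3, h1, h2, h3⟩ := h.regular
  have hmem : ∀ t ∈ Ioc 0 T, IsUnit (wB (q t)) := fun t ht => h.mem t ⟨ht.1.le, ht.2⟩
  have hw : DCurve trB (Ioc 0 T) (fun t => wB (q t)) fun t => I (q1 t) :=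
    ⟨continuous_wB.comp_continuousOn h1.cont, I.continuous.comp_continuousOn h1.cont',
      fun t ht => isD_one_add_I (h1.isD t ht)⟩
  -- `v0`, `v1`, `v2` differentiate `1/w` up to three times, and `e1`, `e2`, `e3` are the Leibniz
  -- rule for `2 q / w`. The derivative of `w` is written `I q1`, equal to `q` a.e., because the
  -- products require bounded continuous factors.
  have v0 := hw.inverse hmem
  have v1 := ((v0.BC_mul v0).BC_mul h2.I).neg
  have v2 := ((((v1.BC_mul v0).add (v0.BC_mul v1)).BC_mul h2.I).add ((v0.BC_mul v0).BC_mul h3.I)).neg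
  have e1 := (v0.mul h1).smul 2
  have e2 := ((v1.mul h1).add (v0.mul h2)).smul 2
  have e3 := (((v2.mul h1).add (v1.mul h2)).add ((v1.mul h2).add (v0.mul h3))).smul 2
  refine ⟨_, _, _, e1, e2, e3, fun t ht => ?_⟩
  have htm : t ∈ Ioc 0 T := ⟨ht.1, ht.2.le⟩
  have hsub : Icc (t / 2) T ⊆ Ioc 0 T := fun s hs => ⟨lt_of_lt_of_le (by linarith [ht.1]) hs.1, hs.2⟩
  have hfc : ContinuousOn (fun t => nonlin (q t)) (Icc 0 T) :=
    contDiffOn_nonlin.continuousOn.comp h.cont h.mem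
  have hqt : HasDerivAt q (q2 t + q1 t + nonlin (q t)) t :=
    TransGroup.hasDerivAt_mild (h.mild.restart hfc (by linarith [ht.1]))
      (hfc.mono (hsub.trans Ioc_subset_Icc_self)) (fun s hs => h1.isD s (hsub hs))
      (fun s hs => h2.isD s (hsub hs)) (h2.cont.mono hsub) (h2.cont'.mono hsub)
      ⟨by linarith [ht.1], ht.2⟩
  obtain ⟨v, hv⟩ := hmem t htm
  have hinv : Ring.inverse (wB (q t)) = ↑v⁻¹ := by rw [← hv, Ring.inverse_unit]
  set N := nonlin (q t) with hN
  have hwt : HasDerivAt (fun t => wB (q t)) (I (q2 t + q1 t + N)) t :=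
    (I.hasFDerivAt.comp_hasDerivAt t hqt).const_add 1
  have hvt : HasDerivAt (fun t => Ring.inverse (wB (q t)))
      (-(↑v⁻¹ * I (q2 t + q1 t + N) * ↑v⁻¹)) t := by
    have h1 : HasFDerivAt (𝕜 := ℝ) (E := BC) (F := BC) Ring.inverse
      (-ContinuousLinearMap.mulLeftRight ℝ BC ↑v⁻¹ ↑v⁻¹) (wB (q t)) := by
      rw [← hv]; exact hasFDerivAt_ringInverse (𝕜 := ℝ) v
    exact h1.comp_hasDerivAt t hwt
  have hut : HasDerivAt (fun t => (2:ℝ) • rL (q t))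
      ((2:ℝ) • (mul (-(↑v⁻¹ * I (q2 t + q1 t + N) * ↑v⁻¹)) (q t) +
        mul (Ring.inverse (wB (q t))) (q2 t + q1 t + N))) t :=
    ((mul.hasFDerivAt.comp_hasDerivAt t hvt).clm_apply hqt).const_smul (2:ℝ)
  refine hut.congr_deriv ?_
  have hIN : I N = -(wB (q t) * kB (q t)) := I_nonlin (h.mem t ⟨ht.1.le, ht.2.le⟩) (h1.isD t htm)
  have rN : N =ᵐ[volume] fun x => wB (q t) x * kB (q t) x - kB (q t) x * q t x - q t x :=
    rep_sub (rep_sub (rep_mul _ (kB_ae _)) (mul_ae _ _)) (EventuallyEq.refl _ _)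
  have r0 := EventuallyEq.refl (ae volume) (q t : ℝ → ℝ)
  have r1 := EventuallyEq.refl (ae volume) (q1 t : ℝ → ℝ)
  have r2 := EventuallyEq.refl (ae volume) (q2 t : ℝ → ℝ)
  have rqt := rep_add (rep_add r2 r1) rN
  have ru := rep_smul 2 (mul_ae (Ring.inverse (wB (q t))) (q t))
  have ru1 := rep_smul 2 (rep_add (mul_ae (-(Ring.inverse (wB (q t)) * Ring.inverse (wB (q t)) * I (q1 t))) (q t))
    (mul_ae (Ring.inverse (wB (q t))) (q1 t)))
  have rv2 := rep_smul 2 (rep_add (rep_add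
    (mul_ae (-((-(Ring.inverse (wB (q t)) * Ring.inverse (wB (q t)) * I (q1 t)) * Ring.inverse (wB (q t)) +
      Ring.inverse (wB (q t)) * -(Ring.inverse (wB (q t)) * Ring.inverse (wB (q t)) * I (q1 t))) * I (q1 t) +
      Ring.inverse (wB (q t)) * Ring.inverse (wB (q t)) * I (q2 t))) (q t))
    (mul_ae (-(Ring.inverse (wB (q t)) * Ring.inverse (wB (q t)) * I (q1 t))) (q1 t)))
    (rep_add (mul_ae (-(Ring.inverse (wB (q t)) * Ring.inverse (wB (q t)) * I (q1 t))) (q1 t))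
      (mul_ae (Ring.inverse (wB (q t))) (q2 t))))
  have rk := rep_smul 2 (kB_ae (q t))
  rw [← map_smul] at rk
  have rlhs := rep_smul 2 (rep_add (rep_mul (-(↑v⁻¹ * I (q2 t + q1 t + N) * ↑v⁻¹)) r0)
    (rep_mul (Ring.inverse (wB (q t))) rqt))
  have rrhs := rep_sub (rep_add (rep_add (rep_add (rep_mul (I ((2:ℝ) •
    (mul (-(Ring.inverse (wB (q t)) * Ring.inverse (wB (q t)) * I (q1 t))) (q t) +
      mul (Ring.inverse (wB (q t))) (q1 t)))) ru1) rv2) ru1) rk) ru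
  refine Lp.ext ?_
  filter_upwards [rlhs, rrhs, isD_ae_eq (h1.isD t htm), isD_ae_eq (h2.isD t htm),
    isD_ae_eq (e1.isD t htm), ru] with x x1 x2 x3 x4 x5 x6
  refine x1.trans (Eq.trans ?_ x2.symm)
  rw [← x5, x6, ← hinv, map_add, map_add, hIN]
  have x7 := inverse_mul_apply (h.mem t ⟨ht.1.le, ht.2.le⟩) x
  simp only [BoundedContinuousFunction.coe_neg, BoundedContinuousFunction.coe_mul,
    BoundedContinuousFunction.coe_add, Pi.neg_apply, Pi.mul_apply, Pi.add_apply, ← x3, ← x4]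
  -- Pointwise, the only relation left to use is `(1/w) w = 1`.
  linear_combination (2 * kB (q t) x + 2 * Ring.inverse (wB (q t)) x * kB (q t) x * q t x) * x7

/-! ### The sign functional and `L¹` contraction -/

/-- The sign of a real number. -/
def sg (z : ℝ) : ℝ := if 0 < z then 1 else if z < 0 then -1 else 0

lemma measurable_sg : Measurable sg :=
  Measurable.ite measurableSet_Ioi measurable_const
    (Measurable.ite measurableSet_Iio measurable_const measurable_const)

lemma abs_sg_le (z : ℝ) : |sg z| ≤ 1 := by unfold sg; split_ifs <;> simp

lemma sg_mul_self (z : ℝ) : sg z * z = |z| := by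
  unfold sg
  split_ifs with h1 h2
  · rw [one_mul, abs_of_pos h1]
  · rw [neg_one_mul, abs_of_neg h2]
  · rw [le_antisymm (not_lt.1 h1) (not_lt.1 h2)]; simp

/-- The functional `f ↦ ∫ sign(d) f`. -/
def sgn (d : L1) : L1 →L[ℝ] ℝ :=
  pairM (fun x => sg (d x)) (measurable_sg.comp (Lp.stronglyMeasurable d).measurable)
    fun _ => abs_sg_le _

lemma sgn_apply (d f : L1) : sgn d f = ∫ x, sg (d x) * f x := rfl

lemma sgn_le (d f : L1) : sgn d f ≤ ‖f‖ := pairM_le _ _ _ f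

lemma sgn_mul {a : BC} (ha : ∀ x, 0 ≤ a x) (d : L1) : sgn d (mul a d) = ‖mul a d‖ := by
  rw [sgn_apply, L1.norm_eq]
  refine integral_congr_ae ?_
  filter_upwards [mul_ae a d] with x hx
  rw [hx, abs_mul, abs_of_nonneg (ha x), ← sg_mul_self]; ring

lemma sgn_self (d : L1) : sgn d d = ‖d‖ := by
  simpa [one_mul_apply] using sgn_mul (a := 1) (fun x => zero_le_one) d

/-- The function `y ↦ sgn d (τ y f)` is bounded by `‖f‖` and attains this bound at `y = 0`, so its
derivative there vanishes. No regularization of the sign is needed. -/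
lemma sgn_isD {d f g : L1} (hf : sgn d f = ‖f‖) (h : IsD trL.τ f g) : sgn d g = 0 := by
  have h1 := (sgn d).hasFDerivAt.comp_hasDerivAt (f := fun y => trL.τ y f) 0 h
  refine IsLocalMax.hasDerivAt_eq_zero (f := (sgn d) ∘ fun y => trL.τ y f) ?_ h1
  refine Eventually.of_forall fun y => ?_
  simp only [Function.comp, trL.zero, hf]
  exact (sgn_le _ _).trans (trL.norm_le y f)

/-- Adding the constant `‖a‖` makes the coefficient nonnegative, so that `sgn d` is norming for the
product. The constant itself contributes a multiple of `sgn d d' = 0`. -/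
lemma sgn_isD_mul {d d' : L1} {a a' : BC} (ha : IsD trB a a') (hd : IsD trL.τ d d') :
    sgn d (mul a' d + mul a d') = 0 := by
  have hM : IsD trB (a + ‖a‖ • (1 : BC)) a' := by
    have := HasDerivAt.add_const (‖a‖ • (1 : BC)) ha
    refine this.congr_of_eventuallyEq (Eventually.of_forall fun y => ?_)
    simp [trB_one]
  have h1 := sgn_isD (sgn_mul (a := a + ‖a‖ • (1 : BC)) (fun x => ?_) d) (isD_mul hM hd)
  · have h2 := sgn_isD (sgn_self d) hd
    simp only [map_add, map_smul, add_apply, smul_apply, one_mul_apply, h2, smul_zero,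
      add_zero] at h1 ⊢
    exact h1
  · have := neg_le_of_abs_le (a.norm_coe_le_norm x)
    simp only [BoundedContinuousFunction.coe_add, Pi.add_apply, BoundedContinuousFunction.coe_smul,
      BoundedContinuousFunction.coe_one, Pi.one_apply, smul_eq_mul, mul_one]
    linarith

/-- The left side is the limit of `sgn d (heat t d - d) / t`. These quotients are nonpositive
because `heat t` is a contraction and `sgn d d = ‖d‖`. -/
lemma sgn_heat {d d' d'' : L1} (h : IsD trL.τ d d') (h' : IsD trL.τ d' d'') :
    sgn d (d'' + d') ≤ 0 := by
  have hc : Continuous fun s => trL.heat s (d'' + d') :=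
    trL.continuous_heat.comp (f := fun s => (s, d'' + d')) (by fun_prop)
  have h1 : HasDerivAt (fun t => ∫ s in (0:ℝ)..t, trL.heat s (d'' + d')) (d'' + d') 0 := by
    have := intervalIntegral.integral_hasDerivAt_right (hc.intervalIntegrable 0 0)
      (hc.stronglyMeasurableAtFilter _ _) hc.continuousAt
    rwa [trL.heat_zero] at this
  have h2 := ((sgn d).hasFDerivAt.comp_hasDerivAt (0:ℝ) h1).hasDerivWithinAt (s := Ioi 0)
  rw [hasDerivWithinAt_iff_tendsto_slope' (by simp)] at h2
  refine le_of_tendsto h2 ?_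
  filter_upwards [self_mem_nhdsWithin] with t ht
  have ht' : 0 < t := ht
  rw [slope_def_field]
  simp only [Function.comp, intervalIntegral.integral_same, map_zero, sub_zero]
  rw [trL.heat_sub_eq ht'.le h h', map_sub, sgn_self]
  refine div_nonpos_of_nonpos_of_nonneg ?_ ht'.le
  have := (sgn_le d (trL.heat t d)).trans (trL.norm_heat_le t d)
  linarith

lemma sgn_Kc (d : L1) : sgn d (Kc d - d) ≤ 0 := by
  rw [map_sub, sgn_self]
  have := (sgn_le d (Kc d)).trans (norm_Kc_le d)
  linarith

/-- A Dini derivative argument: control of the `L¹` norm through the sign functional. -/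
lemma norm_le_of_sgn {e e' : ℝ → L1} {C c : ℝ → ℝ} {a b : ℝ} (hab : a ≤ b)
    (he : ∀ t ∈ Icc a b, HasDerivAt e (e' t) t) (hC : ∀ t ∈ Icc a b, HasDerivAt C (c t) t)
    (h : ∀ t ∈ Icc a b, sgn (e t) (e' t) ≤ c t) : ‖e b‖ ≤ ‖e a‖ + (C b - C a) := by
  have hmem : ∀ s ∈ Icc a b, a + b - s ∈ Icc a b := fun s hs => ⟨by linarith [hs.2], by linarith [hs.1]⟩
  have hrev : ∀ s : ℝ, HasDerivAt (fun s => a + b - s) (-1) s := fun s => (hasDerivAt_id' s).const_sub _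
  -- The functional at the later time satisfies `‖e s‖ ≥ sgn (e t) (e s)`, with equality at `s = t`,
  -- which bounds backward difference quotients of the norm. Time is reversed to fit a comparison
  -- principle for forward slopes.
  have key := image_le_of_liminf_slope_right_le_deriv_boundary (a := a) (b := b)
    (f := fun s => -‖e (a + b - s)‖) (B := fun s => -‖e b‖ + (C b - C (a + b - s)))
    (B' := fun s => c (a + b - s)) ?_ ?_ ?_ ?_ ?_ (x := b) ⟨hab, le_rfl⟩
  · simp only [add_sub_cancel_right] at key
    linarith
  · intro s hs
    have h1 := (he _ (hmem s hs)).continuousAt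
    have h2 : ContinuousAt (fun s => a + b - s) s := by fun_prop
    exact (ContinuousAt.comp (f := fun s => a + b - s) h1 h2).norm.neg.continuousWithinAt
  · simp
  · intro s hs
    have h1 := (hC _ (hmem s hs)).continuousAt
    have h2 : ContinuousAt (fun s => a + b - s) s := by fun_prop
    have h3 : ContinuousAt (fun s => -‖e b‖ + (C b - C (a + b - s))) s :=
      ((ContinuousAt.comp (f := fun s => a + b - s) h1 h2).const_sub _).const_add _
    exact h3.continuousWithinAt
  · intro s hs
    have h1 := (hC _ (hmem s ⟨hs.1, hs.2.le⟩)).scomp s (hrev s)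
    have h2 := (h1.const_sub (C b)).const_add (-‖e b‖)
    refine (h2.congr_deriv ?_).hasDerivWithinAt
    simp
  · intro s hs r hr
    set t := a + b - s with ht
    have htm := hmem s ⟨hs.1, hs.2.le⟩
    have h1 := (sgn (e t)).hasFDerivAt.comp_hasDerivAt t (he t htm)
    have h2 := (h1.scomp s (hrev s)).hasDerivWithinAt (s := Ioi s)
    rw [hasDerivWithinAt_iff_tendsto_slope' (by simp)] at h2
    have h3 : -r < (-1 : ℝ) • sgn (e t) (e' t) := by
      have := h t htm
      rw [smul_eq_mul]
      linarith
    refine Eventually.frequently ?_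
    filter_upwards [h2.eventually (lt_mem_nhds h3), self_mem_nhdsWithin] with z hz1 hz2
    have hz : 0 < z - s := sub_pos.2 hz2
    rw [slope_def_field, lt_div_iff₀ hz] at hz1
    rw [slope_def_field, div_lt_iff₀ hz]
    simp only [Function.comp, ← ht, sgn_self] at hz1
    have := sgn_le (e t) (e (a + b - z))
    linarith

/-- `L¹` contraction for classical solutions, away from the initial time. -/
lemma ClassicalOn.contraction_Ioo {T : ℝ} {u u1 u2 u3 v v1 v2 v3 : ℝ → L1}
    (hu : ClassicalOn T u u1 u2 u3) (hv : ClassicalOn T v v1 v2 v3) {s t : ℝ} (hs : 0 < s)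
    (hst : s ≤ t) (ht : t < T) : ‖u t - v t‖ ≤ ‖u s - v s‖ := by
  have key := norm_le_of_sgn (C := fun _ => 0) (c := fun _ => 0) hst
    (e := fun t => u t - v t) (fun r hr => (hu.time r ⟨hs.trans_le hr.1, hr.2.trans_lt ht⟩).sub
      (hv.time r ⟨hs.trans_le hr.1, hr.2.trans_lt ht⟩)) (fun _ _ => hasDerivAt_const _ _) ?_
  · simpa using key
  intro r hr
  have hrm : r ∈ Ioc 0 T := ⟨hs.trans_le hr.1, (hr.2.trans_lt ht).le⟩
  have d1 := (hu.d1.sub hv.d1).isD r hrm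
  have d2 := (hu.d2.sub hv.d2).isD r hrm
  have da := ((hu.d2.I.add hv.d2.I).smul (1/2)).isD r hrm
  -- The convective terms combine as $uu_x-vv_x=\big(\tfrac{u+v}{2}(u-v)\big)_x$, to which
  -- `sgn_isD_mul` applies with `d = u - v`.
  have e : mul (I (u1 r)) (u1 r) + u2 r + u1 r + Kc (u r) - u r -
      (mul (I (v1 r)) (v1 r) + v2 r + v1 r + Kc (v r) - v r) =
      (mul ((1/2 : ℝ) • (I (u2 r) + I (v2 r))) (u r - v r) +
        mul ((1/2 : ℝ) • (I (u1 r) + I (v1 r))) (u1 r - v1 r)) +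
      ((u2 r - v2 r) + (u1 r - v1 r)) + (Kc (u r - v r) - (u r - v r)) := by
    have e1 : mul ((1/2 : ℝ) • (I (u2 r) + I (v2 r))) (u r - v r) +
        mul ((1/2 : ℝ) • (I (u1 r) + I (v1 r))) (u1 r - v1 r) =
        mul (I (u1 r)) (u1 r) - mul (I (v1 r)) (v1 r) := by
      have ru := EventuallyEq.refl (ae volume) (u r : ℝ → ℝ)
      have rv := EventuallyEq.refl (ae volume) (v r : ℝ → ℝ)
      have ru1 := EventuallyEq.refl (ae volume) (u1 r : ℝ → ℝ)
      have rv1 := EventuallyEq.refl (ae volume) (v1 r : ℝ → ℝ)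
      refine Lp.ext ?_
      filter_upwards [rep_add (rep_mul ((1/2 : ℝ) • (I (u2 r) + I (v2 r))) (rep_sub ru rv))
        (rep_mul ((1/2 : ℝ) • (I (u1 r) + I (v1 r))) (rep_sub ru1 rv1)),
        rep_sub (rep_mul (I (u1 r)) ru1) (rep_mul (I (v1 r)) rv1), isD_ae_eq (hu.d1.isD r hrm),
        isD_ae_eq (hv.d1.isD r hrm), isD_ae_eq (hu.d2.isD r hrm), isD_ae_eq (hv.d2.isD r hrm)]
        with x x1 x2 x3 x4 x5 x6
      rw [x1, x2]
      simp only [BoundedContinuousFunction.coe_smul, BoundedContinuousFunction.coe_add, Pi.add_apply,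
        smul_eq_mul, ← x3, ← x4, ← x5, ← x6]
      ring
    rw [e1, map_sub]
    abel
  rw [e, map_add, map_add]
  have n1 := sgn_isD_mul da d1
  have n2 := sgn_heat d1 d2
  have n3 := sgn_Kc (u r - v r)
  linarith

/-- `L¹` contraction for classical solutions which are continuous up to the initial time. -/
theorem ClassicalOn.contraction {T : ℝ} {u u1 u2 u3 v v1 v2 v3 : ℝ → L1}
    (hu : ClassicalOn T u u1 u2 u3) (hv : ClassicalOn T v v1 v2 v3) (huc : ContinuousOn u (Icc 0 T))
    (hvc : ContinuousOn v (Icc 0 T)) {t : ℝ} (ht : t ∈ Icc 0 T) : ‖u t - v t‖ ≤ ‖u 0 - v 0‖ := by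
  have hT : 0 ≤ T := ht.1.trans ht.2
  have hc : ContinuousOn (fun t => ‖u t - v t‖) (Icc 0 T) := (huc.sub hvc).norm
  rcases ht.1.eq_or_lt with rfl | h0
  · rfl
  have step : ∀ r ∈ Ioo 0 T, ‖u r - v r‖ ≤ ‖u 0 - v 0‖ := by
    intro r hr
    have h1 : Tendsto (fun t => ‖u t - v t‖) (𝓝[>] 0) (𝓝 ‖u 0 - v 0‖) :=
      ((hc 0 ⟨le_rfl, hT⟩).mono_left (nhdsWithin_le_of_mem (by
        filter_upwards [Ioo_mem_nhdsGT (hr.1.trans hr.2)] with s hs using ⟨hs.1.le, hs.2.le⟩)))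
    refine ge_of_tendsto h1 ?_
    filter_upwards [Ioo_mem_nhdsGT hr.1] with s hs
    exact hu.contraction_Ioo hv hs.1 hs.2.le hr.2
  rcases ht.2.eq_or_lt with rfl | hlt
  · have h1 : Tendsto (fun t => ‖u t - v t‖) (𝓝[<] t) (𝓝 ‖u t - v t‖) :=
      ((hc t ⟨hT, le_rfl⟩).mono_left (nhdsWithin_le_of_mem (by
        filter_upwards [Ioo_mem_nhdsLT h0] with s hs using ⟨hs.1.le, hs.2.le⟩)))
    refine le_of_tendsto h1 ?_
    filter_upwards [Ioo_mem_nhdsLT h0] with s hs using step s hs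
  · exact step t ⟨h0, hlt⟩

lemma classicalOn_zero (T : ℝ) :
    ClassicalOn T (fun _ => 0) (fun _ => 0) (fun _ => 0) (fun _ => 0) := by
  have h : DCurve trL.τ (Ioc 0 T) (fun _ => 0) (fun _ => 0) :=
    ⟨continuousOn_const, continuousOn_const, fun t _ => by
      simpa [IsD] using hasDerivAt_const (0:ℝ) (0 : L1)⟩
  refine ⟨h, h, h, fun t _ => ?_⟩
  simpa using hasDerivAt_const t (0 : L1)

/-! ### The Hopf–Cole transformation of the initial datum -/

/-- The pointwise exponential. -/
def expB (b : BC) : BC := NormedSpace.exp b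

lemma expB_apply (b : BC) (x : ℝ) : expB b x = Real.exp (b x) := by
  let ev : BC →+* ℝ :=
    { toFun := fun f => f x
      map_one' := rfl
      map_mul' := fun _ _ => rfl
      map_zero' := rfl
      map_add' := fun _ _ => rfl }
  have h := NormedSpace.map_exp ev (BoundedContinuousFunction.evalCLM ℝ x).continuous b
  rw [← Real.exp_eq_exp_ℝ] at h
  exact h

lemma continuous_expB : Continuous expB := NormedSpace.exp_continuous

/-- The derivative of the Hopf–Cole variable attached to `u`. -/
def hc (u : L1) : L1 := mul (expB ((1/2 : ℝ) • I u)) ((1/2 : ℝ) • u)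

lemma continuous_hc : Continuous hc :=
  (mul.continuous.comp (continuous_expB.comp (I.continuous.const_smul (1/2 : ℝ)))).clm_apply
    (continuous_const_smul (1/2 : ℝ))

/-- Elements of the domain of `D` are dense. -/
lemma dense_isD (u : L1) : ∃ v v' : ℕ → L1, (∀ n, IsD trL.τ (v n) (v' n)) ∧ Tendsto v atTop (𝓝 u) := by
  have hc : Continuous fun s => trL.heat s u := trL.continuous_heat.comp (f := fun s => (s, u)) (by fun_prop)
  refine ⟨fun n => trL.heat (1 / ((n : ℝ) + 1)) u, fun n => trL.dheat (1 / ((n : ℝ) + 1)) u,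
    fun n => trL.isD_heat (by positivity) u, ?_⟩
  have := (hc.tendsto 0).comp (tendsto_one_div_add_atTop_nhds_zero_nat (𝕜 := ℝ))
  rwa [trL.heat_zero] at this

/-- With `U = I u`, this is $1+\int_{-\infty}^x(e^{U/2})'=e^{U/2}$. The fundamental theorem applies
directly when `u` is in the domain of `D`; the general case follows by density and continuity of
both sides. -/
lemma wB_hc (u : L1) : wB (hc u) = expB ((1/2 : ℝ) • I u) := by
  obtain ⟨v, v', hv, hlim⟩ := dense_isD u
  have h1 : Tendsto (fun n => wB (hc (v n))) atTop (𝓝 (wB (hc u))) :=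
    ((continuous_wB.comp continuous_hc).tendsto u).comp hlim
  have h2 : Tendsto (fun n => expB ((1/2 : ℝ) • I (v n))) atTop (𝓝 (expB ((1/2 : ℝ) • I u))) :=
    ((continuous_expB.comp (I.continuous.const_smul (1/2 : ℝ))).tendsto u).comp hlim
  refine tendsto_nhds_unique (h1.congr fun n => ?_) h2
  ext x
  have hd : ∀ y, HasDerivAt (expB ((1/2 : ℝ) • I (v n)))
      (Real.exp ((1/2) * I (v n) y) * ((1/2) * I (v' n) y)) y := fun y => by
    have := ((hasDerivAt_I (hv n) y).const_mul (1/2 : ℝ)).exp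
    refine this.congr_of_eventuallyEq (Eventually.of_forall fun z => ?_)
    rw [expB_apply]; rfl
  have hae : hc (v n) =ᵐ[volume] fun y => Real.exp ((1/2) * I (v n) y) * ((1/2) * I (v' n) y) := by
    filter_upwards [rep_mul (expB ((1/2 : ℝ) • I (v n))) (rep_smul (1/2) (isD_ae_eq (hv n)))] with y hy
    rw [hc, hy, expB_apply]; rfl
  have hlim0 : Tendsto (expB ((1/2 : ℝ) • I (v n))) atBot (𝓝 1) := by
    have h3 := ((tendsto_I_atBot (v n)).const_mul (1/2 : ℝ)).rexp
    rw [mul_zero, Real.exp_zero] at h3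
    refine h3.congr fun z => ?_
    rw [expB_apply]; rfl
  have hint := integral_Iic_of_hasDerivAt_of_tendsto (a := x) (hd x).continuousAt.continuousWithinAt
    (fun y _ => hd y) (((hc (v n)).integrable.congr hae).integrableOn) hlim0
  rw [wB, BoundedContinuousFunction.coe_add, Pi.add_apply, I_apply,
    integral_congr_ae (ae_restrict_of_ae hae), hint]
  simp

lemma isUnit_of_le {b : BC} {c : ℝ} (hc : 0 < c) (h : ∀ x, c ≤ b x) :
    IsUnit b ∧ ‖Ring.inverse b‖ ≤ c⁻¹ := by
  have hne : ∀ x, b x ≠ 0 := fun x => (hc.trans_le (h x)).ne'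
  have hb : ∀ x, ‖(b x)⁻¹‖ ≤ c⁻¹ := fun x => by
    rw [norm_inv, Real.norm_eq_abs, abs_of_pos (hc.trans_le (h x))]
    exact inv_anti₀ hc (h x)
  let i : BC := BoundedContinuousFunction.ofNormedAddCommGroup (fun x => (b x)⁻¹)
    (b.continuous.inv₀ hne) c⁻¹ hb
  have hi : i * b = 1 := by
    ext x
    exact inv_mul_cancel₀ (hne x)
  refine ⟨IsUnit.of_mul_eq_one i (by rw [mul_comm, hi]), ?_⟩
  rw [inverse_eq_of_mul_eq_one hi]
  exact BoundedContinuousFunction.norm_ofNormedAddCommGroup_le _ (by positivity) _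

lemma isUnit_expB (b : BC) : IsUnit (expB b) :=
  (isUnit_of_le (Real.exp_pos (-‖b‖)) fun x => by
    rw [expB_apply]
    exact Real.exp_le_exp.2 (neg_le_of_abs_le (b.norm_coe_le_norm x))).1

lemma hc_mem (u : L1) : hc u ∈ Om := by
  show IsUnit (wB (hc u))
  rw [wB_hc]; exact isUnit_expB _

lemma two_rL_hc (u : L1) : (2:ℝ) • rL (hc u) = u := by
  rw [rL, wB_hc, hc, mul_mul_apply, Ring.inverse_mul_cancel _ (isUnit_expB _), one_mul_apply, smul_smul]
  norm_num

/-- On the domain of `D`, the Hopf–Cole transformation is inverse to `q ↦ 2 • rL q`. -/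
lemma hc_two_rL {q q' : L1} (hq : q ∈ Om) (h : IsD trL.τ q q') : hc ((2:ℝ) • rL q) = q := by
  set u := (2:ℝ) • rL q with hu
  set u' := (2:ℝ) • (mul (-(Ring.inverse (wB q) * Ring.inverse (wB q) * I q')) q +
    mul (Ring.inverse (wB q)) q') with hu'
  have hd : IsD trL.τ u u' := by
    have h1 := isD_mul (isD_inverse (isD_one_add_I h) hq) h
    have h2 := HasDerivAt.fun_const_smul (2:ℝ) h1
    refine h2.congr_of_eventuallyEq (Eventually.of_forall fun y => ?_)
    simp [hu, rL, wB]
  have hI : I u' = (2:ℝ) • (Ring.inverse (wB q) * I q') := by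
    refine BC_ext_ae ?_
    filter_upwards [isD_ae_eq hd, rep_smul 2 (rep_mul (Ring.inverse (wB q)) (isD_ae_eq h))] with x h1 h2
    rw [← h1, hu, rL, h2]; rfl
  -- The product `w exp (-I u / 2)` has zero derivative and tends to `1` at `-∞`, so `w` is the
  -- exponential.
  have hz : ∀ x, HasDerivAt (fun x => wB q x * Real.exp (-((1/2 : ℝ) * I u x))) 0 x := fun x => by
    have h1 : HasDerivAt (wB q) (I q' x) x := (hasDerivAt_I h x).const_add 1
    have h2 := h1.mul (((hasDerivAt_I hd x).const_mul (1/2 : ℝ)).neg.exp)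
    refine h2.congr_deriv ?_
    have h3 := inverse_mul_apply hq x
    rw [hI]
    simp only [BoundedContinuousFunction.coe_smul, BoundedContinuousFunction.coe_mul, Pi.mul_apply, smul_eq_mul]
    simp only [Pi.neg_apply]
    linear_combination (-I q' x * Real.exp (-((1/2 : ℝ) * I u x))) * h3
  have hconst : ∀ x y, wB q x * Real.exp (-((1/2 : ℝ) * I u x)) = wB q y * Real.exp (-((1/2 : ℝ) * I u y)) :=
    fun x y => is_const_of_deriv_eq_zero (fun x => (hz x).differentiableAt) (fun x => (hz x).deriv) x y
  have hlim : Tendsto (fun x => wB q x * Real.exp (-((1/2 : ℝ) * I u x))) atBot (𝓝 1) := by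
    have h1 := ((tendsto_I_atBot q).const_add 1).mul ((tendsto_I_atBot u).const_mul (1/2 : ℝ)).neg.rexp
    simp only [add_zero, mul_zero, neg_zero, Real.exp_zero, mul_one] at h1
    exact h1
  have hexp : expB ((1/2 : ℝ) • I u) = wB q := by
    ext x
    have h1 : wB q x * Real.exp (-((1/2 : ℝ) * I u x)) = 1 :=
      tendsto_nhds_unique (tendsto_const_nhds.congr fun y => hconst x y) hlim
    rw [expB_apply]
    rw [Real.exp_neg, ← div_eq_mul_inv, div_eq_one_iff_eq (Real.exp_ne_zero _)] at h1
    exact h1.symm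
  rw [hc, hexp, hu, smul_smul, show (1/2 : ℝ) * 2 = 1 by norm_num, one_smul, rL, mul_mul_apply,
    Ring.mul_inverse_cancel _ hq, one_mul_apply]

/-! ### Local existence -/

/-- `g` is bounded and Lipschitz on `N`. -/
def BddLip {X : Type*} [NormedAddCommGroup X] (N : Set L1) (g : L1 → X) : Prop :=
  ∃ C, 0 ≤ C ∧ (∀ q ∈ N, ‖g q‖ ≤ C) ∧ ∀ q ∈ N, ∀ q' ∈ N, ‖g q - g q'‖ ≤ C * ‖q - q'‖

lemma BddLip.sub {X : Type*} [NormedAddCommGroup X] {N : Set L1} {f g : L1 → X}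
    (hf : BddLip N f) (hg : BddLip N g) :
    BddLip N fun q => f q - g q := by
  obtain ⟨C, hC, h1, h2⟩ := hf
  obtain ⟨D, hD, h3, h4⟩ := hg
  refine ⟨C + D, by positivity, fun q hq => (norm_sub_le _ _).trans (add_le_add (h1 q hq) (h3 q hq)),
    fun q hq q' hq' => ?_⟩
  rw [sub_sub_sub_comm, add_mul]
  exact (norm_sub_le _ _).trans (add_le_add (h2 q hq q' hq') (h4 q hq q' hq'))

section BddLip

variable {X Y Z : Type*} [NormedAddCommGroup X] [NormedSpace ℝ X] [NormedAddCommGroup Y]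
  [NormedSpace ℝ Y] [NormedAddCommGroup Z] [NormedSpace ℝ Z] {N : Set L1}

lemma BddLip.clm {f : L1 → X} (hf : BddLip N f) (A : X →L[ℝ] Y) : BddLip N fun q => A (f q) := by
  obtain ⟨C, hC, h1, h2⟩ := hf
  refine ⟨‖A‖ * C, by positivity, fun q hq => A.le_opNorm_of_le (h1 q hq), fun q hq q' hq' => ?_⟩
  rw [← map_sub, mul_assoc]
  exact A.le_opNorm_of_le (h2 q hq q' hq')

lemma BddLip.bilin {f : L1 → X} {g : L1 → Y} (hf : BddLip N f) (hg : BddLip N g)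
    (B : X →L[ℝ] Y →L[ℝ] Z) : BddLip N fun q => B (f q) (g q) := by
  obtain ⟨C, hC, h1, h2⟩ := hf
  obtain ⟨D, hD, h3, h4⟩ := hg
  refine ⟨‖B‖ * C * D + ‖B‖ * C * D, by positivity, fun q hq => ?_, fun q hq q' hq' => ?_⟩
  · refine (B.le_of_opNorm₂_le_of_le le_rfl (h1 q hq) (h3 q hq)).trans ?_
    have : 0 ≤ ‖B‖ * C * D := by positivity
    linarith
  · have e : B (f q) (g q) - B (f q') (g q') = B (f q - f q') (g q) + B (f q') (g q - g q') := by
      simp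
    rw [e]
    have e1 := B.le_of_opNorm₂_le_of_le le_rfl (h2 q hq q' hq') (h3 q hq)
    have e2 := B.le_of_opNorm₂_le_of_le le_rfl (h1 q' hq') (h4 q hq q' hq')
    refine (norm_add_le _ _).trans ((add_le_add e1 e2).trans (le_of_eq ?_))
    ring

end BddLip

/-- Data with Hopf–Cole variable bounded below. -/
def Nset (R c : ℝ) : Set L1 := {q | ‖q‖ ≤ R ∧ ∀ x, c ≤ wB q x}

lemma Nset_subset {R c : ℝ} (hc : 0 < c) : Nset R c ⊆ Om := fun _ hq => (isUnit_of_le hc hq.2).1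

/-- Everything but `1/w` is linear or bilinear. On `Nset` the inverse is bounded by `1/c`, and `1/w
- 1/w' = (w' - w) / (w w')` makes it Lipschitz. -/
lemma bddLip_nonlin {R c : ℝ} (hc : 0 < c) : BddLip (Nset R c) nonlin := by
  have hid : BddLip (Nset R c) fun q => q :=
    -- One constant serves as bound and as Lipschitz constant, hence the `1`.
    ⟨max R 1, by positivity, fun q hq => hq.1.trans (le_max_left _ _), fun q _ q' _ =>
      le_mul_of_one_le_left (norm_nonneg _) (le_max_right _ _)⟩
  have hone : BddLip (Nset R c) fun _ => (1 : BC) :=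
    ⟨1, zero_le_one, fun q _ => norm_one.le, fun q _ q' _ => by simp⟩
  have hw : BddLip (Nset R c) wB := by
    have h := hone.sub (hid.clm (-I))
    simpa [wB, sub_neg_eq_add] using! h
  have hi : BddLip (Nset R c) fun q => Ring.inverse (wB q) := by
    obtain ⟨C, hC, h1, h2⟩ := hw
    refine ⟨c⁻¹ + c⁻¹ * c⁻¹ * C, by positivity, fun q hq => ?_, fun q hq q' hq' => ?_⟩
    · have := (isUnit_of_le hc hq.2).2
      have : 0 ≤ c⁻¹ * c⁻¹ * C := by positivity
      linarith
    · have e : Ring.inverse (wB q) - Ring.inverse (wB q') =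
          Ring.inverse (wB q) * Ring.inverse (wB q') * -(wB q - wB q') := by
        have e1 := Ring.inverse_mul_cancel _ (isUnit_of_le hc hq.2).1
        have e2 := Ring.inverse_mul_cancel _ (isUnit_of_le hc hq'.2).1
        linear_combination (-Ring.inverse (wB q)) * e2 + Ring.inverse (wB q') * e1
      rw [e]
      calc _ ≤ ‖Ring.inverse (wB q)‖ * ‖Ring.inverse (wB q')‖ * ‖wB q - wB q'‖ := by
            refine (norm_mul_le _ _).trans ?_
            rw [norm_neg]
            exact mul_le_mul_of_nonneg_right (norm_mul_le _ _) (norm_nonneg _)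
        _ ≤ c⁻¹ * c⁻¹ * (C * ‖q - q'‖) := by
            gcongr
            · exact (isUnit_of_le hc hq.2).2
            · exact (isUnit_of_le hc hq'.2).2
            · exact h2 q hq q' hq'
        _ ≤ _ := by
            have : 0 ≤ c⁻¹ * ‖q - q'‖ := by positivity
            nlinarith
  have hr : BddLip (Nset R c) rL := hi.bilin hid mul
  have hk := hr.clm Kc
  exact ((hw.bilin hk mul).sub (((hr.sub hk).clm I).bilin hid mul)).sub hid

/-- The function `wB` of the heat flow is a Gaussian average of translates of `wB q`, so lower
bounds persist. -/
lemma le_wB_heat {q : L1} {c : ℝ} (h : ∀ x, c ≤ wB q x) (t x : ℝ) : c ≤ wB (trL.heat t q) x := by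
  have hi : Integrable (fun z => trL.τ (t + √(2 * t) * z) q) stdGauss := by
    simpa only [one_smul] using
      trL.integrable_avg (k := fun _ => 1) (integrable_const _) t (√(2 * t)) q
  have h1 : I (trL.heat t q) x = ∫ z, I q (x + (t + √(2 * t) * z)) ∂stdGauss := by
    have := ContinuousLinearMap.integral_comp_comm
      ((BoundedContinuousFunction.evalCLM ℝ x : BC →L[ℝ] ℝ).comp I) hi
    rw [trL.heat_apply]
    refine Eq.trans this.symm ?_
    simp [I_τ]
  have hi' : Integrable (fun z => I q (x + (t + √(2 * t) * z))) stdGauss := by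
    have := ((BoundedContinuousFunction.evalCLM ℝ x : BC →L[ℝ] ℝ).comp I).integrable_comp hi
    refine this.congr (Eventually.of_forall fun z => ?_)
    simp [I_τ]
  have h2 : ∫ z, (c - 1) ∂stdGauss ≤ ∫ z, I q (x + (t + √(2 * t) * z)) ∂stdGauss :=
    integral_mono (integrable_const _) hi' fun z => by
      have : c ≤ 1 + I q (x + (t + √(2 * t) * z)) := h _
      linarith
  rw [← h1] at h2
  simp only [integral_const, probReal_univ, one_smul] at h2
  show c ≤ 1 + I (trL.heat t q) x
  linarith

/-- Local existence, on a time interval depending only on bounds for the datum. -/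
theorem exists_mildSol (R : ℝ) {c : ℝ} (hc : 0 < c) : ∃ δ > 0, ∀ q₀ ∈ Nset R c,
    ∃ q, MildSol δ q ∧ q 0 = q₀ := by
  -- Since `|I f| ≤ ‖f‖`, staying within `c / 2` of the free heat flow keeps the norm below `R + c /
  -- 2` and `w` above `c / 2`.
  obtain ⟨C, hC, hb, hl⟩ := bddLip_nonlin (R := R + c / 2) (half_pos hc)
  -- The first smallness condition makes the fixed point map preserve the ball, the second makes it
  -- a contraction.
  obtain ⟨δ, hδ, hδ1, hδ2⟩ : ∃ δ > 0, δ * C ≤ c / 2 ∧ δ * C ≤ 1 / 2 := by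
    refine ⟨min (c / 2) (1 / 2) / (C + 1), by positivity, ?_, ?_⟩
    · calc _ = min (c / 2) (1 / 2) * (C / (C + 1)) := by ring
        _ ≤ min (c / 2) (1 / 2) * 1 := by gcongr; rw [div_le_one (by positivity)]; linarith
        _ ≤ _ := by rw [mul_one]; exact min_le_left _ _
    · calc _ = min (c / 2) (1 / 2) * (C / (C + 1)) := by ring
        _ ≤ min (c / 2) (1 / 2) * 1 := by gcongr; rw [div_le_one (by positivity)]; linarith
        _ ≤ _ := by rw [mul_one]; exact min_le_right _ _
  refine ⟨δ, hδ, fun q₀ hq₀ => ?_⟩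
  have h0 : (0:ℝ) ≤ δ := hδ.le
  have hheat : Continuous fun t => trL.heat t q₀ :=
    trL.continuous_heat.comp (f := fun t => (t, q₀)) (by fun_prop)
  let p₀ : C(Icc 0 δ, L1) := ⟨fun t => trL.heat t q₀, hheat.comp continuous_subtype_val⟩
  let B : Set C(Icc 0 δ, L1) := Metric.closedBall p₀ (c / 2)
  have hN : ∀ p ∈ B, ∀ t, IccExtend h0 p t ∈ Nset (R + c / 2) (c / 2) := by
    intro p hp t
    set t' := projIcc 0 δ h0 t
    have h1 : ‖p t' - trL.heat t' q₀‖ ≤ c / 2 := by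
      rw [← dist_eq_norm]
      exact (ContinuousMap.dist_apply_le_dist (f := p) (g := p₀) t').trans hp
    refine ⟨?_, fun x => ?_⟩
    · have h2 := (trL.norm_heat_le t' q₀).trans hq₀.1
      have h3 := norm_le_norm_add_norm_sub' (p t') (trL.heat t' q₀)
      show ‖p t'‖ ≤ _
      linarith
    · have h2 := le_wB_heat hq₀.2 t' x
      have h3 := (abs_I_le (p t' - trL.heat t' q₀) x).trans h1
      have h4 : wB (p t') x = wB (trL.heat t' q₀) x + I (p t' - trL.heat t' q₀) x := by
        simp [wB]
      show _ ≤ wB (p t') x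
      have := neg_le_of_abs_le h3
      linarith
  have hsrc : ∀ p ∈ B, Continuous fun s => nonlin (IccExtend h0 p s) := fun p hp =>
    contDiffOn_nonlin.continuousOn.comp_continuous (p.continuous.Icc_extend')
      fun t => Nset_subset (half_pos hc) (hN p hp t)
  have hF : ∀ f : ℝ → L1, Continuous f → Continuous fun p : ℝ × ℝ => trL.heat (p.1 - p.2) (f p.2) :=
    fun f hf => trL.continuous_heat.comp (f := fun p : ℝ × ℝ => (p.1 - p.2, f p.2)) (by fun_prop)
  have hduh : ∀ f : ℝ → L1, Continuous f →
      Continuous fun t => ∫ s in (0:ℝ)..t, trL.heat (t - s) (f s) := fun f hf =>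
    intervalIntegral.continuous_parametric_intervalIntegral_of_continuous
      (f := fun t s => trL.heat (t - s) (f s)) (hF f hf) continuous_id
  classical
  -- The value outside the ball is a default: there `w` may fail to be invertible, and the source
  -- need not be continuous.
  let Φ : C(Icc 0 δ, L1) → C(Icc 0 δ, L1) := fun p => if hp : p ∈ B then
    ⟨fun t => trL.heat t q₀ + ∫ s in (0:ℝ)..t, trL.heat (t - s) (nonlin (IccExtend h0 p s)),
      (hheat.add (hduh _ (hsrc p hp))).comp continuous_subtype_val⟩ else p
  have hΦ : ∀ p ∈ B, ∀ t, Φ p t =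
      trL.heat t q₀ + ∫ s in (0:ℝ)..t, trL.heat (t - s) (nonlin (IccExtend h0 p s)) := fun p hp t => by
    simp only [Φ, dif_pos hp]; rfl
  have hmaps : MapsTo Φ B B := by
    intro p hp
    rw [Metric.mem_closedBall, ContinuousMap.dist_le (by positivity)]
    intro t
    rw [hΦ p hp, dist_eq_norm]
    show ‖trL.heat t q₀ + _ - trL.heat t q₀‖ ≤ _
    rw [add_sub_cancel_left]
    refine (intervalIntegral.norm_integral_le_of_norm_le_const (C := C) fun s _ =>
      (trL.norm_heat_le _ _).trans (hb _ (hN p hp s))).trans ?_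
    rw [sub_zero, abs_of_nonneg t.2.1, mul_comm]
    exact (mul_le_mul_of_nonneg_right t.2.2 hC).trans hδ1
  have hcontr : ∀ p ∈ B, ∀ p' ∈ B, dist (Φ p) (Φ p') ≤ (1/2 : ℝ) * dist p p' := by
    intro p hp p' hp'
    rw [ContinuousMap.dist_le (by positivity)]
    intro t
    have i1 : ∀ p ∈ B, IntervalIntegrable (fun s => trL.heat (t - s) (nonlin (IccExtend h0 p s))) volume 0 t :=
      fun p hp => ((hF _ (hsrc p hp)).comp (f := fun s : ℝ => ((t : ℝ), s))
        (by fun_prop)).intervalIntegrable _ _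
    rw [hΦ p hp, hΦ p' hp', dist_eq_norm, add_sub_add_left_eq_sub,
      ← intervalIntegral.integral_sub (i1 p hp) (i1 p' hp')]
    refine (intervalIntegral.norm_integral_le_of_norm_le_const (C := C * dist p p') fun s _ => ?_).trans ?_
    · rw [← map_sub]
      refine (trL.norm_heat_le _ _).trans ((hl _ (hN p hp s) _ (hN p' hp' s)).trans ?_)
      gcongr
      rw [← dist_eq_norm]
      exact ContinuousMap.dist_apply_le_dist _
    · rw [sub_zero, abs_of_nonneg t.2.1]
      calc C * dist p p' * t ≤ C * dist p p' * δ := by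
            gcongr; exact t.2.2
        _ = (δ * C) * dist p p' := by ring
        _ ≤ _ := by gcongr
  have hlip : ContractingWith (1/2 : ℝ≥0) (hmaps.restrict Φ B B) := by
    refine ⟨by norm_num, LipschitzWith.of_dist_le_mul fun p p' => ?_⟩
    have := hcontr p p.2 p' p'.2
    simpa using! this
  obtain ⟨p, hpB, hpfix, -⟩ := hlip.exists_fixedPoint' Metric.isClosed_closedBall.isComplete hmaps
    (Metric.mem_closedBall_self (by positivity)) (edist_ne_top p₀ _)
  have hpq : ∀ t (ht : t ∈ Icc 0 δ), IccExtend h0 p t =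
      trL.heat t q₀ + ∫ s in (0:ℝ)..t, trL.heat (t - s) (nonlin (IccExtend h0 p s)) := fun t ht => by
    rw [IccExtend_of_mem h0 p ht]
    conv_lhs => rw [← hpfix.eq]
    exact hΦ p hpB ⟨t, ht⟩
  have hz : IccExtend h0 p 0 = q₀ := by
    rw [hpq 0 ⟨le_rfl, h0⟩]; simp [trL.heat_zero]
  refine ⟨IccExtend h0 p, ⟨(p.continuous.Icc_extend').continuousOn, fun t _ =>
    Nset_subset (half_pos hc) (hN p hpB t), fun t ht => ?_⟩, hz⟩
  rw [hz, sub_zero]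
  exact hpq t ht

/-! ### Global existence -/

lemma MildSol.continuousOn_rL {T : ℝ} {q : ℝ → L1} (h : MildSol T q) :
    ContinuousOn (fun t => (2:ℝ) • rL (q t)) (Icc 0 T) :=
  (contDiffOn_rL.continuousOn.comp h.cont h.mem).const_smul (2:ℝ)

lemma MildSol.mono {T T' : ℝ} {q : ℝ → L1} (h : MildSol T q) (hT : T' ≤ T) : MildSol T' q :=
  ⟨h.cont.mono (Icc_subset_Icc_right hT), fun t ht => h.mem t ⟨ht.1, ht.2.trans hT⟩,
    fun t ht => h.mild t ⟨ht.1, ht.2.trans hT⟩⟩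

lemma MildSol.congr {T : ℝ} {q q' : ℝ → L1} (h : MildSol T q) (he : EqOn q' q (Icc 0 T)) :
    MildSol T q' := by
  refine ⟨h.cont.congr he, fun t ht => by rw [he ht]; exact h.mem t ht, fun t ht => ?_⟩
  rw [he ht, he ⟨le_rfl, ht.1.trans ht.2⟩, h.mild t ht]
  congr 1
  refine intervalIntegral.integral_congr fun s hs => ?_
  rw [uIcc_of_le ht.1] at hs
  simp only
  rw [he ⟨hs.1, hs.2.trans ht.2⟩]

lemma mildSol_zero (q₀ : L1) (h : q₀ ∈ Om) : MildSol 0 fun _ => q₀ := by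
  refine ⟨continuousOn_const, fun _ _ => h, fun t ht => ?_⟩
  obtain rfl : t = 0 := le_antisymm ht.2 ht.1
  simp [trL.heat_zero]

lemma MildSol.concat {T δ : ℝ} {q q' : ℝ → L1} (hT : 0 ≤ T) (h : MildSol T q) (h' : MildSol δ q')
    (hq : q' 0 = q T) : MildSol (T + δ) fun t => if t ≤ T then q t else q' (t - T) := by
  set p : ℝ → L1 := fun t => if t ≤ T then q t else q' (t - T) with hp
  have p1 : ∀ t, t ≤ T → p t = q t := fun t ht => if_pos ht
  have p2 : ∀ t, T ≤ t → p t = q' (t - T) := fun t ht => by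
    rcases ht.eq_or_lt with rfl | h
    · rw [p1 T le_rfl, sub_self, hq]
    · exact if_neg (not_le.2 h)
  have hcont : ContinuousOn p (Icc 0 (T + δ)) := by
    have e : Icc 0 (T + δ) ⊆ Icc 0 T ∪ Icc T (T + δ) := fun t ht => by
      rcases le_total t T with h | h
      · exact Or.inl ⟨ht.1, h⟩
      · exact Or.inr ⟨h, ht.2⟩
    refine ContinuousOn.mono ?_ e
    refine ContinuousOn.union_of_isClosed ?_ ?_ isClosed_Icc isClosed_Icc
    · exact h.cont.congr fun t ht => p1 t ht.2
    · refine ContinuousOn.congr (f := fun t => q' (t - T)) ?_ fun t ht => p2 t ht.1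
      exact h'.cont.comp (by fun_prop) fun t ht => ⟨sub_nonneg.2 ht.1, by linarith [ht.2]⟩
  have hmem : ∀ t ∈ Icc 0 (T + δ), p t ∈ Om := fun t ht => by
    rcases le_total t T with h1 | h1
    · rw [p1 t h1]; exact h.mem t ⟨ht.1, h1⟩
    · rw [p2 t h1]; exact h'.mem _ ⟨sub_nonneg.2 h1, by linarith [ht.2]⟩
  refine ⟨hcont, hmem, fun t ht => ?_⟩
  have c0 : ∀ t ∈ Icc 0 T, p t = trL.heat (t - 0) (p 0) + ∫ s in (0:ℝ)..t, trL.heat (t - s) (nonlin (p s)) := by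
    intro t ht
    exact (h.congr (q' := p) fun s hs => p1 s hs.2).mild t ht
  rcases le_total t T with h1 | h1
  · exact c0 t ⟨ht.1, h1⟩
  have hsrc : ContinuousOn (fun t => nonlin (p t)) (Icc 0 (T + δ)) :=
    contDiffOn_nonlin.continuousOn.comp hcont hmem
  have hTδ : T ≤ T + δ := h1.trans ht.2
  have i1 := trL.intervalIntegrable_heat_duhamel hsrc hT hTδ
  have i2 := trL.intervalIntegrable_heat_duhamel hsrc ht.1 ht.2
  have e1 := h'.mild (t - T) ⟨sub_nonneg.2 h1, by linarith [ht.2]⟩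
  rw [← p2 t h1, hq, ← p1 T le_rfl, c0 T ⟨hT, le_rfl⟩, sub_zero, sub_zero, map_add,
    ← trL.heat_add _ _ (by linarith) hT, sub_add_cancel, ← ContinuousLinearMap.intervalIntegral_comp_comm _ i1] at e1
  have e2 : ∫ s in (0:ℝ)..T, trL.heat (t - T) (trL.heat (T - s) (nonlin (p s))) =
      ∫ s in (0:ℝ)..T, trL.heat (t - s) (nonlin (p s)) := by
    refine intervalIntegral.integral_congr fun s hs => ?_
    rw [uIcc_of_le hT] at hs
    rw [← trL.heat_add _ _ (by linarith) (by linarith [hs.2])]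
    congr 2; ring
  have e3 : ∫ s in (0:ℝ)..(t - T), trL.heat (t - T - s) (nonlin (q' s)) =
      ∫ s in T..t, trL.heat (t - s) (nonlin (p s)) := by
    have := intervalIntegral.integral_comp_sub_right (a := T) (b := t)
      (fun s => trL.heat (t - T - s) (nonlin (q' s))) T
    rw [sub_self] at this
    rw [← this]
    refine intervalIntegral.integral_congr fun s hs => ?_
    rw [uIcc_of_le h1] at hs
    rw [p2 s hs.1]
    congr 2; ring
  have hsub : ∀ c ∈ Icc 0 t, c ∈ uIcc 0 t := fun c hc => by rwa [uIcc_of_le ht.1]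
  rw [e2, e3, add_assoc, intervalIntegral.integral_add_adjacent_intervals] at e1
  · rw [sub_zero]; exact e1
  · exact i2.mono_set (uIcc_subset_uIcc (hsub _ ⟨le_rfl, ht.1⟩) (hsub _ ⟨hT, h1⟩))
  · exact i2.mono_set (uIcc_subset_uIcc (hsub _ ⟨hT, h1⟩) (hsub _ ⟨ht.1, le_rfl⟩))

/-- For positive times `q` lies in the domain of `D`, where `hc_two_rL` applies; hence the exclusion
of `t = 0`. -/
lemma MildSol.hc_eq {T : ℝ} {q : ℝ → L1} (h : MildSol T q) {t : ℝ} (ht : t ∈ Ioc 0 T) :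
    hc ((2:ℝ) • rL (q t)) = q t := by
  obtain ⟨q1, -, -, h1, -, -⟩ := h.regular
  exact hc_two_rL (h.mem t ⟨ht.1.le, ht.2⟩) (h1.isD t ht)

lemma MildSol.norm_le {T : ℝ} {q : ℝ → L1} (h : MildSol T q) {t : ℝ} (ht : t ∈ Icc 0 T) :
    ‖(2:ℝ) • rL (q t)‖ ≤ ‖(2:ℝ) • rL (q 0)‖ := by
  obtain ⟨u1, u2, u3, hu⟩ := h.classical
  simpa using hu.contraction (classicalOn_zero T) h.continuousOn_rL continuousOn_const ht

/-- Contraction identifies the functions `u = 2 q / w`, and for positive times `q` is recovered from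
`u`. -/
lemma MildSol.unique {T : ℝ} {q q' : ℝ → L1} (h : MildSol T q) (h' : MildSol T q') (h0 : q 0 = q' 0) :
    EqOn q q' (Icc 0 T) := by
  intro t ht
  rcases ht.1.eq_or_lt with rfl | hpos
  · exact h0
  obtain ⟨u1, u2, u3, hu⟩ := h.classical
  obtain ⟨v1, v2, v3, hv⟩ := h'.classical
  have h1 := hu.contraction hv h.continuousOn_rL h'.continuousOn_rL ht
  simp only [h0, sub_self, norm_zero] at h1
  have h2 := sub_eq_zero.1 (norm_le_zero_iff.1 h1)
  rw [← h.hc_eq ⟨hpos, ht.2⟩, ← h'.hc_eq ⟨hpos, ht.2⟩, h2]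

/-- From `|I v| ≤ ‖v‖ ≤ M` one has `exp (-M/2) ≤ w ≤ exp (M/2)`. The `L¹` norm of the solution thus
controls all quantities on which the local existence time depends. -/
lemma hc_mem_Nset {M : ℝ} {v : L1} (hv : ‖v‖ ≤ M) :
    hc v ∈ Nset (Real.exp (M / 2) * (M / 2)) (Real.exp (-(M / 2))) := by
  have hI : ∀ x, |((1/2 : ℝ) • I v) x| ≤ M / 2 := fun x => by
    have h1 := abs_I_le v x
    show |(1/2 : ℝ) * I v x| ≤ M / 2
    rw [abs_mul, abs_of_pos (by norm_num)]
    linarith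
  refine ⟨?_, fun x => ?_⟩
  · refine (norm_mul_le' _ _).trans ?_
    gcongr
    · refine (BoundedContinuousFunction.norm_le (Real.exp_pos _).le).2 fun x => ?_
      rw [expB_apply, Real.norm_eq_abs, abs_of_pos (Real.exp_pos _)]
      exact Real.exp_le_exp.2 ((le_abs_self _).trans (hI x))
    · rw [norm_smul]; norm_num; linarith
  · rw [wB_hc, expB_apply]
    exact Real.exp_le_exp.2 (neg_le_of_abs_le (hI x))

/-- Global existence for the transformed equation. -/
theorem exists_global (u₀ : L1) : ∃ q : ℝ → L1, q 0 = hc u₀ ∧ ∀ T, MildSol T q := by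
  obtain ⟨δ, hδ, hloc⟩ := exists_mildSol (Real.exp (‖u₀‖ / 2) * (‖u₀‖ / 2))
    (Real.exp_pos (-(‖u₀‖ / 2)))
  have step : ∀ n : ℕ, ∃ q, MildSol (n * δ) q ∧ q 0 = hc u₀ := by
    intro n
    induction n with
    | zero => exact ⟨fun _ => hc u₀, by simpa using mildSol_zero _ (hc_mem u₀), rfl⟩
    | succ n ih =>
      obtain ⟨q, hq, hq0⟩ := ih
      have hT : (0:ℝ) ≤ n * δ := by positivity
      -- Comparison with zero gives `‖u‖ ≤ ‖u₀‖` at the new starting time, so the same `δ` works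
      -- again.
      have hN : q (n * δ) ∈ Nset (Real.exp (‖u₀‖ / 2) * (‖u₀‖ / 2)) (Real.exp (-(‖u₀‖ / 2))) := by
        rcases hT.eq_or_lt with h | h
        · rw [← h, hq0]; exact hc_mem_Nset le_rfl
        · rw [← hq.hc_eq ⟨h, le_rfl⟩]
          have := hq.norm_le ⟨hT, le_rfl⟩
          rw [hq0, two_rL_hc] at this
          exact hc_mem_Nset this
      obtain ⟨q', hq', hq0'⟩ := hloc _ hN
      refine ⟨_, by simpa [add_mul] using hq.concat hT hq' hq0', ?_⟩
      simp only [hT, if_true, hq0]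
  choose Q hQ hQ0 using step
  have hagree : ∀ m n : ℕ, m ≤ n → EqOn (Q m) (Q n) (Icc 0 (m * δ)) := fun m n hmn =>
    (hQ m).unique ((hQ n).mono (by gcongr)) (by rw [hQ0, hQ0])
  have hceil : ∀ t : ℝ, t ≤ ⌈t / δ⌉₊ * δ := fun t => (div_le_iff₀ hδ).1 (Nat.le_ceil _)
  refine ⟨fun t => Q ⌈t / δ⌉₊ t, hQ0 _, fun T => ?_⟩
  refine ((hQ ⌈T / δ⌉₊).mono (hceil T)).congr fun t ht => ?_
  exact hagree _ _ (Nat.ceil_mono (by gcongr; exact ht.2)) ⟨ht.1, hceil t⟩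

/-! ### Global classical solutions and contraction -/

/-- A global classical solution, continuous up to the initial time. -/
structure GlobalSol (u u1 u2 u3 : ℝ → L1) : Prop where
  cont : ContinuousOn u (Ici 0)
  d1 : DCurve trL.τ (Ioi 0) u u1
  d2 : DCurve trL.τ (Ioi 0) u1 u2
  d3 : DCurve trL.τ (Ioi 0) u2 u3
  time : ∀ t, 0 < t → HasDerivAt u (mul (I (u1 t)) (u1 t) + u2 t + u1 t + Kc (u t) - u t) t

lemma GlobalSol.classicalOn {u u1 u2 u3 : ℝ → L1} (h : GlobalSol u u1 u2 u3) (T : ℝ) :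
    ClassicalOn T u u1 u2 u3 :=
  ⟨h.d1.mono Ioc_subset_Ioi_self, h.d2.mono Ioc_subset_Ioi_self, h.d3.mono Ioc_subset_Ioi_self,
    fun t ht => h.time t ht.1⟩

lemma continuousOn_Ioi_of_Ioc {X : Type*} [TopologicalSpace X] {g : ℝ → X} 
    (h : ∀ T, ContinuousOn g (Ioc 0 T)) : ContinuousOn g (Ioi 0) := by
  intro t ht
  refine (h (t + 1) t ⟨ht, by linarith⟩).mono_of_mem_nhdsWithin ?_
  filter_upwards [self_mem_nhdsWithin, mem_nhdsWithin_of_mem_nhds (gt_mem_nhds (show t < t + 1 by linarith))]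
    with s h1 h2 using ⟨h1, h2.le⟩

/-- Existence of a global classical solution. -/
theorem exists_globalSol (u₀ : L1) : ∃ u u1 u2 u3 : ℝ → L1, GlobalSol u u1 u2 u3 ∧ u 0 = u₀ := by
  obtain ⟨q, hq0, hq⟩ := exists_global u₀
  set u : ℝ → L1 := fun t => (2:ℝ) • rL (q t) with hu
  -- Writing the derivatives through `trL.D` makes them independent of `T`, so that the solutions on
  -- `(0, T]` fit together.
  have key : ∀ T, ClassicalOn T u (fun t => trL.D (u t)) (fun t => trL.D (trL.D (u t)))
      (fun t => trL.D (trL.D (trL.D (u t)))) := by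
    intro T
    obtain ⟨u1, u2, u3, h⟩ := (hq T).classical
    have e1 : ∀ t ∈ Ioc 0 T, trL.D (u t) = u1 t := fun t ht => TransGroup.D_eq (h.d1.isD t ht)
    have e2 : ∀ t ∈ Ioc 0 T, trL.D (trL.D (u t)) = u2 t := fun t ht => by
      rw [e1 t ht]; exact TransGroup.D_eq (h.d2.isD t ht)
    have e3 : ∀ t ∈ Ioc 0 T, trL.D (trL.D (trL.D (u t))) = u3 t := fun t ht => by
      rw [e2 t ht]; exact TransGroup.D_eq (h.d3.isD t ht)
    refine ⟨⟨h.d1.cont, h.d1.cont'.congr e1, fun t ht => ?_⟩,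
      ⟨h.d2.cont.congr e1, h.d2.cont'.congr e2, fun t ht => ?_⟩,
      ⟨h.d3.cont.congr e2, h.d3.cont'.congr e3, fun t ht => ?_⟩, fun t ht => ?_⟩
    · rw [e1 t ht]; exact h.d1.isD t ht
    · rw [e2 t ht, e1 t ht]; exact h.d2.isD t ht
    · rw [e3 t ht, e2 t ht]; exact h.d3.isD t ht
    · have ht' : t ∈ Ioc 0 T := ⟨ht.1, ht.2.le⟩
      rw [e2 t ht', e1 t ht']; exact h.time t ht
  refine ⟨u, _, _, _, ⟨?_, ⟨continuousOn_Ioi_of_Ioc fun T => (key T).d1.cont,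
    continuousOn_Ioi_of_Ioc fun T => (key T).d1.cont', fun t ht => (key t).d1.isD t ⟨ht, le_rfl⟩⟩,
    ⟨continuousOn_Ioi_of_Ioc fun T => (key T).d2.cont,
    continuousOn_Ioi_of_Ioc fun T => (key T).d2.cont', fun t ht => (key t).d2.isD t ⟨ht, le_rfl⟩⟩,
    ⟨continuousOn_Ioi_of_Ioc fun T => (key T).d3.cont,
    continuousOn_Ioi_of_Ioc fun T => (key T).d3.cont', fun t ht => (key t).d3.isD t ⟨ht, le_rfl⟩⟩,
    fun t ht => (key (t + 1)).time t ⟨ht, by linarith⟩⟩, ?_⟩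
  · intro t ht
    refine ((hq (t + 1)).continuousOn_rL t ⟨ht, by linarith⟩).mono_of_mem_nhdsWithin ?_
    filter_upwards [self_mem_nhdsWithin, mem_nhdsWithin_of_mem_nhds (gt_mem_nhds (show t < t + 1 by linarith))]
      with s h1 h2 using ⟨h1, h2.le⟩
  · simp only [hu, hq0, two_rL_hc]

/-- `L¹` contraction for global solutions. -/
theorem GlobalSol.contraction {u u1 u2 u3 v v1 v2 v3 : ℝ → L1} (hu : GlobalSol u u1 u2 u3)
    (hv : GlobalSol v v1 v2 v3) {t : ℝ} (ht : 0 ≤ t) : ‖u t - v t‖ ≤ ‖u 0 - v 0‖ :=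
  (hu.classicalOn t).contraction (hv.classicalOn t) (hu.cont.mono Icc_subset_Ici_self)
    (hv.cont.mono Icc_subset_Ici_self) ⟨ht, le_rfl⟩

/-! ### Test functions on the line and the pairing of `L¹` with bounded functions -/

/-- The integral as a functional on `L¹`. -/
def intL : L1 →L[ℝ] ℝ := pairM (fun _ => 1) measurable_const (by simp)

lemma intL_apply (f : L1) : intL f = ∫ x, f x := by
  simp [intL, pairM_apply]

lemma intL_τ (y : ℝ) (f : L1) : intL (trL.τ y f) = intL f := by
  rw [intL_apply, intL_apply, integral_congr_ae (trL_ae y f)]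
  exact integral_add_right_eq_self (μ := volume) (fun x => f x) y

/-- The pairing `∫ b f`. -/
def pB : BC →L[ℝ] L1 →L[ℝ] ℝ := (ContinuousLinearMap.compL ℝ L1 L1 ℝ intL).comp mul

lemma pB_eq (b : BC) (f : L1) : pB b f = intL (mul b f) := rfl

lemma pB_apply (b : BC) (f : L1) : pB b f = ∫ x, b x * f x := by
  rw [pB_eq, intL_apply]
  exact integral_congr_ae (mul_ae b f)

lemma pB_τ (y : ℝ) (b : BC) (f : L1) : pB (trB y b) (trL.τ y f) = pB b f := by
  rw [pB_eq, pB_eq, ← mul_τ, intL_τ]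

lemma intL_isD {f g : L1} (h : IsD trL.τ f g) : intL g = 0 := by
  have h1 : HasDerivAt (fun y => intL (trL.τ y f)) (intL g) 0 :=
    intL.hasFDerivAt.comp_hasDerivAt (0:ℝ) h
  simp only [intL_τ] at h1
  exact h1.unique (hasDerivAt_const _ _)

/-- Integration by parts: the integral is translation invariant, hence vanishes on derivatives, in
particular on that of a product. -/
lemma pB_isD {b b' : BC} {f f' : L1} (hb : IsD trB b b') (hf : IsD trL.τ f f') :
    pB b f' = -pB b' f := by
  have := intL_isD (isD_mul hb hf)
  rw [map_add] at this
  exact eq_neg_of_add_eq_zero_right this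

lemma hasDerivAt_BC {F : ℝ → BC} {F' : BC} {t : ℝ}
    (h : ∀ ε > 0, ∃ δ > 0, ∀ y, |y| < δ → ∀ x, |F (t + y) x - F t x - y * F' x| ≤ ε * |y|) :
    HasDerivAt F F' t := by
  rw [hasDerivAt_iff_isLittleO_nhds_zero, Asymptotics.isLittleO_iff]
  intro ε hε
  obtain ⟨δ, hδ, H⟩ := h ε hε
  filter_upwards [Metric.ball_mem_nhds (0:ℝ) hδ] with y hy
  rw [Metric.mem_ball, dist_zero_right, Real.norm_eq_abs] at hy
  refine (BoundedContinuousFunction.norm_le (by positivity)).2 fun x => ?_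
  simpa using H y hy x

/-- Compact support makes the derivative uniformly continuous, so the remainder is small uniformly
in the base point. This yields differentiability in the supremum norm. -/
lemma uniform_taylor {X : Type*} [NormedAddCommGroup X] [NormedSpace ℝ X] {φ : X → ℝ}
    (h : ContDiff ℝ ∞ φ) (hc : HasCompactSupport φ) {ε : ℝ} (hε : 0 < ε) :
    ∃ δ > 0, ∀ p v : X, ‖v‖ < δ → |φ (p + v) - φ p - fderiv ℝ φ p v| ≤ ε * ‖v‖ := by
  have hu : UniformContinuous (fderiv ℝ φ) :=
    (h.continuous_fderiv (by simp)).uniformContinuous_of_tendsto_cocompact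
      (hc.fderiv (𝕜 := ℝ)).is_zero_at_infty
  obtain ⟨δ, hδ, H⟩ := Metric.uniformContinuous_iff.1 hu ε hε
  refine ⟨δ, hδ, fun p v hv => ?_⟩
  have := (convex_ball p δ).norm_image_sub_le_of_norm_fderiv_le' (f := φ) (φ := fderiv ℝ φ p) (C := ε)
    (𝕜 := ℝ) (x := p) (y := p + v)
    (fun x _ => (h.differentiable (by simp)) x)
    (fun x hx => by rw [← dist_eq_norm]; exact (H (Metric.mem_ball.1 hx)).le)
    (Metric.mem_ball_self hδ) (by simpa using hv)
  simpa using this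

/-- Test functions on the line. -/
structure TF where
  f : ℝ → ℝ
  smooth : ContDiff ℝ ∞ f
  compact : HasCompactSupport f

namespace TF

variable (ψ : TF)

/-- A test function as a bounded continuous function. -/
def b : BC := BoundedContinuousFunction.ofNormedAddCommGroup ψ.f ψ.smooth.continuous
  (ψ.compact.exists_bound_of_continuous ψ.smooth.continuous).choose
  (ψ.compact.exists_bound_of_continuous ψ.smooth.continuous).choose_spec

lemma b_apply (x : ℝ) : ψ.b x = ψ.f x := rfl

/-- The derivative of a test function. -/
def d : TF := ⟨deriv ψ.f, (contDiff_infty_iff_deriv.1 ψ.smooth).2, ψ.compact.deriv⟩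

lemma hasDerivAt (x : ℝ) : HasDerivAt ψ.f (ψ.d.f x) x :=
  (ψ.smooth.differentiable (by simp) x).hasDerivAt

lemma isD : IsD trB ψ.b ψ.d.b := by
  refine hasDerivAt_BC fun ε hε => ?_
  obtain ⟨δ, hδ, H⟩ := uniform_taylor ψ.smooth ψ.compact hε
  refine ⟨δ, hδ, fun y hy x => ?_⟩
  have := H x y hy
  rw [zero_add, trB_zero]
  rw [show fderiv ℝ ψ.f x y = y * ψ.d.f x by
    rw [← smul_eq_mul y, show ψ.d.f x = fderiv ℝ ψ.f x 1 from rfl, ← map_smul]; simp] at this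
  exact this

/-- Translation of a test function. -/
def shift (y : ℝ) : TF := ⟨fun x => ψ.f (x + y), ψ.smooth.comp (contDiff_id.add contDiff_const),
  ψ.compact.comp_homeomorph (Homeomorph.addRight y)⟩

lemma shift_b (y : ℝ) : (ψ.shift y).b = trB y ψ.b := rfl

lemma shift_d (y : ℝ) : (ψ.shift y).d.b = trB y ψ.d.b := by
  ext x
  exact deriv_comp_add_const ψ.f y x

lemma pB_d {f f' : L1} (h : IsD trL.τ f f') : pB ψ.b f' = -pB ψ.d.b f := pB_isD ψ.isD h

lemma integrable : Integrable ψ.f := ψ.smooth.continuous.integrable_of_hasCompactSupport ψ.compact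

end TF

lemma eq_zero_of_pB {f : L1} (h : ∀ ψ : TF, pB ψ.b f = 0) : f = 0 := by
  have := ae_eq_zero_of_integral_contDiff_smul_eq_zero (L1.integrable f).locallyIntegrable
    fun g hg hg' => (pB_apply _ _).symm.trans (h ⟨g, hg, hg'⟩)
  refine Lp.ext ?_
  filter_upwards [this, Lp.coeFn_zero ℝ 1 (volume : Measure ℝ)] with x h1 h2
  rw [h1, h2]; rfl

/-! ### Test functions on the half plane -/

/-- The slice at time `t` of a test function of two variables. -/
def slice {φ : ℝ × ℝ → ℝ} (h : ContDiff ℝ ∞ φ) (hc : HasCompactSupport φ) (t : ℝ) : TF :=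
  ⟨fun x => φ (t, x), h.comp (contDiff_const.prodMk contDiff_id),
    hc.comp_isClosedEmbedding (Topology.IsClosedEmbedding.of_continuous_injective_isClosedMap
      (by fun_prop) (fun a b h => by simpa using h) (isClosedMap_prodMk_left t))⟩

/-- The derivative is again a slice of a smooth compactly supported function, so the lemma can be
reapplied, for instance to see that the derivative is continuous in time. -/
lemma hasDerivAt_slice {φ : ℝ × ℝ → ℝ} (h : ContDiff ℝ ∞ φ) (hc : HasCompactSupport φ) :
    ∃ (h' : ContDiff ℝ ∞ fun p : ℝ × ℝ => fderiv ℝ φ p (1, 0))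
      (hc' : HasCompactSupport fun p : ℝ × ℝ => fderiv ℝ φ p (1, 0)),
    ∀ t, HasDerivAt (fun t => (slice h hc t).b) (slice h' hc' t).b t := by
  have h' : ContDiff ℝ ∞ fun p : ℝ × ℝ => fderiv ℝ φ p (1, 0) :=
    (h.fderiv_right (m := ∞) (by simp)).clm_apply contDiff_const
  have hc' := (hc.fderiv (𝕜 := ℝ)).comp_left (g := fun A : ℝ × ℝ →L[ℝ] ℝ => A (1, 0)) rfl
  refine ⟨h', hc', fun t => hasDerivAt_BC fun ε hε => ?_⟩
  obtain ⟨δ, hδ, H⟩ := uniform_taylor h hc hε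
  refine ⟨δ, hδ, fun y hy x => ?_⟩
  have hn : ‖((y, 0) : ℝ × ℝ)‖ = |y| := by simp [Prod.norm_def]
  have := H (t, x) (y, 0) (by rwa [hn])
  rw [hn, show fderiv ℝ φ (t, x) (y, 0) = y * fderiv ℝ φ (t, x) (1, 0) by
    rw [← smul_eq_mul y, ← map_smul]; simp] at this
  simpa using! this

lemma deriv_slice {φ : ℝ × ℝ → ℝ} (h : ContDiff ℝ ∞ φ) (t x : ℝ) :
    deriv (fun s => φ (s, x)) t = fderiv ℝ φ (t, x) (1, 0) := by
  have h1 : HasDerivAt (fun s : ℝ => (s, x)) ((1, 0) : ℝ × ℝ) t :=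
    (hasDerivAt_id t).prodMk (hasDerivAt_const t x)
  exact ((h.differentiable (by simp) (t, x)).hasFDerivAt.comp_hasDerivAt t h1).deriv

/-! ### Classical solutions are distributional solutions -/

/-- At a fixed time, `φ` stands for the time derivative of the test function and `ψ` for the test
function itself. Integration by parts then turns the weak integrand into the time derivative of `∫ ψ
u`. -/
lemma weak_density {f f1 f2 : L1} (h1 : IsD trL.τ f f1) (h2 : IsD trL.τ f1 f2) (φ ψ : TF) :
    ∫ x, (f x * φ.f x - f x ^ 2 / 2 * ψ.d.f x + f x * ψ.d.d.f x + (convK f x - f x) * ψ.f x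
      - f x * ψ.d.f x) = pB φ.b f + pB ψ.b (mul (I f1) f1 + f2 + f1 + Kc f - f) := by
  have hf := isD_ae_eq h1
  have hsq : mul (I f2) f + mul (I f1) f1 = (2:ℝ) • mul (I f1) f1 := by
    rw [two_smul]
    congr 1
    refine Lp.ext ?_
    filter_upwards [mul_ae (I f2) f, mul_ae (I f1) f1, hf, isD_ae_eq h2] with x a b c d
    rw [a, b, c, d, mul_comm]
  have hD := ψ.pB_d (isD_mul (isD_I h2) h1)
  rw [hsq, map_smul, smul_eq_mul] at hD
  have hD2 := ψ.pB_d h2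
  rw [← neg_eq_iff_eq_neg] at hD2
  have hD1 := ψ.pB_d h1
  have hD3 := ψ.d.pB_d h1
  have hrep := rep_add (rep_mul φ.b (ae_eq_refl f)) (rep_add (rep_smul (-(1/2))
    (rep_mul ψ.d.b (mul_ae (I f1) f))) (rep_add (rep_mul ψ.d.d.b (ae_eq_refl f)) (rep_sub
    (rep_mul ψ.b (rep_sub (Kc_ae f) (ae_eq_refl f))) (rep_mul ψ.d.b (ae_eq_refl f)))))
  calc _ = intL (mul φ.b f + ((-(1/2) : ℝ) • mul ψ.d.b (mul (I f1) f) + (mul ψ.d.d.b f +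
        (mul ψ.b (Kc f - f) - mul ψ.d.b f)))) := by
        rw [intL_apply, integral_congr_ae hrep]
        refine integral_congr_ae ?_
        filter_upwards [hf] with x a
        rw [← a]
        simp only [TF.b_apply]
        ring
    _ = pB φ.b f + (-(1/2) * pB ψ.d.b (mul (I f1) f) + (pB ψ.d.d.b f +
        (pB ψ.b (Kc f - f) - pB ψ.d.b f))) := by
        simp only [map_add, map_sub intL, map_smul, ← pB_eq, smul_eq_mul]
    _ = _ := by
        simp only [map_add, map_sub]
        linarith

/-- Since `f = I f1` a.e., `|f|` is bounded by `‖f1‖`, and one factor of the square can be taken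
out. -/
lemma lintegral_sq_le {f f1 : L1} (h : IsD trL.τ f f1) {C : ℝ} (hf : ‖f‖ ≤ C) (hf1 : ‖f1‖ ≤ C) :
    ∫⁻ x, ‖f x‖ₑ ^ 2 ≤ ENNReal.ofReal C * ENNReal.ofReal C := by
  calc ∫⁻ x, ‖f x‖ₑ ^ 2 ≤ ∫⁻ x, ENNReal.ofReal C * ‖f x‖ₑ := by
        refine lintegral_mono_ae ?_
        filter_upwards [isD_ae_eq h] with x hx
        rw [sq]
        gcongr
        rw [hx, Real.enorm_eq_ofReal_abs]
        exact ENNReal.ofReal_le_ofReal ((abs_I_le _ _).trans hf1)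
    _ = ENNReal.ofReal C * ‖f‖ₑ := by
        rw [lintegral_const_mul' _ _ ENNReal.ofReal_ne_top, Lp.enorm_def, eLpNorm_one_eq_lintegral_enorm]
    _ ≤ _ := by
        gcongr
        rw [← ofReal_norm]
        exact ENNReal.ofReal_le_ofReal hf

lemma GlobalSol.time_cont {u u1 u2 u3 : ℝ → L1} (h : GlobalSol u u1 u2 u3) :
    DCurve trL.τ (Ioi 0) (fun t => mul (I (u1 t)) (u1 t) + u2 t + u1 t + Kc (u t) - u t)
      fun t => mul (I (u2 t)) (u1 t) + mul (I (u1 t)) (u2 t) + u3 t + u2 t + Kc (u1 t) - u1 t := by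
  have hK : DCurve trL.τ (Ioi 0) (fun t => Kc (u t)) fun t => Kc (u1 t) :=
    ⟨Kc.continuous.comp_continuousOn h.d1.cont, Kc.continuous.comp_continuousOn h.d1.cont',
      fun t ht => trL.isD_clm Kc_τ (h.d1.isD t ht)⟩
  exact ((((h.d2.I.mul h.d2).add h.d3).add h.d2).add hK).sub h.d1

/-- The weak integrand is the derivative of `H t = ∫ φ(t, ·) u(t)`, and `H` vanishes outside a
compact interval of positive times. -/
theorem GlobalSol.isSolution {u u1 u2 u3 : ℝ → L1} (h : GlobalSol u u1 u2 u3) :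
    IsSolution (u 0) fun t : ℝ≥0 => u t where
  continuous := h.cont.comp_continuous NNReal.continuous_coe fun t => t.2
  initial := rfl
  locallySquareIntegrable a b R ha := by
    have hs : Icc a b ⊆ Ioi 0 := fun t ht => ha.trans_le ht.1
    obtain ⟨C, hC⟩ := isCompact_Icc.exists_bound_of_continuousOn (h.d1.cont.mono hs)
    obtain ⟨C', hC'⟩ := isCompact_Icc.exists_bound_of_continuousOn (h.d1.cont'.mono hs)
    have hle : ∀ t ∈ Icc a b, ∫⁻ x in Icc (-R) R, ‖u (t.toNNReal : ℝ≥0) x‖ₑ ^ 2 ≤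
        ENNReal.ofReal (max C C') * ENNReal.ofReal (max C C') := fun t ht => by
      rw [Real.coe_toNNReal t (hs ht).le]
      exact (setLIntegral_le_lintegral _ _).trans (lintegral_sq_le (h.d1.isD t (hs ht))
        ((hC t ht).trans (le_max_left _ _)) ((hC' t ht).trans (le_max_right _ _)))
    refine (setLIntegral_mono measurable_const hle).trans_lt ?_
    rw [lintegral_const, Measure.restrict_apply_univ]
    exact ENNReal.mul_lt_top (ENNReal.mul_lt_top ENNReal.ofReal_lt_top ENNReal.ofReal_lt_top)
      measure_Icc_lt_top
  equation φ hφ := by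
    obtain ⟨h', hc', hd⟩ := hasDerivAt_slice hφ.smooth hφ.compact
    set s := slice hφ.smooth hφ.compact with hs
    set F := fun t => mul (I (u1 t)) (u1 t) + u2 t + u1 t + Kc (u t) - u t with hF
    set H := fun t => pB (s t).b (u t) with hH
    set H' := fun t => pB (slice h' hc' t).b (u t) + pB (s t).b (F t) with hH'
    have e1 : ∀ t ∈ Ioi (0:ℝ), (∫ x : ℝ, (u (t.toNNReal : ℝ≥0) x * deriv (fun s => φ (s, x)) t
        - u (t.toNNReal : ℝ≥0) x ^ 2 / 2 * deriv (fun y => φ (t, y)) x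
        + u (t.toNNReal : ℝ≥0) x * iteratedDeriv 2 (fun y => φ (t, y)) x
        + (convK (u (t.toNNReal : ℝ≥0)) x - u (t.toNNReal : ℝ≥0) x) * φ (t, x)
        - u (t.toNNReal : ℝ≥0) x * deriv (fun y => φ (t, y)) x)) = H' t := fun t ht => by
      refine Eq.trans ?_ (weak_density (h.d1.isD t ht) (h.d2.isD t ht) (slice h' hc' t) (s t))
      rw [Real.coe_toNNReal t (le_of_lt ht)]
      simp only [deriv_slice hφ.smooth, iteratedDeriv_succ, iteratedDeriv_zero]
      rfl
    rw [setIntegral_congr_fun measurableSet_Ioi e1]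
    have hder : ∀ t ∈ Ioi (0:ℝ), HasDerivAt H (H' t) t := fun t ht => by
      have := (pB.hasFDerivAt.comp_hasDerivAt t (hd t)).clm_apply (h.time t ht)
      exact this
    have hcont : ContinuousOn H' (Ioi 0) := by
      have hb : Continuous fun t => (s t).b := continuous_iff_continuousAt.2 fun t => (hd t).continuousAt
      obtain ⟨h'', hc'', hd'⟩ := hasDerivAt_slice h' hc'
      have hb' : Continuous fun t => (slice h' hc' t).b :=
        continuous_iff_continuousAt.2 fun t => (hd' t).continuousAt
      exact ((pB.continuous.comp hb').continuousOn.clm_apply h.d1.cont).add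
        ((pB.continuous.comp hb).continuousOn.clm_apply h.time_cont.cont)
    obtain ⟨a, ha, b, hab, hsupp⟩ : ∃ a > 0, ∃ b ≥ a, ∀ t, t ∉ Icc a b → ∀ x, (t, x) ∉ tsupport φ := by
      have hK : IsCompact (Prod.fst '' tsupport φ) := hφ.compact.isCompact.image continuous_fst
      rcases (tsupport φ).eq_empty_or_nonempty with he | hne
      · exact ⟨1, one_pos, 1, le_rfl, fun t _ x => by simp [he]⟩
      obtain ⟨a, ⟨p, hp, rfl⟩, ha⟩ := hK.exists_isLeast (hne.image _)
      obtain ⟨b, hb, hb'⟩ := hK.exists_isGreatest (hne.image _)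
      refine ⟨p.1, (hφ.support hp).1, b, hb' ⟨p, hp, rfl⟩, fun t ht x hx => ht ⟨ha ⟨_, hx, rfl⟩, hb' ⟨_, hx, rfl⟩⟩⟩
    have z1 : ∀ t, t ∉ Icc a b → (s t).b = 0 := fun t ht => by
      ext x
      exact image_eq_zero_of_notMem_tsupport (f := φ) (hsupp t ht x)
    have z2 : ∀ t, t ∉ Icc a b → (slice h' hc' t).b = 0 := fun t ht => by
      ext x
      show fderiv ℝ φ (t, x) (1, 0) = 0
      rw [image_eq_zero_of_notMem_tsupport (f := fderiv ℝ φ)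
        fun hx => hsupp t ht x (tsupport_fderiv_subset ℝ hx)]
      rfl
    -- The interval is enlarged strictly beyond `[a, b]`, so that `H` vanishes at both endpoints.
    have hsub : Ioc (a / 2) (b + 1) ⊆ Ioi 0 := fun t ht => lt_trans (by positivity) ht.1
    have hle : a / 2 ≤ b + 1 := by linarith
    rw [setIntegral_eq_of_subset_of_forall_sdiff_eq_zero measurableSet_Ioi hsub,
      ← intervalIntegral.integral_of_le hle, intervalIntegral.integral_eq_sub_of_hasDerivAt (f := H)]
    · have n1 : b + 1 ∉ Icc a b := fun hh => by linarith [hh.2]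
      have n2 : a / 2 ∉ Icc a b := fun hh => by linarith [hh.1]
      simp [hH, z1 _ n1, z1 _ n2]
    · intro t ht
      rw [uIcc_of_le hle] at ht
      exact hder t (lt_of_lt_of_le (by positivity) ht.1)
    · refine (hcont.mono ?_).intervalIntegrable
      rw [uIcc_of_le hle]
      exact fun t ht => lt_of_lt_of_le (by positivity : 0 < a / 2) ht.1
    · intro t ht
      have : t ∉ Icc a b := fun hh => ht.2 ⟨by linarith [hh.1], by linarith [hh.2]⟩
      simp [hH', z1 _ this, z2 _ this]

/-! ### Regularity in `Lᵖ` -/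

/-- Interpolation in its simplest form: `|g|^p ≤ M^(p-1) |g|`. -/
lemma eLpNorm_le_of_bound {g : ℝ → ℝ} (hg : AEStronglyMeasurable g volume) {p : ℝ≥0∞} (hp : 1 ≤ p)
    (hp' : p ≠ ⊤) {M : ℝ≥0∞} (h1 : eLpNorm g 1 volume ≤ M) (h2 : ∀ᵐ x, ‖g x‖ₑ ≤ M) :
    eLpNorm g p volume ≤ M := by
  have hp0 : p ≠ 0 := (one_pos.trans_le hp).ne'
  have hr : 1 ≤ p.toReal := by
    rw [← ENNReal.toReal_one]; exact ENNReal.toReal_mono hp' hp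
  have hr0 : 0 < p.toReal := one_pos.trans_le hr
  rw [eLpNorm_eq_lintegral_rpow_enorm_toReal hp0 hp']
  rw [one_div, ENNReal.rpow_inv_le_iff hr0]
  have hsplit : ∀ a : ℝ≥0∞, a ^ p.toReal = a ^ (p.toReal - 1) * a := fun a => by
    nth_rw 3 [← ENNReal.rpow_one a]
    rw [← ENNReal.rpow_add_of_nonneg _ _ (by linarith) zero_le_one]
    congr 1; ring
  calc ∫⁻ x, ‖g x‖ₑ ^ p.toReal ≤ ∫⁻ x, M ^ (p.toReal - 1) * ‖g x‖ₑ := by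
        refine lintegral_mono_ae (h2.mono fun x hx => ?_)
        rw [hsplit]
        gcongr
    _ = M ^ (p.toReal - 1) * eLpNorm g 1 volume := by
        rw [lintegral_const_mul'' _ hg.enorm, eLpNorm_one_eq_lintegral_enorm]
    _ ≤ M ^ (p.toReal - 1) * M := by gcongr
    _ = M ^ p.toReal := (hsplit M).symm

section

variable (p : ℝ≥0∞) [hp : Fact (1 ≤ p)]

/-- The function `K * f` is the primitive of `f - K * f`, hence bounded by `2 ‖f‖`, while its `L¹`
norm is at most `‖f‖`. -/
lemma eLpNorm_Kc_le (hp' : p ≠ ⊤) (f : L1) : eLpNorm (Kc f) p volume ≤ ENNReal.ofReal (2 * ‖f‖) := by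
  refine eLpNorm_le_of_bound (Lp.aestronglyMeasurable _) hp.out hp' ?_ ?_
  · rw [← Lp.enorm_def, ← ofReal_norm]
    exact ENNReal.ofReal_le_ofReal ((norm_Kc_le f).trans (by linarith [norm_nonneg f]))
  · filter_upwards [isD_ae_eq (isD_Kc f)] with x hx
    rw [hx, Real.enorm_eq_ofReal_abs]
    refine ENNReal.ofReal_le_ofReal ((abs_I_le _ _).trans ((norm_sub_le _ _).trans ?_))
    linarith [norm_Kc_le f]

lemma memLp_Kc (hp' : p ≠ ⊤) (f : L1) : MemLp (Kc f : ℝ → ℝ) p volume :=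
  ⟨Lp.aestronglyMeasurable _, (eLpNorm_Kc_le p hp' f).trans_lt ENNReal.ofReal_lt_top⟩

/-- Convolution with the kernel `K`, as an operator from `L¹` to `Lᵖ`. -/
def KLp (hp' : p ≠ ⊤) : L1 →L[ℝ] Lp ℝ p (volume : Measure ℝ) :=
  LinearMap.mkContinuous
    { toFun := fun f => (memLp_Kc p hp' f).toLp
      map_add' := fun f g => by
        rw [← MemLp.toLp_add, MemLp.toLp_eq_toLp_iff, map_add]
        exact Lp.coeFn_add _ _
      map_smul' := fun c f => by
        rw [RingHom.id_apply, ← MemLp.toLp_const_smul, MemLp.toLp_eq_toLp_iff, map_smul]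
        exact Lp.coeFn_smul _ _ } 2 fun f => by
    show ‖(memLp_Kc p hp' f).toLp‖ ≤ _
    rw [Lp.norm_toLp]
    exact ENNReal.toReal_le_of_le_ofReal (by positivity) (eLpNorm_Kc_le p hp' f)

lemma KLp_ae (hp' : p ≠ ⊤) (f : L1) : (KLp p hp' f : ℝ → ℝ) =ᵐ[volume] Kc f := (memLp_Kc p hp' f).coeFn_toLp

/-- Convolution with `K` inverts `1 + D`: the derivative of `K * f` is both `K * f1` and `f - K *
f`. Continuity and differentiability of `f` in `Lᵖ` are thereby inherited from those of `f + f1` in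
`L¹`. -/
lemma Kc_add_isD {f f1 : L1} (h : IsD trL.τ f f1) : Kc (f + f1) = f := by
  have := trL.isD_unique (trL.isD_clm Kc_τ h) (isD_Kc f)
  rw [map_add, this, add_sub_cancel]

lemma KLp_add_ae (hp' : p ≠ ⊤) {f f1 : L1} (h : IsD trL.τ f f1) :
    (KLp p hp' (f + f1) : ℝ → ℝ) =ᵐ[volume] f := by
  have := KLp_ae p hp' (f + f1)
  rwa [Kc_add_isD h] at this

lemma hasWeakDeriv_of_isD {f f1 : L1} (h : IsD trL.τ f f1) {g g1 : ℝ → ℝ} (hg : g =ᵐ[volume] f)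
    (hg1 : g1 =ᵐ[volume] f1) : HasWeakDeriv g g1 := by
  intro ψ h1 h2
  have := TF.pB_d ⟨ψ, h1, h2⟩ h
  rw [pB_apply, pB_apply] at this
  rw [← neg_eq_iff_eq_neg] at this
  have e1 : ∫ x, g1 x * ψ x = ∫ x, ψ x * f1 x :=
    integral_congr_ae (hg1.mono fun x hx => by simp only [hx, mul_comm])
  have e2 : ∫ x, g x * deriv ψ x = ∫ x, deriv ψ x * f x :=
    integral_congr_ae (hg.mono fun x hx => by simp only [hx, mul_comm])
  rw [e1, e2]
  exact this.symm

variable {u u1 u2 u3 : ℝ → L1}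

lemma GlobalSol.isContinuousIntoW2 (hp' : p ≠ ⊤) (h : GlobalSol u u1 u2 u3) : IsContinuousIntoW2 (fun t : ℝ≥0 => u t) p := by
  -- The curve must take values in `W2 p` for every real time; nonpositive times are sent to the
  -- default time `1`.
  set g : ℝ → ℝ := fun t => if 0 < t then t else 1 with hg
  have hgpos : ∀ t, g t ∈ Ioi (0:ℝ) := fun t => by
    by_cases ht : 0 < t <;> simp [hg, ht]
  have hgt : ∀ t, 0 < t → g t = t := fun t ht => by simp [hg, ht]
  have hgc : ContinuousOn g (Ioi 0) := continuousOn_id.congr fun t ht => hgt t ht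
  have cont : ∀ {f : ℝ → L1}, ContinuousOn f (Ioi 0) →
      ContinuousOn (fun t => KLp p hp' (f (g t))) (Ioi 0) := fun hf =>
    (KLp p hp').continuous.comp_continuousOn (hf.comp hgc fun t _ => hgpos t)
  refine ⟨fun t => ⟨(KLp p hp' (u (g t) + u1 (g t)), KLp p hp' (u1 (g t) + u2 (g t)),
    KLp p hp' (u2 (g t) + u3 (g t))), ?_, ?_⟩, ?_, fun t ht => ?_⟩
  · exact hasWeakDeriv_of_isD (h.d1.isD _ (hgpos t)) (KLp_add_ae p hp' (h.d1.isD _ (hgpos t)))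
      (KLp_add_ae p hp' (h.d2.isD _ (hgpos t)))
  · exact hasWeakDeriv_of_isD (h.d2.isD _ (hgpos t)) (KLp_add_ae p hp' (h.d2.isD _ (hgpos t)))
      (KLp_add_ae p hp' (h.d3.isD _ (hgpos t)))
  · have hP := (cont (h.d1.cont.add h.d1.cont')).prodMk
      ((cont (h.d2.cont.add h.d2.cont')).prodMk (cont (h.d3.cont.add h.d3.cont')))
    rw [continuousOn_iff_continuous_domRestrict] at hP ⊢
    exact hP.subtype_mk _
  · have := KLp_add_ae p hp' (h.d1.isD _ (hgpos t))
    simp only [hgt t ht] at this ⊢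
    rwa [Real.coe_toNNReal t ht.le]

/-- Differentiation along translations commutes with time integration, so the integrated equation
for `u` gives the one for `u1`. Together they make `u + u1` continuously differentiable in `L¹`, as
`Kc_add_isD` requires. -/
lemma GlobalSol.hasDerivAt_u1 (h : GlobalSol u u1 u2 u3) {t : ℝ} (ht : 0 < t) :
    HasDerivAt u1 (mul (I (u2 t)) (u1 t) + mul (I (u1 t)) (u2 t) + u3 t + u2 t + Kc (u1 t) - u1 t) t := by
  have hF := h.time_cont
  set F := fun t => mul (I (u1 t)) (u1 t) + u2 t + u1 t + Kc (u t) - u t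
  set F1 := fun t => mul (I (u2 t)) (u1 t) + mul (I (u1 t)) (u2 t) + u3 t + u2 t + Kc (u1 t) - u1 t
  have hsub : ∀ {s : ℝ}, 0 < s → uIcc t s ⊆ Ioi 0 := fun hs x hx =>
    lt_of_lt_of_le (lt_min ht hs) hx.1
  have key : ∀ s, 0 < s → u1 s = u1 t + ∫ r in t..s, F1 r := by
    intro s hs
    have i0 := (hF.cont.mono (hsub hs)).intervalIntegrable (μ := volume)
    have i1 := (hF.cont'.mono (hsub hs)).intervalIntegrable (μ := volume)
    have e : ∫ r in t..s, F r = u s - u t :=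
      intervalIntegral.integral_eq_sub_of_hasDerivAt (fun r hr => h.time r (hsub hs hr)) i0
    have hmem : ∀ r ∈ uIoc t s, r ∈ Ioi (0:ℝ) := fun r hr => hsub hs (uIoc_subset_uIcc hr)
    have hd := trL.isD_integral (μ := volume.restrict (uIoc t s)) (g := F) (g' := F1)
      (bound := fun r => ‖F1 r‖) (intervalIntegrable_iff.1 i0) (intervalIntegrable_iff.1 i1).1
      (Eventually.of_forall fun _ => le_rfl) (intervalIntegrable_iff.1 i1).norm
      ((ae_restrict_mem measurableSet_uIoc).mono fun r hr => hF.isD r (hmem r hr))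
    have hd' : IsD trL.τ (∫ r in t..s, F r) (∫ r in t..s, F1 r) := by
      rw [intervalIntegral.intervalIntegral_eq_integral_uIoc,
        intervalIntegral.intervalIntegral_eq_integral_uIoc]
      -- The scalar `±1` restores the orientation of the interval integral when `s < t`.
      exact trL.isD_clm (A := (if t ≤ s then (1:ℝ) else -1) • ContinuousLinearMap.id ℝ L1)
        (fun _ _ => by split_ifs <;> simp) hd
    rw [e] at hd'
    have hd2 := ((h.d1.isD s hs).sub (h.d1.isD t ht))
    have := trL.isD_unique hd' (by simpa [IsD] using! hd2)
    rw [this]; abel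
  have hder : HasDerivAt (fun s => u1 t + ∫ r in t..s, F1 r) (F1 t) t := by
    refine HasDerivAt.const_add _ (intervalIntegral.integral_hasDerivAt_right (by simp) ?_ ?_)
    · exact hF.cont'.stronglyMeasurableAtFilter isOpen_Ioi t ht
    · exact hF.cont'.continuousAt (Ioi_mem_nhds ht)
  refine hder.congr_of_eventuallyEq ?_
  filter_upwards [Ioi_mem_nhds ht] with s hs using key s hs

lemma GlobalSol.isC1IntoLp (hp' : p ≠ ⊤) (h : GlobalSol u u1 u2 u3) : IsC1IntoLp (fun t : ℝ≥0 => u t) p := by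
  refine ⟨fun t => KLp p hp' (u t + u1 t), ?_, fun t ht => ?_⟩
  · have hd : ∀ t ∈ Ioi (0:ℝ), HasDerivAt (fun t => KLp p hp' (u t + u1 t)) _ t := fun t ht =>
      (KLp p hp').hasFDerivAt.comp_hasDerivAt t ((h.time t ht).add (h.hasDerivAt_u1 ht))
    refine (contDiffOn_succ_iff_deriv_of_isOpen (n := 0) isOpen_Ioi).2 ⟨fun t ht =>
      (hd t ht).differentiableAt.differentiableWithinAt, by simp, contDiffOn_zero.2 ?_⟩
    exact ((KLp p hp').continuous.comp_continuousOn (h.time_cont.cont.add h.time_cont.cont')).congr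
      fun t ht => (hd t ht).deriv
  · have := KLp_add_ae p hp' (h.d1.isD t ht)
    simp only
    rwa [Real.coe_toNNReal t ht.le]

end

/-! ### The fundamental lemma in time -/

/-- The derivative of the smooth transition function. -/
def dst : ℝ → ℝ := deriv Real.smoothTransition

lemma contDiff_st : ContDiff ℝ ∞ Real.smoothTransition := Real.smoothTransition.contDiff

lemma hasDerivAt_st (x : ℝ) : HasDerivAt Real.smoothTransition (dst x) x :=
  (contDiff_st.differentiable (by simp) x).hasDerivAt

lemma continuous_dst : Continuous dst := contDiff_st.continuous_deriv (by simp)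

lemma dst_eq_zero {x : ℝ} (hx : x ∉ Ioc (0:ℝ) 1) : dst x = 0 := by
  have hc : IsClosed {y | dst y = 0} := isClosed_singleton.preimage continuous_dst
  rcases not_and_or.1 hx with h | h
  · have h1 : ∀ y ∈ Iio (0:ℝ), dst y = 0 := fun y hy => by
      have : Real.smoothTransition =ᶠ[𝓝 y] fun _ => 0 := by
        filter_upwards [Iio_mem_nhds hy] with z hz using Real.smoothTransition.zero_of_nonpos hz.le
      rw [dst, this.deriv_eq, deriv_const]
    have := hc.closure_subset_iff.2 h1
    rw [closure_Iio] at this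
    exact this (not_lt.1 h)
  · have : Real.smoothTransition =ᶠ[𝓝 x] fun _ => 1 := by
      filter_upwards [Ioi_mem_nhds (not_le.1 h)] with z hz using
        Real.smoothTransition.one_of_one_le (le_of_lt hz)
    rw [dst, this.deriv_eq, deriv_const]

lemma integrable_dst : Integrable dst :=
  continuous_dst.integrable_of_hasCompactSupport
    (HasCompactSupport.intro isCompact_Icc fun _ hx => dst_eq_zero fun h => hx (Ioc_subset_Icc_self h))

lemma integral_dst : ∫ x, dst x = 1 := by
  rw [← setIntegral_eq_integral_of_forall_compl_eq_zero (s := Ioc (0:ℝ) 1) fun x hx => dst_eq_zero hx,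
    ← intervalIntegral.integral_of_le zero_le_one,
    intervalIntegral.integral_eq_sub_of_hasDerivAt (fun _ _ => hasDerivAt_st _)
      (continuous_dst.intervalIntegrable _ _)]
  simp

/-- A one-sided approximate identity: the rescaled bump lives on `(c, c + 1 / (n + 1)]`. -/
lemma tendsto_integral_dst {a : ℝ → ℝ} (ha : Continuous a) (c : ℝ) :
    Tendsto (fun n : ℕ => ∫ r, a r * ((n + 1) * dst ((n + 1) * (r - c)))) atTop (𝓝 (a c)) := by
  have e : ∀ n : ℕ, ∫ r, a r * ((n + 1) * dst ((n + 1) * (r - c))) =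
      ∫ z, a (c + z / (n + 1)) * dst z := fun n => by
    have hm : (0:ℝ) < n + 1 := by positivity
    have h1 := integral_sub_right_eq_self (μ := (volume : Measure ℝ))
      (fun r => a (c + ((n + 1) * r) / (n + 1)) * ((n + 1) * dst ((n + 1) * r))) c
    have h2 := Measure.integral_comp_mul_left
      (fun z : ℝ => a (c + z / (n + 1)) * ((n + 1) * dst z)) ((n:ℝ) + 1)
    rw [h2] at h1
    calc _ = ∫ r, a (c + ((n + 1) * (r - c)) / (n + 1)) * ((n + 1) * dst ((n + 1) * (r - c))) := by
          refine integral_congr_ae (Eventually.of_forall fun r => ?_)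
          simp only
          rw [mul_div_cancel_left₀ _ hm.ne', add_sub_cancel]
      _ = _ := by
          rw [h1, abs_of_pos (inv_pos.2 hm), smul_eq_mul, ← integral_const_mul]
          refine integral_congr_ae (Eventually.of_forall fun r => ?_)
          simp only
          field_simp
  simp only [e]
  obtain ⟨C, hC⟩ := (isCompact_Icc (a := c) (b := c + 1)).exists_bound_of_continuousOn ha.continuousOn
  have hlim : Tendsto (fun n : ℕ => ∫ z, a (c + z / (n + 1)) * dst z) atTop (𝓝 (∫ z, a c * dst z)) := by
    refine tendsto_integral_of_dominated_convergence (fun z => C * |dst z|)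
      (fun n => ((ha.comp (by fun_prop)).mul continuous_dst).aestronglyMeasurable)
      (integrable_dst.abs.const_mul _) (fun n => Eventually.of_forall fun z => ?_)
      (Eventually.of_forall fun z => ?_)
    · by_cases hz : z ∈ Ioc (0:ℝ) 1
      · rw [norm_mul, ← Real.norm_eq_abs (dst z)]
        refine mul_le_mul_of_nonneg_right (hC _ ⟨?_, ?_⟩) (norm_nonneg _)
        · have := hz.1
          have : 0 ≤ z / ((n:ℝ) + 1) := by positivity
          linarith
        · have : z / ((n:ℝ) + 1) ≤ 1 :=
            (div_le_one (by positivity)).2 (by have := hz.2; linarith [(Nat.cast_nonneg n : (0:ℝ) ≤ n)])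
          linarith
      · simp [dst_eq_zero hz]
    · refine Tendsto.mul_const _ ((ha.tendsto c).comp ?_)
      have : Tendsto (fun n : ℕ => z / ((n:ℝ) + 1)) atTop (𝓝 0) :=
        tendsto_const_nhds.div_atTop (tendsto_natCast_atTop_atTop.atTop_add tendsto_const_nhds)
      simpa using this.const_add c
  rwa [integral_const_mul, integral_dst, mul_one] at hlim

/-- A smooth approximation of the indicator function of `(s, t]`. -/
def cutoffTF (s t : ℝ) (hst : s ≤ t) (n : ℕ) : TF where
  f r := Real.smoothTransition ((n + 1) * (r - s)) - Real.smoothTransition ((n + 1) * (r - t))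
  smooth := (contDiff_st.comp (by fun_prop)).sub (contDiff_st.comp (by fun_prop))
  compact := by
    refine HasCompactSupport.intro (K := Icc s (t + 1)) isCompact_Icc fun x hx => ?_
    have hm : (1:ℝ) ≤ n + 1 := by linarith [(Nat.cast_nonneg n : (0:ℝ) ≤ n)]
    rcases not_and_or.1 hx with h | h
    · rw [Real.smoothTransition.zero_of_nonpos (by nlinarith), Real.smoothTransition.zero_of_nonpos
        (by nlinarith), sub_zero]
    · rw [Real.smoothTransition.one_of_one_le (by nlinarith), Real.smoothTransition.one_of_one_le
        (by nlinarith), sub_self]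

lemma cutoffTF_eq_zero {s t : ℝ} (hst : s ≤ t) (n : ℕ) {x : ℝ} (hx : x ∉ Icc s (t + 1)) :
    (cutoffTF s t hst n).f x = 0 := by
  have hm : (1:ℝ) ≤ n + 1 := by linarith [(Nat.cast_nonneg n : (0:ℝ) ≤ n)]
  show Real.smoothTransition ((n + 1) * (x - s)) - Real.smoothTransition ((n + 1) * (x - t)) = 0
  rcases not_and_or.1 hx with h | h
  · rw [Real.smoothTransition.zero_of_nonpos (by nlinarith), Real.smoothTransition.zero_of_nonpos
      (by nlinarith), sub_zero]
  · rw [Real.smoothTransition.one_of_one_le (by nlinarith), Real.smoothTransition.one_of_one_le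
      (by nlinarith), sub_self]

lemma cutoffTF_d {s t : ℝ} (hst : s ≤ t) (n : ℕ) (x : ℝ) : (cutoffTF s t hst n).d.f x =
    (n + 1) * dst ((n + 1) * (x - s)) - (n + 1) * dst ((n + 1) * (x - t)) := by
  have h : ∀ c : ℝ, HasDerivAt (fun x => Real.smoothTransition ((n + 1) * (x - c)))
      ((n + 1) * dst ((n + 1) * (x - c))) x := fun c => by
    have h1 : HasDerivAt (fun x : ℝ => ((n:ℝ) + 1) * (x - c)) (n + 1) x := by
      simpa using ((hasDerivAt_id x).sub_const c).const_mul ((n:ℝ) + 1)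
    rw [mul_comm]
    exact (hasDerivAt_st (((n:ℝ) + 1) * (x - c))).comp x h1
  exact ((h s).sub (h t)).deriv

lemma abs_cutoffTF_le {s t : ℝ} (hst : s ≤ t) (n : ℕ) (x : ℝ) : |(cutoffTF s t hst n).f x| ≤ 1 := by
  show |Real.smoothTransition _ - Real.smoothTransition _| ≤ 1
  rw [abs_le]
  constructor <;> linarith [Real.smoothTransition.nonneg (((n:ℝ) + 1) * (x - s)),
    Real.smoothTransition.nonneg (((n:ℝ) + 1) * (x - t)),
    Real.smoothTransition.le_one (((n:ℝ) + 1) * (x - s)),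
    Real.smoothTransition.le_one (((n:ℝ) + 1) * (x - t))]

lemma tendsto_st (c x : ℝ) : Tendsto (fun n : ℕ => Real.smoothTransition ((n + 1) * (x - c))) atTop
    (𝓝 ((Ioi c).indicator (fun _ => 1) x)) := by
  by_cases h : x ∈ Ioi c
  · rw [indicator_of_mem h]
    have h1 : Tendsto (fun n : ℕ => ((n:ℝ) + 1) * (x - c)) atTop atTop :=
      (tendsto_natCast_atTop_atTop.atTop_add tendsto_const_nhds).atTop_mul_const (sub_pos.2 h)
    refine tendsto_const_nhds.congr' ?_
    filter_upwards [h1.eventually_ge_atTop 1] with n hn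
    rw [Real.smoothTransition.one_of_one_le hn]
  · rw [indicator_of_notMem h]
    refine tendsto_const_nhds.congr fun n => ?_
    have : x - c ≤ 0 := by simpa using h
    rw [Real.smoothTransition.zero_of_nonpos (mul_nonpos_of_nonneg_of_nonpos (by positivity) this)]

/-- If `a' = b` in the sense of distributions on `(0, ∞)`, then `a` is a primitive of `b`. -/
lemma sub_eq_integral_of_weak {a b : ℝ → ℝ} (ha : Continuous a)
    (hb : ∀ s t, 0 < s → IntegrableOn b (Icc s t))
    (h : ∀ θ : TF, tsupport θ.f ⊆ Ioi 0 → ∫ r in Ioi (0:ℝ), (a r * θ.d.f r + b r * θ.f r) = 0)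
    {s t : ℝ} (hs : 0 < s) (hst : s ≤ t) : a t - a s = ∫ r in s..t, b r := by
  -- The cutoffs approximate the indicator of `(s, t]` and extend at most `1 / (n + 1) ≤ 1` beyond
  -- `t`.
  set J := Icc s (t + 1) with hJ
  have hJ0 : J ⊆ Ioi 0 := fun x hx => hs.trans_le hx.1
  have hbJ := hb s (t + 1) hs
  have haJ : ∀ (c : ℝ) (n : ℕ), Integrable (fun r => a r * ((n + 1) * dst ((n + 1) * (r - c))))
      (volume.restrict J) := fun c n =>
    (Continuous.continuousOn (by have := continuous_dst; fun_prop)).integrableOn_compact isCompact_Icc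
  have hθ : ∀ n, Integrable (fun r => b r * (cutoffTF s t hst n).f r) (volume.restrict J) := fun n =>
    Integrable.mul_bdd (c := 1) hbJ (cutoffTF s t hst n).smooth.continuous.aestronglyMeasurable
      (Eventually.of_forall fun x => abs_cutoffTF_le hst n x)
  have hdJ : ∀ c ∈ Icc s t, ∀ n : ℕ, ∫ r in J, a r * ((n + 1) * dst ((n + 1) * (r - c))) =
      ∫ r, a r * ((n + 1) * dst ((n + 1) * (r - c))) := fun c hc n => by
    refine setIntegral_eq_integral_of_forall_compl_eq_zero fun x hx => ?_
    have hm : (1:ℝ) ≤ n + 1 := by linarith [(Nat.cast_nonneg n : (0:ℝ) ≤ n)]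
    rw [dst_eq_zero, mul_zero, mul_zero]
    rintro ⟨h1, h2⟩
    have h3 : 0 < x - c := pos_of_mul_pos_right h1 (by linarith)
    exact hx ⟨by linarith [hc.1], by nlinarith [hc.2]⟩
  have e : ∀ n : ℕ, (∫ r, a r * ((n + 1) * dst ((n + 1) * (r - s)))) -
      (∫ r, a r * ((n + 1) * dst ((n + 1) * (r - t)))) +
      ∫ r in J, b r * (cutoffTF s t hst n).f r = 0 := fun n => by
    rw [← hdJ s ⟨le_rfl, hst⟩, ← hdJ t ⟨hst, le_rfl⟩, ← integral_sub (haJ s n) (haJ t n)]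
    refine (integral_add ((haJ s n).sub (haJ t n)) (hθ n)).symm.trans ?_
    have hsupp : tsupport (cutoffTF s t hst n).f ⊆ Ioi 0 :=
      (closure_minimal (t := J) (fun x hx => by_contra fun hx' =>
        (Function.mem_support.1 hx) (cutoffTF_eq_zero hst n hx')) isClosed_Icc).trans hJ0
    rw [← h (cutoffTF s t hst n) hsupp,
      setIntegral_eq_of_subset_of_forall_sdiff_eq_zero measurableSet_Ioi hJ0]
    · refine integral_congr_ae (Eventually.of_forall fun r => ?_)
      simp only [Pi.sub_apply, cutoffTF_d]
      ring
    · intro x hx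
      rw [cutoffTF_eq_zero hst n hx.2, mul_zero, add_zero]
      have hz : ∀ y ∉ J, (cutoffTF s t hst n).f y = 0 := fun y hy => cutoffTF_eq_zero hst n hy
      have : (cutoffTF s t hst n).f =ᶠ[𝓝 x] fun _ => 0 := by
        filter_upwards [isClosed_Icc.isOpen_compl.mem_nhds hx.2] with y hy using hz y hy
      show a x * deriv (cutoffTF s t hst n).f x = 0
      rw [this.deriv_eq, deriv_const, mul_zero]
  have hlim : Tendsto (fun n : ℕ => ∫ r in J, b r * (cutoffTF s t hst n).f r) atTop
      (𝓝 (∫ r in J, b r * ((Ioi s).indicator (fun _ => 1) r - (Ioi t).indicator (fun _ => 1) r))) := by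
    refine tendsto_integral_of_dominated_convergence (fun r => ‖b r‖) (fun n => (hθ n).1) hbJ.norm
      (fun n => Eventually.of_forall fun r => ?_) (Eventually.of_forall fun r => ?_)
    · rw [norm_mul]
      exact mul_le_of_le_one_right (norm_nonneg _) (abs_cutoffTF_le hst n r)
    · exact ((tendsto_st s r).sub (tendsto_st t r)).const_mul _
  have h1 := ((tendsto_integral_dst ha s).sub (tendsto_integral_dst ha t)).add hlim
  have h2 := tendsto_nhds_unique h1 (tendsto_const_nhds.congr fun n => (e n).symm)
  have h3 : ∫ r in J, b r * ((Ioi s).indicator (fun _ => 1) r - (Ioi t).indicator (fun _ => 1) r) =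
      ∫ r in s..t, b r := by
    rw [intervalIntegral.integral_of_le hst, ← integral_indicator measurableSet_Icc,
      ← integral_indicator measurableSet_Ioc]
    refine integral_congr_ae (Eventually.of_forall fun r => ?_)
    simp only [indicator_apply, mem_Ioi, mem_Ioc, mem_Icc]
    split_ifs <;> first | (exfalso; grind) | simp
  rw [h3] at h2
  linarith

/-! ### Weak solutions, in integrated form -/

/-- A cutoff function, equal to `1` on `[-R, R]`. -/
def chi (R : ℝ) : BC := BoundedContinuousFunction.ofNormedAddCommGroup
  (fun x => max 0 (min 1 (R + 1 - |x|))) (by fun_prop) 1 fun x => by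
    rw [Real.norm_eq_abs, abs_of_nonneg (le_max_left _ _)]
    exact max_le zero_le_one (min_le_left _ _)

lemma chi_apply (R x : ℝ) : chi R x = max 0 (min 1 (R + 1 - |x|)) := rfl

lemma chi_nonneg (R x : ℝ) : 0 ≤ chi R x := le_max_left _ _

lemma chi_le_one (R x : ℝ) : chi R x ≤ 1 := max_le zero_le_one (min_le_left _ _)

lemma chi_eq_one {R x : ℝ} (h : |x| ≤ R) : chi R x = 1 := by
  rw [chi_apply, min_eq_left (by linarith), max_eq_right zero_le_one]

lemma chi_eq_zero {R x : ℝ} (h : x ∉ Icc (-(R + 1)) (R + 1)) : chi R x = 0 := by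
  rw [chi_apply, max_eq_left]
  refine (min_le_right _ _).trans ?_
  by_contra hx
  exact h (abs_le.1 (by linarith))

/-- The localized square of an integrable function. -/
def sqc (R : ℝ) (f : L1) : L1 :=
  open Classical in
  -- Zero is a default. For a weak solution, integrability holds at almost every time, and only such
  -- times matter.
  if h : Integrable (fun x => chi R x * f x ^ 2) then h.toL1 else 0

lemma sqc_ae {R : ℝ} {f : L1} (h : Integrable (fun x => chi R x * f x ^ 2)) :
    sqc R f =ᵐ[volume] fun x => chi R x * f x ^ 2 := by
  rw [sqc, dif_pos h]
  exact h.coeFn_toL1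

lemma lipschitzWith_truncSq (n : ℕ) : LipschitzWith (2 * n) fun x : ℝ => min |x| n ^ 2 := by
  refine LipschitzWith.of_dist_le_mul fun x y => ?_
  rw [Real.dist_eq, Real.dist_eq, sq_sub_sq, abs_mul]
  have h1 : |min |x| (n:ℝ) - min |y| n| ≤ |x - y| :=
    (abs_min_sub_min_le_max _ _ _ _).trans (by simpa using abs_abs_sub_abs_le x y)
  have h2 : |min |x| (n:ℝ) + min |y| n| ≤ 2 * n := by
    rw [abs_of_nonneg (by positivity)]
    linarith [min_le_right |x| (n:ℝ), min_le_right |y| (n:ℝ)]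
  simpa using mul_le_mul h2 h1 (abs_nonneg _) (by positivity)

/-- Truncations of the localized square. -/
def truncSq (R : ℝ) (n : ℕ) (f : L1) : L1 :=
  mul (chi R) ((lipschitzWith_truncSq n).compLp (by simp) f)

lemma continuous_truncSq (R : ℝ) (n : ℕ) : Continuous (truncSq R n) :=
  (mul (chi R)).continuous.comp ((lipschitzWith_truncSq n).continuous_compLp (by simp))

lemma truncSq_ae (R : ℝ) (n : ℕ) (f : L1) :
    truncSq R n f =ᵐ[volume] fun x => chi R x * min |f x| n ^ 2 :=
  rep_mul _ ((lipschitzWith_truncSq n).coeFn_compLp (by simp) f)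

lemma tendsto_truncSq_pointwise (y : ℝ) : Tendsto (fun n : ℕ => min |y| (n:ℝ) ^ 2) atTop (𝓝 (y ^ 2)) := by
  refine tendsto_const_nhds.congr' ?_
  filter_upwards [tendsto_natCast_atTop_atTop.eventually_ge_atTop |y|] with n hn
  rw [min_eq_left hn, sq_abs]

lemma truncSq_le (y : ℝ) (n : ℕ) : min |y| (n:ℝ) ^ 2 ≤ y ^ 2 := by
  rw [← sq_abs y]
  have : 0 ≤ min |y| (n:ℝ) := by positivity
  gcongr
  exact min_le_left _ _

/-- The square is not continuous on `L¹`, but its truncations are, and they increase to it. The same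
truncations give strong measurability in time of `sqc`. -/
lemma measurable_lintegral_sq (R : ℝ) {u : ℝ → L1} (hu : Continuous u) :
    Measurable fun t => ∫⁻ x, ENNReal.ofReal (chi R x * u t x ^ 2) := by
  refine measurable_of_tendsto_metrizable (f := fun (n : ℕ) t => ‖truncSq R n (u t)‖ₑ)
    (fun n => ((continuous_truncSq R n).comp hu).enorm.measurable) ?_
  rw [tendsto_pi_nhds]
  intro t
  have e : ∀ n, ‖truncSq R n (u t)‖ₑ = ∫⁻ x, ENNReal.ofReal (chi R x * min |u t x| n ^ 2) := fun n => by
    rw [Lp.enorm_def, eLpNorm_one_eq_lintegral_enorm]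
    refine lintegral_congr_ae ?_
    filter_upwards [truncSq_ae R n (u t)] with x hx
    rw [hx, Real.enorm_eq_ofReal (mul_nonneg (chi_nonneg _ _) (sq_nonneg _))]
  simp only [e]
  refine lintegral_tendsto_of_tendsto_of_monotone (fun n => ?_)
    (Eventually.of_forall fun x => ?_) (Eventually.of_forall fun x => ?_)
  · have := (Lp.aestronglyMeasurable (u t)).aemeasurable
    fun_prop
  · intro n m hnm
    have := chi_nonneg R x
    have : (n:ℝ) ≤ m := by exact_mod_cast hnm
    have : 0 ≤ min |u t x| (n:ℝ) := by positivity
    simp only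
    gcongr
  · exact (ENNReal.continuous_ofReal.tendsto _).comp ((tendsto_truncSq_pointwise _).const_mul _)

lemma integrable_sq_iff {R : ℝ} {f : L1} :
    Integrable (fun x => chi R x * f x ^ 2) ↔ ∫⁻ x, ENNReal.ofReal (chi R x * f x ^ 2) < ⊤ := by
  have hm : AEStronglyMeasurable (fun x => chi R x * f x ^ 2) volume :=
    (chi R).continuous.aestronglyMeasurable.mul ((Lp.aestronglyMeasurable f).pow 2)
  rw [← lintegral_ofReal_ne_top_iff_integrable hm
    (Eventually.of_forall fun x => mul_nonneg (chi_nonneg _ _) (sq_nonneg _)), lt_top_iff_ne_top]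

lemma enorm_sqc_le (R : ℝ) (f : L1) : ‖sqc R f‖ₑ ≤ ∫⁻ x, ENNReal.ofReal (chi R x * f x ^ 2) := by
  by_cases h : Integrable (fun x => chi R x * f x ^ 2)
  · rw [Lp.enorm_def, eLpNorm_one_eq_lintegral_enorm]
    refine (lintegral_congr_ae ?_).le
    filter_upwards [sqc_ae h] with x hx
    rw [hx, Real.enorm_eq_ofReal (mul_nonneg (chi_nonneg _ _) (sq_nonneg _))]
  · rw [sqc, dif_neg h]; simp

lemma tendsto_truncSq {R : ℝ} {f : L1} (h : Integrable (fun x => chi R x * f x ^ 2)) :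
    Tendsto (fun n => truncSq R n f) atTop (𝓝 (sqc R f)) := by
  rw [tendsto_iff_norm_sub_tendsto_zero]
  have e : ∀ n, ‖truncSq R n f - sqc R f‖ = ∫ x, chi R x * (f x ^ 2 - min |f x| n ^ 2) := fun n => by
    rw [L1.norm_eq]
    refine integral_congr_ae ?_
    filter_upwards [rep_sub (truncSq_ae R n f) (sqc_ae h)] with x hx
    rw [hx, abs_sub_comm, ← mul_sub, abs_of_nonneg]
    exact mul_nonneg (chi_nonneg _ _) (sub_nonneg.2 (truncSq_le _ _))
  simp only [e]
  have : Tendsto (fun n : ℕ => ∫ x, chi R x * (f x ^ 2 - min |f x| n ^ 2)) atTop (𝓝 (∫ _ : ℝ, 0)) := by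
    refine tendsto_integral_of_dominated_convergence (fun x => chi R x * f x ^ 2) (fun n => ?_) h
      (fun n => Eventually.of_forall fun x => ?_) (Eventually.of_forall fun x => ?_)
    · have := (Lp.aestronglyMeasurable f).aemeasurable
      have : AEMeasurable (fun x => chi R x * (f x ^ 2 - min |f x| (n:ℝ) ^ 2)) :=
        (chi R).continuous.measurable.aemeasurable.mul (by fun_prop)
      exact this.aestronglyMeasurable
    · rw [Real.norm_eq_abs, abs_of_nonneg (mul_nonneg (chi_nonneg _ _) (sub_nonneg.2 (truncSq_le _ _)))]
      have := chi_nonneg R x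
      have : 0 ≤ min |f x| (n:ℝ) ^ 2 := by positivity
      gcongr
      linarith
    · have := ((tendsto_truncSq_pointwise (f x)).const_sub (f x ^ 2)).const_mul (chi R x)
      rwa [sub_self, mul_zero] at this
  simpa using this

/-- The weak formulation, integrated in time. -/
def wdens (R : ℝ) (ψ : TF) (f : L1) : ℝ :=
  -(1/2) * pB ψ.d.b (sqc R f) + pB ψ.d.d.b f - pB ψ.d.b f + pB ψ.b (Kc f - f)

/-- The cutoff `chi R` equals `1` on the support of `ψ`, so `sqc R` replaces the square, which is
integrable only locally. Times are bounded away from `0`, where local square integrability is not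
assumed; the initial datum enters through continuity. -/
structure WeakSol (u : ℝ → L1) : Prop where
  cont : Continuous u
  sq : ∀ R a b : ℝ, 0 < a → IntegrableOn (fun t => sqc R (u t)) (Icc a b)
  ae : ∀ R : ℝ, ∀ᵐ t ∂volume.restrict (Ioi 0), Integrable (fun x => chi R x * u t x ^ 2)
  weak : ∀ (R : ℝ) (ψ : TF), (∀ x, R ≤ |x| → ψ.f x = 0) → ∀ s t, 0 < s → s ≤ t →
    pB ψ.b (u t) - pB ψ.b (u s) = ∫ r in s..t, wdens R ψ (u r)

lemma iUnion_Icc_eq_Ioi : ⋃ n : ℕ, Icc (1 / ((n:ℝ) + 1)) (n + 1) = Ioi 0 := by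
  ext t
  simp only [mem_iUnion, mem_Icc, mem_Ioi]
  constructor
  · rintro ⟨n, h, -⟩
    exact lt_of_lt_of_le (by positivity) h
  · intro ht
    obtain ⟨n, hn⟩ := exists_nat_gt (max t (1 / t))
    refine ⟨n, ?_, by linarith [le_max_left t (1 / t)]⟩
    rw [div_le_iff₀ (by positivity)]
    have h1 : 1 / t < n := (le_max_right _ _).trans_lt hn
    rw [div_lt_iff₀ ht] at h1
    nlinarith

lemma TF.d_eq_zero (ψ : TF) {R : ℝ} (h : ∀ x, R ≤ |x| → ψ.f x = 0) {x : ℝ} (hx : R < |x|) :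
    ψ.d.f x = 0 := by
  have : ψ.f =ᶠ[𝓝 x] fun _ => 0 := by
    filter_upwards [continuous_abs.continuousAt.eventually (Ioi_mem_nhds hx)] with y hy using h y (le_of_lt hy)
  show deriv ψ.f x = 0
  rw [this.deriv_eq, deriv_const]

lemma TF.d_mul_chi (ψ : TF) {R : ℝ} (h : ∀ x, R ≤ |x| → ψ.f x = 0) (x : ℝ) :
    ψ.d.f x * chi R x = ψ.d.f x := by
  rcases le_or_gt |x| R with hx | hx
  · rw [chi_eq_one hx, mul_one]
  · rw [ψ.d_eq_zero h hx, zero_mul]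

/-- This is the weak integrand for a product test function `θ(t) ψ(x)`, with `a = θ'(t)` and `b =
θ(t)`. -/
lemma integral_inner_eq {R : ℝ} {f : L1} (hf : Integrable (fun x => chi R x * f x ^ 2)) {ψ : TF}
    (h : ∀ x, R ≤ |x| → ψ.f x = 0) (a b : ℝ) :
    ∫ x, (f x * (a * ψ.f x) - f x ^ 2 / 2 * (b * ψ.d.f x) + f x * (b * ψ.d.d.f x)
      + (convK f x - f x) * (b * ψ.f x) - f x * (b * ψ.d.f x)) = pB ψ.b f * a + wdens R ψ f * b := by
  have hrep := rep_add (rep_smul a (rep_mul ψ.b (ae_eq_refl f))) (rep_smul b (rep_add (rep_sub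
    (rep_add (rep_smul (-(1/2)) (rep_mul ψ.d.b (sqc_ae hf))) (rep_mul ψ.d.d.b (ae_eq_refl f)))
    (rep_mul ψ.d.b (ae_eq_refl f))) (rep_mul ψ.b (rep_sub (Kc_ae f) (ae_eq_refl f)))))
  have h1 := integral_congr_ae hrep
  rw [← intL_apply] at h1
  simp only [map_add, map_sub intL, map_smul, ← pB_eq, smul_eq_mul] at h1
  rw [wdens, mul_comm _ a, mul_comm _ b, h1]
  refine integral_congr_ae (Eventually.of_forall fun x => ?_)
  simp only [TF.b_apply]
  linear_combination (b * f x ^ 2 / 2) * ψ.d_mul_chi h x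

lemma wdens_integrable {R : ℝ} {u : ℝ → L1} (hu : Continuous u) {a b : ℝ}
    (hs : IntegrableOn (fun t => sqc R (u t)) (Icc a b)) (ψ : TF) :
    IntegrableOn (fun t => wdens R ψ (u t)) (Icc a b) := by
  have hK := Kc.continuous
  have hc : ∀ {g : ℝ → ℝ}, Continuous g → Integrable g (volume.restrict (Icc a b)) := fun hg =>
    hg.continuousOn.integrableOn_compact isCompact_Icc
  exact ((((ContinuousLinearMap.integrable_comp (pB ψ.d.b) hs).const_mul _).add
    (hc (by fun_prop))).sub (hc (by fun_prop))).add (hc (by fun_prop))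

/-- Product test functions say that `(∫ ψ u)' = wdens R ψ u` in the sense of distributions in time;
continuity of `u` and the fundamental lemma integrate this. -/
theorem IsSolution.weakSol {u₀ : L1} {u : ℝ≥0 → L1} (h : IsSolution u₀ u) :
    WeakSol fun t => u t.toNNReal := by
  have hc : Continuous fun t : ℝ => u t.toNNReal := h.continuous.comp continuous_real_toNNReal
  have hle : ∀ R t, ∫⁻ x, ENNReal.ofReal (chi R x * u (Real.toNNReal t) x ^ 2) ≤
      ∫⁻ x in Icc (-(R + 1)) (R + 1), ‖u t.toNNReal x‖ₑ ^ 2 := fun R t => by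
    rw [← lintegral_indicator measurableSet_Icc]
    refine lintegral_mono fun x => ?_
    by_cases hx : x ∈ Icc (-(R + 1)) (R + 1)
    · rw [indicator_of_mem hx, Real.enorm_eq_ofReal_abs, ← ENNReal.ofReal_pow (abs_nonneg _), sq_abs]
      exact ENNReal.ofReal_le_ofReal (mul_le_of_le_one_left (sq_nonneg _) (chi_le_one _ _))
    · simp [chi_eq_zero hx]
  have hfin : ∀ R a b : ℝ, 0 < a →
      ∫⁻ t in Icc a b, ∫⁻ x, ENNReal.ofReal (chi R x * u (Real.toNNReal t) x ^ 2) < ⊤ := fun R a b ha =>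
    (lintegral_mono fun t => hle R t).trans_lt (h.locallySquareIntegrable a b (R + 1) ha)
  have hae : ∀ R a b : ℝ, 0 < a →
      ∀ᵐ t ∂volume.restrict (Icc a b), Integrable (fun x => chi R x * u (Real.toNNReal t) x ^ 2) :=
    fun R a b ha => by
      filter_upwards [ae_lt_top (measurable_lintegral_sq R hc) (hfin R a b ha).ne] with t ht
      exact integrable_sq_iff.2 ht
  have hsq : ∀ R a b : ℝ, 0 < a → IntegrableOn (fun t : ℝ => sqc R (u t.toNNReal)) (Icc a b) :=
    fun R a b ha => by
      refine ⟨aestronglyMeasurable_of_tendsto_ae atTop (f := fun n t => truncSq R n (u (Real.toNNReal t)))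
        (fun n => ((continuous_truncSq R n).comp hc).aestronglyMeasurable) ?_, ?_⟩
      · filter_upwards [hae R a b ha] with t ht using tendsto_truncSq ht
      · exact (lintegral_mono fun t => enorm_sqc_le R _).trans_lt (hfin R a b ha)
  have hae' : ∀ R : ℝ, ∀ᵐ t ∂volume.restrict (Ioi 0),
      Integrable (fun x => chi R x * u (Real.toNNReal t) x ^ 2) := fun R => by
    rw [← iUnion_Icc_eq_Ioi, ae_restrict_iUnion_iff]
    exact fun n => hae R _ _ (by positivity)
  refine ⟨hc, hsq, hae', fun R ψ hψ s t hs hst => ?_⟩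
  refine sub_eq_integral_of_weak ((pB ψ.b).continuous.comp hc)
    (fun s t hs => wdens_integrable hc (hsq R s t hs) ψ) (fun θ hθ => ?_) hs hst
  have hφ : IsTestFunction fun p : ℝ × ℝ => θ.f p.1 * ψ.f p.2 := by
    refine ⟨(θ.smooth.comp contDiff_fst).mul (ψ.smooth.comp contDiff_snd), ?_, ?_⟩
    · refine HasCompactSupport.intro (θ.compact.isCompact.prod ψ.compact.isCompact) fun p hp => ?_
      rw [mem_prod, not_and_or] at hp
      rcases hp with hp | hp
      · rw [image_eq_zero_of_notMem_tsupport hp, zero_mul]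
      · rw [image_eq_zero_of_notMem_tsupport hp, mul_zero]
    · refine (closure_minimal (t := tsupport θ.f ×ˢ univ) (fun p hp => ⟨subset_closure ?_, trivial⟩)
        ((isClosed_tsupport _).prod isClosed_univ)).trans (prod_mono hθ le_rfl)
      exact left_ne_zero_of_mul hp
  refine Eq.trans ?_ (h.equation _ hφ)
  refine integral_congr_ae ?_
  filter_upwards [hae' R] with r hr
  refine (integral_inner_eq hr hψ (θ.d.f r) (θ.f r)).symm.trans ?_
  refine integral_congr_ae (Eventually.of_forall fun x => ?_)
  have hd : (deriv fun y => θ.f r * ψ.f y) = fun y => θ.f r * deriv ψ.f y :=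
    funext fun y => deriv_const_mul_field _
  simp only [iteratedDeriv_succ, iteratedDeriv_zero, deriv_mul_const_field, hd,
    deriv_const_mul_field]
  rfl

/-! ### Tools for the potential -/

lemma _root_.LipschitzOnWith.comp_absolutelyContinuousOnInterval {F Y : ℝ → ℝ} {a b : ℝ} {S : Set ℝ}
    {C : ℝ≥0} (hF : LipschitzOnWith C F S) (hY : AbsolutelyContinuousOnInterval Y a b)
    (hS : MapsTo Y (uIcc a b) S) : AbsolutelyContinuousOnInterval (fun r => F (Y r)) a b := by
  rw [absolutelyContinuousOnInterval_iff] at hY ⊢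
  intro ε hε
  obtain ⟨δ, hδ, H⟩ := hY (ε / (C + 1)) (by positivity)
  refine ⟨δ, hδ, fun E hE hlt => ?_⟩
  have h1 : ∑ i ∈ Finset.range E.1, dist (F (Y (E.2 i).1)) (F (Y (E.2 i).2)) ≤
      C * ∑ i ∈ Finset.range E.1, dist (Y (E.2 i).1) (Y (E.2 i).2) := by
    rw [Finset.mul_sum]
    refine Finset.sum_le_sum fun i hi => ?_
    have := hE.1 i hi
    exact hF.dist_le_mul _ (hS this.1) _ (hS this.2)
  have h2 := H E hE hlt
  rw [lt_div_iff₀ (by positivity)] at h2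
  have h3 : 0 ≤ ∑ i ∈ Finset.range E.1, dist (Y (E.2 i).1) (Y (E.2 i).2) :=
    Finset.sum_nonneg fun _ _ => dist_nonneg
  nlinarith

/-- The integrand `g` is merely integrable, so `y` is only absolutely continuous. The exponential is
Lipschitz on its bounded range, and absolute continuity survives composition. -/
lemma exp_sub_exp_eq_integral {y g : ℝ → ℝ} {s t : ℝ} (hg : IntervalIntegrable g volume s t)
    (hy : ∀ r ∈ uIcc s t, y r - y s = ∫ v in s..r, g v) :
    Real.exp (y t) - Real.exp (y s) = ∫ r in s..t, Real.exp (y r) * g r := by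
  set Y : ℝ → ℝ := fun r => y s + ∫ v in s..r, g v with hY
  have hYy : ∀ r ∈ uIcc s t, Y r = y r := fun r hr => by simp only [hY, ← hy r hr]; ring
  have hAC : AbsolutelyContinuousOnInterval Y s t := by
    have h0 : AbsolutelyContinuousOnInterval (fun _ : ℝ => y s) s t :=
      (contDiff_const.contDiffOn).absolutelyContinuousOnInterval
    exact h0.add (hg.absolutelyContinuousOnInterval_intervalIntegral left_mem_uIcc)
  obtain ⟨C, hC⟩ := hAC.exists_bound
  have hLip : ∃ c, LipschitzOnWith c Real.exp (Icc (-C) C) :=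
    Real.contDiff_exp.contDiffOn.exists_lipschitzOnWith (n := 1) (by decide) (convex_Icc _ _) isCompact_Icc
  obtain ⟨c, hc⟩ := hLip
  have h1 := (hc.comp_absolutelyContinuousOnInterval hAC
    fun r hr => abs_le.1 (hC r hr)).integral_deriv_eq_sub
  rw [← hYy t right_mem_uIcc, ← hYy s left_mem_uIcc, ← h1]
  refine intervalIntegral.integral_congr_ae ?_
  filter_upwards [hg.ae_hasDerivAt_integral] with r hr hmem
  have hm := uIoc_subset_uIcc hmem
  have h2 := ((hr hm s left_mem_uIcc).const_add (y s)).exp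
  rw [← hYy r hm]
  exact h2.deriv

section

variable {E : Type*} [NormedAddCommGroup E] [NormedSpace ℝ E] [CompleteSpace E] (G : TransGroup E)

/-- The integrated form passes to limits, so `D` is a closed operator (`isD_of_tendsto`). -/
lemma TransGroup.isD_iff {f g : E} :
    IsD G.τ f g ↔ ∀ y, G.τ y f - f = ∫ s in (0:ℝ)..y, G.τ s g := by
  constructor
  · intro h y
    rw [intervalIntegral.integral_eq_sub_of_hasDerivAt (fun s _ => G.hasDerivAt_τ h s)
      ((G.cont g).intervalIntegrable _ _), G.zero]
  · intro h
    have h1 : HasDerivAt (fun y => f + ∫ s in (0:ℝ)..y, G.τ s g) (G.τ 0 g) 0 :=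
      (intervalIntegral.integral_hasDerivAt_right (by simp)
        ((G.cont g).stronglyMeasurableAtFilter _ _) (G.cont g).continuousAt).const_add f
    rw [G.zero] at h1
    exact h1.congr_of_eventuallyEq (Eventually.of_forall fun y => by simp only [← h y]; abel)

lemma TransGroup.isD_of_tendsto {f g : ℕ → E} {f' g' : E} (h : ∀ n, IsD G.τ (f n) (g n))
    (hf : Tendsto f atTop (𝓝 f')) (hg : Tendsto g atTop (𝓝 g')) : IsD G.τ f' g' := by
  rw [G.isD_iff]
  intro y
  have h1 : Tendsto (fun n => G.τ y (f n) - f n) atTop (𝓝 (G.τ y f' - f')) :=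
    (((G.τ y).continuous.tendsto _).comp hf).sub hf
  have hbd : Continuous fun g : E => ∫ s in (0:ℝ)..y, G.τ s g :=
    intervalIntegral.continuous_parametric_intervalIntegral_of_continuous'
      (f := fun g s => G.τ s g) (G.continuous_τ.comp (continuous_snd.prodMk continuous_fst)) 0 y
  refine tendsto_nhds_unique h1 (((hbd.tendsto _).comp hg).congr fun n => ?_)
  exact (G.isD_iff.1 (h n) y).symm

end

/-! ### Mollification of integrable functions -/

namespace TF

/-- A test function as an element of `L¹`. -/
def l (ψ : TF) : L1 := ψ.integrable.toL1

lemma l_ae (ψ : TF) : ψ.l =ᵐ[volume] ψ.f := ψ.integrable.coeFn_toL1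

lemma pB_l (ψ : TF) (b : BC) : pB b ψ.l = ∫ x, b x * ψ.f x := by
  rw [pB_apply]
  exact integral_congr_ae (ψ.l_ae.mono fun x hx => by simp only [hx])

lemma pB_I_d (ψ : TF) (f : L1) : pB (I f) ψ.d.l = -pB ψ.b f := by
  obtain ⟨v, v', hv, hlim⟩ := dense_isD f
  have key : ∀ n, pB (I (v n)) ψ.d.l = -pB ψ.b (v n) := fun n => by
    rw [pB_l, pB_apply]
    have := integral_mul_deriv_eq_deriv_mul_of_integrable (u := I (v n)) (v := ψ.f) (u' := I (v' n))
      (v' := ψ.d.f) (fun x _ => hasDerivAt_I (hv n) x) (fun x _ => ψ.hasDerivAt x)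
      (((I (v n)).continuous.mul ψ.d.smooth.continuous).integrable_of_hasCompactSupport
        ψ.d.compact.mul_left)
      (((I (v' n)).continuous.mul ψ.smooth.continuous).integrable_of_hasCompactSupport
        ψ.compact.mul_left)
      (((I (v n)).continuous.mul ψ.smooth.continuous).integrable_of_hasCompactSupport
        ψ.compact.mul_left)
    rw [this]
    congr 1
    refine integral_congr_ae ?_
    filter_upwards [isD_ae_eq (hv n)] with x hx
    rw [hx, mul_comm]; rfl
  have h1 : Tendsto (fun n => pB (I (v n)) ψ.d.l) atTop (𝓝 (pB (I f) ψ.d.l)) := by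
    have hc : Continuous fun f => pB (I f) ψ.d.l := by fun_prop
    exact (hc.tendsto f).comp hlim
  have h2 : Tendsto (fun n => -pB ψ.b (v n)) atTop (𝓝 (-pB ψ.b f)) :=
    (((pB ψ.b).continuous.tendsto f).comp hlim).neg
  exact tendsto_nhds_unique h1 (h2.congr fun n => (key n).symm)

/-- The primitive of a test function with mean zero. -/
lemma exists_primitive (ψ : TF) {R : ℝ} (hR : 0 ≤ R) (h : ∀ x, R ≤ |x| → ψ.f x = 0) (h0 : ∫ x, ψ.f x = 0) :
    ∃ Ψ : TF, Ψ.d.f = ψ.f ∧ ∀ x, R ≤ |x| → Ψ.f x = 0 := by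
  set P : ℝ → ℝ := fun x => ∫ y in (-R)..x, ψ.f y with hP
  have hc := ψ.smooth.continuous
  have hd : ∀ x, HasDerivAt P (ψ.f x) x := fun x =>
    intervalIntegral.integral_hasDerivAt_right (hc.intervalIntegrable _ _)
      (hc.stronglyMeasurableAtFilter _ _) hc.continuousAt
  have hz : ∀ x, R ≤ |x| → P x = 0 := fun x hx => by
    rcases le_abs.1 hx with h1 | h1
    · have e : ∫ y in (-R)..x, ψ.f y = ∫ y, ψ.f y := by
        rw [intervalIntegral.integral_of_le (by linarith)]
        refine setIntegral_eq_integral_of_forall_compl_eq_zero fun y hy => h y ?_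
        by_contra hlt
        have := abs_lt.1 (not_le.1 hlt)
        exact hy ⟨this.1, by linarith⟩
      rw [hP]
      exact e.trans h0
    · have : ∀ y ∈ uIcc (-R) x, ψ.f y = 0 := fun y hy => by
        rw [uIcc_of_ge (by linarith)] at hy
        exact h y (le_abs.2 (Or.inr (by linarith [hy.2])))
      simp only [hP]
      rw [intervalIntegral.integral_congr (g := fun _ => 0) this]
      simp
  refine ⟨⟨P, ?_, ?_⟩, funext fun x => (hd x).deriv, hz⟩
  · rw [contDiff_infty_iff_deriv]
    refine ⟨fun x => (hd x).differentiableAt, ?_⟩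
    rw [show deriv P = ψ.f from funext fun x => (hd x).deriv]
    exact ψ.smooth
  · refine HasCompactSupport.intro (K := Icc (-R) R) isCompact_Icc fun x hx => hz x ?_
    by_contra hlt
    have := abs_lt.1 (not_le.1 hlt)
    exact hx ⟨this.1.le, this.2.le⟩

lemma integrable_smul_τ (ρ : TF) (f : L1) : Integrable fun z => ρ.f z • trL.τ z f :=
  (ρ.smooth.continuous.smul (trL.cont f)).integrable_of_hasCompactSupport ρ.compact.smul_right

/-- Mollification. -/
def moll (ρ : TF) : L1 →L[ℝ] L1 :=
  LinearMap.mkContinuous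
    { toFun := fun f => ∫ z, ρ.f z • trL.τ z f
      map_add' := fun f g => by
        simp only [map_add, smul_add]
        exact integral_add (ρ.integrable_smul_τ f) (ρ.integrable_smul_τ g)
      map_smul' := fun c f => by
        simp only [map_smul, RingHom.id_apply]
        rw [← integral_smul]
        simp only [smul_comm c] } (∫ z, |ρ.f z|) fun f => by
    refine (norm_integral_le_integral_norm _).trans ?_
    rw [← integral_mul_const]
    refine integral_mono (ρ.integrable_smul_τ f).norm (ρ.integrable.abs.mul_const _) fun z => ?_
    simp only [norm_smul, Real.norm_eq_abs, trL.norm_τ]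
    exact le_rfl

lemma moll_apply (ρ : TF) (f : L1) : ρ.moll f = ∫ z, ρ.f z • trL.τ z f := rfl

lemma moll_τ (ρ : TF) (s : ℝ) (f : L1) : ρ.moll (trL.τ s f) = trL.τ s (ρ.moll f) := by
  rw [moll_apply, moll_apply, ← ContinuousLinearMap.integral_comp_comm _ (ρ.integrable_smul_τ f)]
  refine integral_congr_ae (Eventually.of_forall fun z => ?_)
  simp only [map_smul, ← trL.add, add_comm]

lemma moll_isD (ρ : TF) {f f' : L1} (h : IsD trL.τ f f') : ρ.moll f' = -ρ.d.moll f := by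
  rw [moll_apply, moll_apply]
  exact integral_bilinear_hasDerivAt_right_eq_neg_left_of_integrable
    (L := ContinuousLinearMap.lsmul ℝ ℝ) (fun x _ => ρ.hasDerivAt x) (fun x _ => trL.hasDerivAt_τ h x)
    (ρ.integrable_smul_τ _) (ρ.d.integrable_smul_τ _) (ρ.integrable_smul_τ _)

/-- The mollification is the correlation `∫ ρ(z) f(x + z) dz`, so the derivative falls on `ρ` with a
minus sign. Integration by parts on the domain of `D`, then closedness. -/
lemma isD_moll (ρ : TF) (f : L1) : IsD trL.τ (ρ.moll f) (-ρ.d.moll f) := by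
  obtain ⟨v, v', hv, hlim⟩ := dense_isD f
  refine trL.isD_of_tendsto (f := fun n => ρ.moll (v n)) (g := fun n => -ρ.d.moll (v n)) (fun n => ?_)
    ((ρ.moll.continuous.tendsto _).comp hlim) (((ρ.d.moll.continuous.tendsto _).comp hlim).neg)
  rw [← ρ.moll_isD (hv n)]
  exact trL.isD_clm ρ.moll_τ (hv n)

/-- The mollified potential at `x` is the potential tested with the shifted mollifier, so the weak
equation applies to it pointwise. -/
lemma I_moll (ρ : TF) (f : L1) (x : ℝ) : I (ρ.moll f) x = pB (I f) (ρ.shift (-x)).l := by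
  have e : I (ρ.moll f) x = ∫ z, ρ.f z * I f (x + z) := by
    have := ((BoundedContinuousFunction.evalCLM ℝ x).comp I).integral_comp_comm (ρ.integrable_smul_τ f)
    rw [moll_apply]
    refine this.symm.trans (integral_congr_ae (Eventually.of_forall fun z => ?_))
    show I (ρ.f z • trL.τ z f) x = _
    rw [map_smul, I_τ]
    rfl
  rw [e, pB_l, ← integral_add_left_eq_self (μ := (volume : Measure ℝ))
    (fun y => I f y * (ρ.shift (-x)).f y) x]
  refine integral_congr_ae (Eventually.of_forall fun z => ?_)
  simp only [shift]
  rw [mul_comm, add_neg_cancel_comm]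

/-- Since `-ρ.d.moll f` is the derivative of `ρ.moll f`, its primitive is the continuous
representative of the mollification. -/
lemma I_moll_d (ρ : TF) (f : L1) (x : ℝ) : I (-ρ.d.moll f) x = pB (ρ.shift (-x)).b f := by
  have h1 : (ρ.d.shift (-x)).l = (ρ.shift (-x)).d.l := by
    refine Lp.ext ?_
    filter_upwards [l_ae (ρ.d.shift (-x)), l_ae (ρ.shift (-x)).d] with y h1 h2
    rw [h1, h2]
    exact (deriv_comp_add_const ρ.f (-x) y).symm
  rw [map_neg, BoundedContinuousFunction.coe_neg, Pi.neg_apply, I_moll, h1, pB_I_d, neg_neg]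

end TF

/-! ### The equation for the potential -/

/-- Standard mollifiers. -/
def bump (n : ℕ) : ContDiffBump (0 : ℝ) :=
  ⟨1 / (2 * (n + 1)), 1 / (n + 1), by positivity, by
    rw [div_lt_div_iff_of_pos_left one_pos (by positivity) (by positivity)]
    linarith [(Nat.cast_nonneg n : (0:ℝ) ≤ n)]⟩

def mol (n : ℕ) : TF :=
  ⟨(bump n).normed volume, (bump n).contDiff_normed, (bump n).hasCompactSupport_normed⟩

lemma mol_nonneg (n : ℕ) (x : ℝ) : 0 ≤ (mol n).f x := (bump n).nonneg_normed x

lemma integral_mol (n : ℕ) : ∫ x, (mol n).f x = 1 := (bump n).integral_normed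

lemma mol_eq_zero' {n : ℕ} {x : ℝ} (h : 1 / ((n:ℝ) + 1) ≤ |x|) : (mol n).f x = 0 := by
  by_contra hx
  have : x ∈ Function.support ((bump n).normed volume) := hx
  rw [(bump n).support_normed_eq, Metric.mem_ball, dist_zero_right, Real.norm_eq_abs] at this
  exact absurd this (not_lt.2 h)

lemma mol_eq_zero {n : ℕ} {x : ℝ} (h : 1 ≤ |x|) : (mol n).f x = 0 :=
  mol_eq_zero' (h.trans' ((div_le_one (by positivity)).2 (by linarith [(Nat.cast_nonneg n : (0:ℝ) ≤ n)])))

/-- The density of the equation for the potential. -/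
def gd (R : ℝ) (ψ : TF) (f : L1) : ℝ :=
  (1/2) * pB ψ.b (sqc R f) - pB ψ.d.b f + pB ψ.b (f - Kc f)

/-- Testing the equation for `u` with `Ψ` amounts to testing that for its potential with `-Ψ'`; the
nonlocal term integrates because `(K * f)_x = f - K * f`. -/
lemma wdens_eq_gd (R : ℝ) (Ψ : TF) (f : L1) : wdens R Ψ f = -gd R Ψ.d f := by
  have := Ψ.pB_d (isD_Kc f)
  simp only [wdens, gd, map_sub (pB _)] at this ⊢
  linarith

/-- `ψ - m ζ`. -/
def TF.subMul (ψ ζ : TF) (m : ℝ) : TF :=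
  ⟨fun x => ψ.f x - m * ζ.f x, ψ.smooth.sub (contDiff_const.mul ζ.smooth),
    ψ.compact.sub ζ.compact.mul_left⟩

lemma TF.subMul_b (ψ ζ : TF) (m : ℝ) : (ψ.subMul ζ m).b = ψ.b - m • ζ.b := rfl

lemma TF.subMul_d (ψ ζ : TF) (m : ℝ) : (ψ.subMul ζ m).d.b = ψ.d.b - m • ζ.d.b := by
  ext x
  exact ((ψ.hasDerivAt x).sub ((ζ.hasDerivAt x).const_mul m)).deriv

lemma TF.subMul_l (ψ ζ : TF) (m : ℝ) : (ψ.subMul ζ m).l = ψ.l - m • ζ.l := by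
  refine Lp.ext ?_
  filter_upwards [(ψ.subMul ζ m).l_ae, rep_sub ψ.l_ae (rep_smul m ζ.l_ae)] with x h1 h2
  rw [h1, h2]; rfl

lemma TF.ext' {ψ φ : TF} (h : ψ.f = φ.f) : ψ = φ := by
  cases ψ; cases φ; simp_all

lemma gd_subMul (R : ℝ) (ψ ζ : TF) (m : ℝ) (f : L1) :
    gd R (ψ.subMul ζ m) f = gd R ψ f - m * gd R ζ f := by
  simp only [gd, TF.subMul_b, TF.subMul_d, map_sub pB, map_smul pB, sub_apply,
    smul_apply, smul_eq_mul]
  ring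

lemma gd_eq_of_le {R : ℝ} (hR : 1 ≤ R) {f : L1} (h1 : Integrable fun x => chi 1 x * f x ^ 2)
    (h2 : Integrable fun x => chi R x * f x ^ 2) {ζ : TF} (hζ : ∀ x, 1 ≤ |x| → ζ.f x = 0) :
    gd R ζ f = gd 1 ζ f := by
  have : pB ζ.b (sqc R f) = pB ζ.b (sqc 1 f) := by
    rw [pB_apply, pB_apply]
    refine integral_congr_ae ?_
    filter_upwards [sqc_ae h1, sqc_ae h2] with x a b
    rw [a, b, TF.b_apply]
    rcases le_or_gt 1 |x| with hx | hx
    · rw [hζ x hx, zero_mul, zero_mul]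
    · rw [chi_eq_one hx.le, chi_eq_one (hx.le.trans hR)]
  rw [gd, gd, this]

lemma gd_integrable {R : ℝ} {u : ℝ → L1} (hu : Continuous u) {a b : ℝ}
    (hs : IntegrableOn (fun t => sqc R (u t)) (Icc a b)) (ψ : TF) :
    IntegrableOn (fun t => gd R ψ (u t)) (Icc a b) := by
  have hK := Kc.continuous
  have hc : ∀ {g : ℝ → ℝ}, Continuous g → Integrable g (volume.restrict (Icc a b)) := fun hg =>
    hg.continuousOn.integrableOn_compact isCompact_Icc
  exact ((((pB ψ.b).integrable_comp hs).const_mul _).sub (hc (by fun_prop))).add (hc (by fun_prop))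

lemma WeakSol.gd_intervalIntegrable {u : ℝ → L1} (h : WeakSol u) (R : ℝ) (ψ : TF) {a b : ℝ} (ha : 0 < a)
    (hab : a ≤ b) : IntervalIntegrable (fun t => gd R ψ (u t)) volume a b := by
  rw [intervalIntegrable_iff_integrableOn_Icc_of_le hab]
  exact gd_integrable h.cont (h.sq R a b ha) ψ

/-- Only test functions of mean zero have a compactly supported primitive. Subtracting `(∫ ψ) ζ` for
a fixed `ζ` of mass one reduces to these, and what is lost is a multiple of one function `C` of
time: the defect of the equation for `ζ`. The radius is at least `1` to contain the support of `ζ`.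
-/
theorem WeakSol.potential {u : ℝ → L1} (h : WeakSol u) : ∃ C : ℝ → ℝ, ContinuousOn C (Ioi 0) ∧
    ∀ R, 1 ≤ R → ∀ ψ : TF, (∀ x, R ≤ |x| → ψ.f x = 0) → ∀ s t, 0 < s → s ≤ t →
      pB (I (u t)) ψ.l - pB (I (u s)) ψ.l =
        (C t - C s) * (∫ x, ψ.f x) + ∫ r in s..t, gd R ψ (u r) := by
  set ζ := mol 0
  have hζ : ∀ x, 1 ≤ |x| → ζ.f x = 0 := fun x hx => mol_eq_zero hx
  have hI : ∀ s t, 0 < s → 0 < t → IntervalIntegrable (fun t => gd 1 ζ (u t)) volume s t := fun s t hs ht => by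
    rcases le_total s t with hst | hst
    · exact h.gd_intervalIntegrable 1 ζ hs hst
    · exact (h.gd_intervalIntegrable 1 ζ ht hst).symm
  refine ⟨fun t => pB (I (u t)) ζ.l - ∫ r in (1:ℝ)..t, gd 1 ζ (u r), ?_, ?_⟩
  · have hc1 : Continuous fun t => pB (I (u t)) ζ.l := by
      have := h.cont
      fun_prop
    refine hc1.continuousOn.sub fun t ht => ?_
    have ht' : (0:ℝ) < t := ht
    have hle : min 1 (t / 2) ≤ max 1 (t + 1) := (min_le_left _ _).trans (le_max_left _ _)
    have := intervalIntegral.continuousOn_primitive_interval'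
      (hI (min 1 (t / 2)) (max 1 (t + 1)) (by positivity) (by positivity))
      (a := 1) (by rw [uIcc_of_le hle]; exact ⟨min_le_left _ _, le_max_left _ _⟩)
    rw [uIcc_of_le hle] at this
    refine (this.continuousAt (Icc_mem_nhds ?_ ?_)).continuousWithinAt
    · exact (min_le_right _ _).trans_lt (by linarith)
    · exact lt_of_lt_of_le (by linarith) (le_max_right _ _)
  · intro R hR ψ hψ s t hs hst
    set m := ∫ x, ψ.f x
    have hsub : ∀ x, R ≤ |x| → (ψ.subMul ζ m).f x = 0 := fun x hx => by
      show ψ.f x - m * ζ.f x = 0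
      rw [hψ x hx, hζ x (hR.trans hx), mul_zero, sub_zero]
    have h0 : ∫ x, (ψ.subMul ζ m).f x = 0 := by
      show ∫ x, (ψ.f x - m * ζ.f x) = 0
      rw [integral_sub ψ.integrable (ζ.integrable.const_mul _), integral_const_mul, integral_mol,
        mul_one, sub_self]
    obtain ⟨Ψ, hΨ, hΨ0⟩ := (ψ.subMul ζ m).exists_primitive (by linarith) hsub h0
    have hd : Ψ.d = ψ.subMul ζ m := TF.ext' hΨ
    have hw := h.weak R Ψ hΨ0 s t hs hst
    have hp : ∀ r, pB (I (u r)) ψ.l - m * pB (I (u r)) ζ.l = -pB Ψ.b (u r) := fun r => by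
      rw [← Ψ.pB_I_d, hd, TF.subMul_l, map_sub, map_smul, smul_eq_mul]
    have hint : ∫ r in s..t, wdens R Ψ (u r) =
        -((∫ r in s..t, gd R ψ (u r)) - m * ∫ r in s..t, gd 1 ζ (u r)) := by
      rw [← intervalIntegral.integral_const_mul, ← intervalIntegral.integral_sub
        (h.gd_intervalIntegrable R ψ hs hst) ((hI s t hs (hs.trans_le hst)).const_mul m),
        ← intervalIntegral.integral_neg]
      refine intervalIntegral.integral_congr_ae_restrict ?_
      have hsub : uIoc s t ⊆ Ioi 0 := fun r hr => hs.trans (by rw [uIoc_of_le hst] at hr; exact hr.1)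
      filter_upwards [ae_restrict_of_ae_restrict_of_subset hsub (h.ae 1),
        ae_restrict_of_ae_restrict_of_subset hsub (h.ae R)] with r h1 h2
      rw [wdens_eq_gd, hd, gd_subMul, gd_eq_of_le hR h1 h2 hζ]
    rw [hint] at hw
    have hadd := intervalIntegral.integral_add_adjacent_intervals (hI 1 s one_pos hs)
      (hI s t hs (hs.trans_le hst))
    beta_reduce
    rw [← hadd]
    linear_combination hp t - hp s - hw

/-! ### The chain rule for the mollified potential -/

/-- The density of the mollified potential equation. -/
def GB (R : ℝ) (ρ : TF) (f : L1) : BC :=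
  (1/2 : ℝ) • I (-ρ.d.moll (sqc R f)) + I (ρ.d.d.moll f) + I (-ρ.d.moll (f - Kc f))

/-- Tested with shifted mollifiers, the density is a bounded continuous function of `x`, so time
integrals may be taken in `BC` and evaluated at points. -/
lemma gd_shift (R : ℝ) (ρ : TF) (f : L1) (x : ℝ) : gd R (ρ.shift (-x)) f = GB R ρ f x := by
  have h1 : (ρ.shift (-x)).d.b = (ρ.d.shift (-x)).b := by rw [TF.shift_d, TF.shift_b]
  have h2 : I (ρ.d.d.moll f) x = -pB (ρ.shift (-x)).d.b f := by
    rw [h1, ← TF.I_moll_d, map_neg]; simp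
  show _ = (1/2 : ℝ) * I (-ρ.d.moll (sqc R f)) x + I (ρ.d.d.moll f) x + I (-ρ.d.moll (f - Kc f)) x
  rw [h2, TF.I_moll_d, TF.I_moll_d, gd]
  ring

lemma GB_integrable {R : ℝ} {u : ℝ → L1} (hu : Continuous u) {a b : ℝ}
    (hs : IntegrableOn (fun t => sqc R (u t)) (Icc a b)) (ρ : TF) :
    IntegrableOn (fun t => GB R ρ (u t)) (Icc a b) := by
  have hK := Kc.continuous
  have hc : ∀ {g : ℝ → BC}, Continuous g → Integrable g (volume.restrict (Icc a b)) := fun hg =>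
    hg.continuousOn.integrableOn_compact isCompact_Icc
  exact (((I.integrable_comp (ρ.d.moll.integrable_comp hs).neg).smul (1/2 : ℝ)).add
    (hc (by fun_prop))).add (hc (by fun_prop))

lemma pB_congr {b b' : BC} {ψ : TF} (h : ∀ x, ψ.f x ≠ 0 → b x = b' x) : pB b ψ.l = pB b' ψ.l := by
  rw [TF.pB_l, TF.pB_l]
  refine integral_congr_ae (Eventually.of_forall fun x => ?_)
  by_cases hx : ψ.f x = 0
  · simp [hx]
  · simp only [h x hx]

lemma TF.integral_shift (ρ : TF) (y : ℝ) : ∫ x, (ρ.shift y).f x = ∫ x, ρ.f x :=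
  integral_add_right_eq_self (μ := volume) ρ.f y

/-- At each `x` the mollified potential minus `C` is absolutely continuous in time, and
`exp_sub_exp_eq_integral` applies to half of it. The margin `R - 1` keeps mollifiers of radius at
most `1` centred there within radius `R`. -/
lemma WeakSol.chain {u : ℝ → L1} (h : WeakSol u) {C : ℝ → ℝ} (hC : ContinuousOn C (Ioi 0))
    (hpot : ∀ R, 1 ≤ R → ∀ ψ : TF, (∀ x, R ≤ |x| → ψ.f x = 0) → ∀ s t, 0 < s → s ≤ t →
      pB (I (u t)) ψ.l - pB (I (u s)) ψ.l =
        (C t - C s) * (∫ x, ψ.f x) + ∫ r in s..t, gd R ψ (u r))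
    {R : ℝ} (hR : 1 ≤ R) (n : ℕ) {ψ : TF} (hψ : ∀ x, R - 1 ≤ |x| → ψ.f x = 0) {s t : ℝ} (hs : 0 < s)
    (hst : s ≤ t) :
    IntervalIntegrable (fun r => Real.exp (-(1/2) * C r) *
        pB ((1/2 : ℝ) • (expB ((1/2 : ℝ) • I ((mol n).moll (u r))) * GB R (mol n) (u r))) ψ.l) volume s t ∧
    Real.exp (-(1/2) * C t) * pB (expB ((1/2 : ℝ) • I ((mol n).moll (u t)))) ψ.l -
      Real.exp (-(1/2) * C s) * pB (expB ((1/2 : ℝ) • I ((mol n).moll (u s)))) ψ.l =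
    ∫ r in s..t, Real.exp (-(1/2) * C r) *
      pB ((1/2 : ℝ) • (expB ((1/2 : ℝ) • I ((mol n).moll (u r))) * GB R (mol n) (u r))) ψ.l := by
  set ρ := mol n with hρ
  set W : ℝ → BC := fun r => expB ((1/2 : ℝ) • I (ρ.moll (u r))) with hW
  set c : ℝ → ℝ := fun r => Real.exp (-(1/2) * C r) with hc
  have hWc : Continuous W := continuous_expB.comp (by have := h.cont; fun_prop)
  have hsub : uIcc s t ⊆ Ioi 0 := by
    rw [uIcc_of_le hst]; exact fun r hr => hs.trans_le hr.1
  have hcc : ContinuousOn c (uIcc s t) :=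
    Real.continuous_exp.comp_continuousOn (continuousOn_const.mul (hC.mono hsub))
  have hGi : IntervalIntegrable (fun r => GB R ρ (u r)) volume s t := by
    rw [intervalIntegrable_iff_integrableOn_Icc_of_le hst]
    exact GB_integrable h.cont (h.sq R s t hs) ρ
  have hXi : IntervalIntegrable (fun r => (c r * (1/2)) • (W r * GB R ρ (u r))) volume s t :=
    (hGi.continuousOn_mul hWc.continuousOn).continuousOn_smul (hcc.mul continuousOn_const)
  set J := ∫ r in s..t, (c r * (1/2)) • (W r * GB R ρ (u r)) with hJ
  have hpt : ∀ x, |x| < R - 1 → c t * W t x - c s * W s x = J x := fun x hx => by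
    have hx0 : ∀ y, R ≤ |y| → (ρ.shift (-x)).f y = 0 := fun y hy => mol_eq_zero (by
      have := abs_sub_abs_le_abs_sub y x
      rw [← sub_eq_add_neg]
      linarith)
    set y : ℝ → ℝ := fun r => 1/2 * (I (ρ.moll (u r)) x - C r) with hy
    have hexp : ∀ r, Real.exp (y r) = c r * W r x := fun r => by
      simp only [hc, hW, hy, expB_apply]
      rw [← Real.exp_add]
      congr 1
      show _ = -(1/2) * C r + 1/2 * I (ρ.moll (u r)) x
      ring
    have hyi : ∀ r ∈ uIcc s t, y r - y s = ∫ v in s..r, 1/2 * GB R ρ (u v) x := fun r hr => by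
      rw [uIcc_of_le hst] at hr
      have := hpot R hR _ hx0 s r hs hr.1
      rw [TF.integral_shift, integral_mol, ← TF.I_moll, ← TF.I_moll] at this
      simp only [gd_shift] at this
      rw [intervalIntegral.integral_const_mul]
      simp only [hy]
      linear_combination (1/2) * this
    have hev : ∀ b : BC, BoundedContinuousFunction.evalCLM ℝ x b = b x := fun b => rfl
    have hgi : IntervalIntegrable (fun r => 1/2 * GB R ρ (u r) x) volume s t := by
      refine IntervalIntegrable.const_mul ?_ _
      rw [intervalIntegrable_iff] at hGi ⊢
      exact (BoundedContinuousFunction.evalCLM ℝ x).integrable_comp hGi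
    have := exp_sub_exp_eq_integral hgi hyi
    rw [hexp, hexp] at this
    rw [this, hJ, ← hev, ← ContinuousLinearMap.intervalIntegral_comp_comm _ hXi]
    refine intervalIntegral.integral_congr fun r _ => ?_
    simp only [hexp, hev]
    show _ = c r * (1/2) * (W r x * GB R ρ (u r) x)
    ring
  have hlin : ∀ r, c r * pB ((1/2 : ℝ) • (W r * GB R ρ (u r))) ψ.l =
      pB.flip ψ.l ((c r * (1/2)) • (W r * GB R ρ (u r))) := fun r => by
    rw [mul_smul, map_smul (pB.flip ψ.l) (c r)]
    rfl
  have hlin' := funext hlin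
  rw [hlin']
  constructor
  · rw [intervalIntegrable_iff] at hXi ⊢
    exact (pB.flip ψ.l).integrable_comp hXi
  · rw [ContinuousLinearMap.intervalIntegral_comp_comm _ hXi, ← hJ]
    have : pB.flip ψ.l J = pB.flip ψ.l (c t • W t - c s • W s) := by
      refine pB_congr fun x hx => ?_
      have : |x| < R - 1 := by
        by_contra hlt
        exact hx (hψ x (not_lt.1 hlt))
      exact (hpt x this).symm
    rw [this, map_sub, map_smul, map_smul]
    rfl

lemma isD_expB {b b' : BC} (h : IsD trB b b') : IsD trB (expB b) (expB b * b') := by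
  have h0 : trB 0 b = b := trB_zero b
  have h1 : HasFDerivAt (𝕜 := ℝ) (NormedSpace.exp : BC → BC)
      (NormedSpace.exp (trB 0 b) • (1 : BC →L[ℝ] BC)) (trB 0 b) := hasFDerivAt_exp
  have h2 := h1.comp_hasDerivAt (0:ℝ) h
  rw [h0] at h2
  refine h2.congr_of_eventuallyEq (Eventually.of_forall fun y => ?_)
  ext x
  show expB b (x + y) = expB (trB y b) x
  rw [expB_apply, expB_apply]
  rfl

/-- Hopf–Cole cancellation for the mollified potential: the second derivative of the exponential
produces `(ρ * f)² / 4`, whereas the equation supplies `(ρ * f²) / 4`. The difference, a Jensen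
defect, is the only term that does not fit. -/
lemma inner_chain (R : ℝ) (ρ : TF) (f : L1) (ψ : TF) :
    pB ((1/2 : ℝ) • (expB ((1/2 : ℝ) • I (ρ.moll f)) * GB R ρ f)) ψ.l =
      -pB ψ.d.b (hc (ρ.moll f)) + pB ψ.b (hc (ρ.moll f)) -
        (1/2) * pB ψ.b (mul (expB ((1/2 : ℝ) • I (ρ.moll f))) (ρ.moll (Kc f))) +
        (1/4) * pB (expB ((1/2 : ℝ) • I (ρ.moll f)) *
          (I (-ρ.d.moll (sqc R f)) - I (-ρ.d.moll f) * I (-ρ.d.moll f))) ψ.l := by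
  have hm := ρ.isD_moll f
  have hm' : IsD trL.τ (-ρ.d.moll f) (ρ.d.d.moll f) := by
    have := trL.isD_clm (A := -ContinuousLinearMap.id ℝ L1) (fun _ _ => by simp) (ρ.d.isD_moll f)
    simpa using this
  have hV := ρ.isD_moll (sqc R f)
  have hg := ρ.isD_moll (f - Kc f)
  set m := ρ.moll f
  set m' := -ρ.d.moll f
  set m'' := ρ.d.d.moll f
  set W := expB ((1/2 : ℝ) • I m)
  have hhalf : ∀ {f g : L1}, IsD trL.τ f g → IsD trL.τ ((1/2 : ℝ) • f) ((1/2 : ℝ) • g) := fun h =>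
    trL.isD_clm (A := (1/2 : ℝ) • ContinuousLinearMap.id ℝ L1) (fun _ _ => by simp) h
  have hWd : IsD trB W (W * I ((1/2 : ℝ) • m')) := by
    have := isD_expB (isD_I (hhalf hm))
    rwa [map_smul I (1/2 : ℝ) m] at this
  have hq := ψ.pB_d (isD_mul hWd (hhalf hm))
  rw [show hc m = mul W ((1/2 : ℝ) • m) from rfl, ← hq]
  have hKm : ρ.moll (f - Kc f) = m - ρ.moll (Kc f) := map_sub _ _ _
  have key : mul ((1/2 : ℝ) • (W * GB R ρ f)) ψ.l =
      mul ψ.b (mul (W * I ((1/2 : ℝ) • m')) ((1/2 : ℝ) • m) + mul W ((1/2 : ℝ) • m')) +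
        mul ψ.b (mul W ((1/2 : ℝ) • m)) - (1/2 : ℝ) • mul ψ.b (mul W (ρ.moll (Kc f))) +
        (1/4 : ℝ) • mul (W * (I (-ρ.d.moll (sqc R f)) - I m' * I m')) ψ.l := by
    refine Lp.ext ?_
    have hrep := rep_add (rep_sub (rep_add (rep_mul ψ.b (rep_add
      (rep_mul (W * I ((1/2 : ℝ) • m')) (rep_smul (1/2) (isD_ae_eq hm)))
      (rep_mul W (rep_smul (1/2) (isD_ae_eq hm')))))
      (rep_mul ψ.b (rep_mul W (rep_smul (1/2) (ae_eq_refl m)))))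
      (rep_smul (1/2) (rep_mul ψ.b (rep_mul W (ae_eq_refl (ρ.moll (Kc f)))))))
      (rep_smul (1/4) (rep_mul (W * (I (-ρ.d.moll (sqc R f)) - I m' * I m')) ψ.l_ae))
    filter_upwards [hrep, rep_mul ((1/2 : ℝ) • (W * GB R ρ f)) ψ.l_ae, isD_ae_eq hg,
      rep_sub (ae_eq_refl m) (ae_eq_refl (ρ.moll (Kc f)))] with x h1 h2 h3 h4
    rw [h1, h2]
    rw [hKm, h4] at h3
    rw [map_smul I]
    show 1/2 * (W x * (1/2 * I (-ρ.d.moll (sqc R f)) x + I m'' x + I (-ρ.d.moll (f - Kc f)) x)) * ψ.f x =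
      ψ.f x * (W x * (1/2 * I m' x) * (1/2 * I m' x) + W x * (1/2 * I m'' x)) + ψ.f x * (W x * (1/2 * m x))
        - 1/2 * (ψ.f x * (W x * (ρ.moll (Kc f)) x)) +
        1/4 * (W x * (I (-ρ.d.moll (sqc R f)) x - I m' x * I m' x) * ψ.f x)
    rw [← h3]
    ring
  have := congrArg intL key
  rw [← pB_eq] at this
  rw [this]
  simp only [map_add, map_sub intL, map_smul intL, ← pB_eq, smul_eq_mul]

/-! ### Convergence of the mollification and of the commutator -/

lemma norm_mol_moll_sub_le (n : ℕ) (f : L1) {ε : ℝ}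
    (h : ∀ z, |z| < 1 / ((n:ℝ) + 1) → ‖trL.τ z f - f‖ ≤ ε) : ‖(mol n).moll f - f‖ ≤ ε := by
  have e : (mol n).moll f - f = ∫ z, (mol n).f z • (trL.τ z f - f) := by
    simp only [smul_sub]
    rw [integral_sub ((mol n).integrable_smul_τ f) ((mol n).integrable.smul_const f), TF.moll_apply,
      integral_smul_const, integral_mol, one_smul]
  rw [e]
  refine (norm_integral_le_of_norm_le ((mol n).integrable.mul_const ε)
    (Eventually.of_forall fun z => ?_)).trans (le_of_eq ?_)
  · rw [norm_smul, Real.norm_eq_abs, abs_of_nonneg (mol_nonneg n z)]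
    by_cases hz : |z| < 1 / ((n:ℝ) + 1)
    · exact mul_le_mul_of_nonneg_left (h z hz) (mol_nonneg n z)
    · rw [mol_eq_zero' (not_lt.1 hz), zero_mul, zero_mul]
  · rw [integral_mul_const, integral_mol, one_mul]

lemma tendsto_moll (f : L1) : Tendsto (fun n => (mol n).moll f) atTop (𝓝 f) := by
  rw [Metric.tendsto_atTop]
  intro ε hε
  have hc := (trL.cont f).tendsto 0
  rw [trL.zero, Metric.tendsto_nhds_nhds] at hc
  obtain ⟨δ, hδ, H⟩ := hc (ε / 2) (by positivity)
  obtain ⟨N, hN⟩ := exists_nat_one_div_lt hδ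
  refine ⟨N, fun n hn => ?_⟩
  rw [dist_eq_norm]
  refine (norm_mol_moll_sub_le n f fun z hz => ?_).trans_lt (half_lt_self hε)
  rw [← dist_eq_norm]
  refine (H ?_).le
  rw [Real.dist_eq, sub_zero]
  exact (hz.trans_le (one_div_le_one_div_of_le (by positivity) (by gcongr))).trans hN

lemma norm_mol_moll_le (n : ℕ) (f : L1) : ‖(mol n).moll f‖ ≤ ‖f‖ := by
  refine (norm_integral_le_of_norm_le ((mol n).integrable.mul_const ‖f‖)
    (Eventually.of_forall fun z => ?_)).trans (le_of_eq ?_)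
  · rw [norm_smul, trL.norm_τ, Real.norm_eq_abs, abs_of_nonneg (mol_nonneg n z)]
  · rw [integral_mul_const, integral_mol, one_mul]

lemma integral_sub_mul_add {f g h : ℝ → ℝ} (hf : Integrable f) (hg : Integrable g) (hh : Integrable h)
    (a : ℝ) : Integrable (fun x => f x - a * g x + h x) ∧
    ∫ x, (f x - a * g x + h x) = (∫ x, f x) - a * (∫ x, g x) + ∫ x, h x := by
  have h1 : Integrable fun x => f x - a * g x := hf.sub (hg.const_mul a)
  refine ⟨h1.add hh, ?_⟩
  rw [integral_add h1 hh, integral_sub hf (hg.const_mul a), integral_const_mul]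

/-- Jensen's inequality for the mollification. -/
lemma sq_moll_le {R : ℝ} {f : L1} (hf : Integrable fun x => chi R x * f x ^ 2) (n : ℕ) {x : ℝ}
    (hx : |x| < R - 1) :
    I (-(mol n).d.moll f) x * I (-(mol n).d.moll f) x ≤ I (-(mol n).d.moll (sqc R f)) x := by
  set m := I (-(mol n).d.moll f) x with hm
  rw [TF.I_moll_d, pB_apply] at hm
  rw [TF.I_moll_d, pB_apply]
  set ρ := (mol n).shift (-x)
  have hρ0 : ∀ y, 0 ≤ ρ.b y := fun y => mol_nonneg n _
  have hρχ : ∀ y, ρ.b y * chi R y = ρ.b y := fun y => by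
    rcases le_or_gt |y| R with h | h
    · rw [chi_eq_one h, mul_one]
    · have : ρ.b y = 0 := mol_eq_zero (by
        have := abs_sub_abs_le_abs_sub y x
        rw [← sub_eq_add_neg]
        linarith)
      rw [this, zero_mul]
  have i1 : Integrable fun y => ρ.b y * f y := integrable_BC_mul _ _
  have i2 : Integrable fun y => ρ.b y * (sqc R f) y := integrable_BC_mul _ _
  have i3 : Integrable fun y => ρ.b y := ρ.integrable
  have h1 : ∫ y, ρ.b y = 1 := (TF.integral_shift _ _).trans (integral_mol n)
  have hpos : 0 ≤ ∫ y, (ρ.b y * (sqc R f) y - 2 * m * (ρ.b y * f y) + m ^ 2 * ρ.b y) := by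
    refine integral_nonneg_of_ae ?_
    filter_upwards [sqc_ae hf] with y hy
    rw [hy, ← mul_assoc, hρχ]
    have := mul_nonneg (hρ0 y) (sq_nonneg (f y - m))
    show 0 ≤ _
    linarith
  rw [(integral_sub_mul_add i2 i1 (i3.const_mul (m ^ 2)) (2 * m)).2, integral_const_mul, h1, ← hm] at hpos
  nlinarith

/-- The defect in Jensen's inequality for the mollification. -/
def defect (R : ℝ) (n : ℕ) (f : L1) : BC :=
  I (-(mol n).d.moll (sqc R f)) - I (-(mol n).d.moll f) * I (-(mol n).d.moll f)

lemma defect_nonneg {R : ℝ} {f : L1} (hf : Integrable fun x => chi R x * f x ^ 2) (n : ℕ) {x : ℝ}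
    (hx : |x| < R - 1) : 0 ≤ defect R n f x :=
  sub_nonneg.2 (sq_moll_le hf n hx)

/-- From `(ρ * f - g)² ≥ 0` one gets `-(ρ * f)² ≤ -2 g (ρ * f) + g²`. For bounded `g` the resulting
bound involves the mollifications only linearly. -/
lemma integral_defect_le {R : ℝ} {f : L1} (n : ℕ) {θ : ℝ → ℝ} (hθc : Continuous θ)
    (hθ0 : ∀ x, 0 ≤ θ x) (hθs : HasCompactSupport θ) {b : BC} (hb : ∀ x, b x = θ x)
    {g : ℝ → ℝ} (hg : Measurable g) {k : ℝ} (hgk : ∀ x, |g x| ≤ k) :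
    ∫ x, θ x * defect R n f x ≤ pB b ((mol n).moll (sqc R f)) -
      2 * (∫ x, θ x * g x * (mol n).moll f x) + ∫ x, θ x * g x ^ 2 := by
  have hθi := hθc.integrable_of_hasCompactSupport (μ := volume) hθs
  have i1 : Integrable fun x => b x * ((mol n).moll (sqc R f)) x := integrable_BC_mul _ _
  have i2 : Integrable fun x => θ x * g x * (mol n).moll f x := by
    have : Integrable fun x => g x * (b x * (mol n).moll f x) :=
      (integrable_BC_mul _ _).bdd_mul hg.aestronglyMeasurable (Eventually.of_forall hgk)
    refine this.congr (Eventually.of_forall fun x => ?_)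
    simp only [hb]; ring
  have i3 : Integrable fun x => θ x * g x ^ 2 := by
    refine hθi.mul_bdd (c := k ^ 2) (hg.pow_const 2).aestronglyMeasurable (Eventually.of_forall fun x => ?_)
    rw [norm_pow]
    exact pow_le_pow_left₀ (norm_nonneg _) (hgk x) 2
  rw [pB_apply, ← (integral_sub_mul_add i1 i2 i3 2).2]
  refine integral_mono_ae ((hθc.mul (defect R n f).continuous).integrable_of_hasCompactSupport
    hθs.mul_right) (integral_sub_mul_add i1 i2 i3 2).1 ?_
  filter_upwards [isD_ae_eq ((mol n).isD_moll f), isD_ae_eq ((mol n).isD_moll (sqc R f))] with x h1 h2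
  have e : defect R n f x = (mol n).moll (sqc R f) x - (mol n).moll f x * (mol n).moll f x := by
    rw [h1, h2]; rfl
  rw [e, hb]
  have := mul_nonneg (hθ0 x) (sq_nonneg ((mol n).moll f x - g x))
  show _ ≤ θ x * _ - 2 * _ + _
  linarith

lemma tendsto_integral_bdd_mul {f : ℕ → L1} {f' : L1} (hf : Tendsto f atTop (𝓝 f')) {s : ℝ → ℝ}
    (hs : Measurable s) {k : ℝ} (hk : ∀ x, |s x| ≤ k) :
    Tendsto (fun n => ∫ x, s x * f n x) atTop (𝓝 (∫ x, s x * f' x)) := by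
  have hi : ∀ g : L1, Integrable fun x => s x * g x := fun g =>
    (L1.integrable g).bdd_mul hs.aestronglyMeasurable (Eventually.of_forall hk)
  rw [tendsto_iff_norm_sub_tendsto_zero]
  refine squeeze_zero (fun _ => norm_nonneg _) (g := fun n => k * ‖f n - f'‖) (fun n => ?_) ?_
  · rw [← integral_sub (hi _) (hi _), L1.norm_eq, ← integral_const_mul]
    refine norm_integral_le_of_norm_le ((L1.integrable _).abs.const_mul _) ?_
    filter_upwards [Lp.coeFn_sub (f n) f'] with x hx
    rw [hx, Pi.sub_apply, ← mul_sub, norm_mul]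
    exact mul_le_mul_of_nonneg_right (hk x) (abs_nonneg _)
  · simpa using (tendsto_iff_norm_sub_tendsto_zero.1 hf).const_mul k

/-- For fixed bounded `g`, the bound of `integral_defect_le` converges to `∫ θ (f - g)²`, by `L¹`
convergence of mollifications. Truncating `f` at level `k` and letting `k` grow makes this small. -/
lemma tendsto_defect {R : ℝ} {f : L1} (hf : Integrable fun x => chi R x * f x ^ 2) {θ : ℝ → ℝ}
    (hθc : Continuous θ) (hθ0 : ∀ x, 0 ≤ θ x) (hθs : HasCompactSupport θ)
    (hθR : ∀ x, R - 1 ≤ |x| → θ x = 0) :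
    Tendsto (fun n => ∫ x, θ x * defect R n f x) atTop (𝓝 0) := by
  obtain ⟨B, hB⟩ := hθs.exists_bound_of_continuous hθc
  set b : BC := BoundedContinuousFunction.ofNormedAddCommGroup θ hθc B hB
  have hb : ∀ x, b x = θ x := fun x => rfl
  have hnn : ∀ n, 0 ≤ ∫ x, θ x * defect R n f x := fun n => integral_nonneg fun x => by
    rcases le_or_gt (R - 1) |x| with h | h
    · simp [hθR x h]
    · exact mul_nonneg (hθ0 x) (defect_nonneg hf n h)
  obtain ⟨f₀, hf₀m, hf₀⟩ := (Lp.aestronglyMeasurable f).aemeasurable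
  set g : ℕ → ℝ → ℝ := fun k x => max (-k) (min (f₀ x) k) with hg
  have hgm : ∀ k, Measurable (g k) := fun k => measurable_const.max (hf₀m.min measurable_const)
  have hgk : ∀ (k : ℕ) x, |g k x| ≤ k := fun k x => by
    have : (0:ℝ) ≤ k := Nat.cast_nonneg k
    exact abs_le.2 ⟨le_max_left _ _, max_le (by linarith) (min_le_right _ _)⟩
  have hθf : ∀ x, θ x * chi R x = θ x := fun x => by
    rcases le_or_gt (R - 1) |x| with h | h
    · rw [hθR x h, zero_mul]
    · rw [chi_eq_one (by linarith), mul_one]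
  have hi2 : Integrable fun x => θ x * f₀ x ^ 2 := by
    have : Integrable fun x => b x * (chi R x * f x ^ 2) :=
      hf.bdd_mul b.continuous.aestronglyMeasurable (Eventually.of_forall hB)
    refine this.congr ?_
    filter_upwards [hf₀] with x hx
    rw [← mul_assoc, hb, hθf, hx]
  have hle : ∀ (k : ℕ) x, ‖θ x * (f₀ x - g k x) ^ 2‖ ≤ θ x * f₀ x ^ 2 := fun k x => by
    have hk : (0:ℝ) ≤ k := Nat.cast_nonneg k
    rw [Real.norm_eq_abs, abs_of_nonneg (mul_nonneg (hθ0 x) (sq_nonneg _))]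
    refine mul_le_mul_of_nonneg_left ?_ (hθ0 x)
    rw [sq_le_sq]
    simp only [hg]
    rcases le_total (f₀ x) k with h | h
    · rw [min_eq_left h]
      rcases le_total (-(k:ℝ)) (f₀ x) with h' | h'
      · rw [max_eq_right h']; simp
      · rw [max_eq_left h', abs_of_nonpos (by linarith), abs_of_nonpos (by linarith)]; linarith
    · rw [min_eq_right h, max_eq_right (by linarith), abs_of_nonneg (by linarith),
        abs_of_nonneg (by linarith)]; linarith
  have hmeas : ∀ k : ℕ, AEStronglyMeasurable (fun x => θ x * (f₀ x - g k x) ^ 2) volume := fun k =>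
    (hθc.measurable.mul ((hf₀m.sub (hgm k)).pow_const 2)).aestronglyMeasurable
  have hk0 : Tendsto (fun k : ℕ => ∫ x, θ x * (f₀ x - g k x) ^ 2) atTop (𝓝 0) := by
    have : Tendsto (fun k : ℕ => ∫ x, θ x * (f₀ x - g k x) ^ 2) atTop (𝓝 (∫ _ : ℝ, (0:ℝ))) := by
      refine tendsto_integral_of_dominated_convergence _ hmeas hi2
        (fun k => Eventually.of_forall (hle k)) (Eventually.of_forall fun x => ?_)
      refine tendsto_const_nhds.congr' ?_
      filter_upwards [tendsto_natCast_atTop_atTop.eventually_ge_atTop |f₀ x|] with k hk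
      simp only [hg]
      rw [min_eq_left ((le_abs_self _).trans hk), max_eq_right (by linarith [neg_abs_le (f₀ x)])]
      simp
    simpa using this
  have hlim : ∀ k : ℕ, Tendsto (fun n => pB b ((mol n).moll (sqc R f)) -
      2 * (∫ x, θ x * g k x * (mol n).moll f x) + ∫ x, θ x * g k x ^ 2) atTop
      (𝓝 (∫ x, θ x * (f₀ x - g k x) ^ 2)) := fun k => by
    have e : ∫ x, θ x * (f₀ x - g k x) ^ 2 = pB b (sqc R f) - 2 * (∫ x, θ x * g k x * f x) +
        ∫ x, θ x * g k x ^ 2 := by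
      have i1 : Integrable fun x => b x * (sqc R f) x := integrable_BC_mul _ _
      have i2 : Integrable fun x => θ x * g k x * f x := by
        have : Integrable fun x => g k x * (b x * f x) :=
          (integrable_BC_mul _ _).bdd_mul (hgm k).aestronglyMeasurable (Eventually.of_forall (hgk k))
        refine this.congr (Eventually.of_forall fun x => ?_)
        simp only [hb]; ring
      have i3 : Integrable fun x => θ x * g k x ^ 2 := by
        refine (hθc.integrable_of_hasCompactSupport hθs).mul_bdd (c := (k:ℝ) ^ 2)
          ((hgm k).pow_const 2).aestronglyMeasurable (Eventually.of_forall fun x => ?_)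
        rw [norm_pow]
        exact pow_le_pow_left₀ (norm_nonneg _) (hgk k x) 2
      rw [pB_apply, ← (integral_sub_mul_add i1 i2 i3 2).2]
      refine integral_congr_ae ?_
      filter_upwards [sqc_ae hf, hf₀] with x h1 h2
      show _ = b x * _ - 2 * _ + _
      rw [h1, ← mul_assoc, hb, hθf, h2]
      ring
    rw [e]
    refine (Tendsto.sub ?_ (Tendsto.const_mul 2 ?_)).add tendsto_const_nhds
    · exact ((pB b).continuous.tendsto _).comp (tendsto_moll _)
    · refine tendsto_integral_bdd_mul (tendsto_moll f) (hθc.measurable.mul (hgm k)) (k := B * k)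
        fun x => ?_
      rw [abs_mul]
      exact mul_le_mul (hB x) (hgk k x) (abs_nonneg _) ((norm_nonneg _).trans (hB x))
  rw [Metric.tendsto_atTop]
  intro ε hε
  obtain ⟨k, hk⟩ := (hk0.eventually_lt_const hε).exists
  obtain ⟨N, hN⟩ := eventually_atTop.1 ((hlim k).eventually_lt_const hk)
  refine ⟨N, fun n hn => ?_⟩
  rw [Real.dist_eq, sub_zero, abs_of_nonneg (hnn n)]
  exact (integral_defect_le n hθc hθ0 hθs hb (hgm k) (hgk k)).trans_lt (hN n hn)

lemma abs_pB_mul_defect_le {R : ℝ} {f : L1} (hf : Integrable fun x => chi R x * f x ^ 2) (n : ℕ)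
    {ψ : TF} (hψ : ∀ x, R - 1 ≤ |x| → ψ.f x = 0) (W : BC) :
    |pB (W * defect R n f) ψ.l| ≤ ‖W‖ * ∫ x, |ψ.f x| * defect R n f x := by
  rw [TF.pB_l, ← integral_const_mul]
  have hi : Integrable fun x => |ψ.f x| * defect R n f x :=
    (ψ.smooth.continuous.abs.mul (defect R n f).continuous).integrable_of_hasCompactSupport
      (ψ.compact.comp_left abs_zero).mul_right
  rw [← Real.norm_eq_abs]
  refine norm_integral_le_of_norm_le (hi.const_mul _) (Eventually.of_forall fun x => ?_)
  · rcases le_or_gt (R - 1) |x| with h | h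
    · simp [hψ x h]
    · rw [norm_mul, BoundedContinuousFunction.coe_mul, Pi.mul_apply, norm_mul,
        Real.norm_eq_abs (defect R n f x), abs_of_nonneg (defect_nonneg hf n h), mul_assoc,
        mul_comm (|ψ.f x|), ← Real.norm_eq_abs (ψ.f x)]
      exact mul_le_mul_of_nonneg_right (W.norm_coe_le_norm x)
        (mul_nonneg (defect_nonneg hf n h) (norm_nonneg _))

/-- The choice `g = 0` gives a bound uniform in `n`, used for domination in time. -/
lemma integral_defect_le_norm {R : ℝ} {f : L1} (n : ℕ) {θ : ℝ → ℝ} (hθc : Continuous θ)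
    (hθ0 : ∀ x, 0 ≤ θ x) (hθs : HasCompactSupport θ) {B : ℝ} (hB : ∀ x, ‖θ x‖ ≤ B) :
    ∫ x, θ x * defect R n f x ≤ B * ‖sqc R f‖ := by
  have hB0 : 0 ≤ B := (norm_nonneg _).trans (hB 0)
  refine (integral_defect_le n hθc hθ0 hθs
    (b := BoundedContinuousFunction.ofNormedAddCommGroup θ hθc B hB) (fun _ => rfl)
    (g := fun _ => 0) measurable_const (k := 0) (by simp)).trans ?_
  simp only [mul_zero, zero_mul, integral_zero, sub_zero, ne_eq, OfNat.ofNat_ne_zero,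
    not_false_eq_true, zero_pow, add_zero, pB_apply]
  refine (Real.le_norm_self _).trans ?_
  refine (norm_integral_le_of_norm_le ((L1.integrable ((mol n).moll (sqc R f))).abs.const_mul B)
    (Eventually.of_forall fun x => ?_)).trans ?_
  · rw [norm_mul]
    exact mul_le_mul_of_nonneg_right (hB x) (abs_nonneg _)
  · rw [integral_const_mul, ← L1.norm_eq]
    exact mul_le_mul_of_nonneg_left (norm_mol_moll_le n _) hB0

/-! ### The Hopf–Cole transform of a weak solution -/

lemma abs_pB_le (b : BC) (f : L1) : |pB b f| ≤ ‖b‖ * ‖f‖ := by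
  rw [pB_eq]
  -- A multiplier constant in `x`, the sign of the integral, turns its absolute value into a
  -- pairing.
  refine (le_of_eq ?_).trans ((pairM_le (fun x => sg (intL (mul b f))) measurable_const
    (fun _ => abs_sg_le _) (mul b f)).trans (norm_mul_le' b f))
  rw [pairM_apply, integral_const_mul, ← intL_apply, sg_mul_self]

lemma norm_expB_le {M : ℝ} {f : L1} (hf : ‖f‖ ≤ M) : ‖expB ((1/2 : ℝ) • I f)‖ ≤ Real.exp (M / 2) := by
  refine (BoundedContinuousFunction.norm_le (Real.exp_pos _).le).2 fun x => ?_
  rw [expB_apply, Real.norm_eq_abs, abs_of_pos (Real.exp_pos _)]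
  refine Real.exp_le_exp.2 ?_
  have := (le_abs_self _).trans (abs_I_le f x)
  show 1/2 * I f x ≤ M / 2
  linarith

/-- The density of the equation for the exponential of the potential. -/
def hcd (ψ : TF) (f g : L1) : ℝ :=
  -pB ψ.d.b (hc f) + pB ψ.b (hc f) - (1/2) * pB ψ.b (mul (expB ((1/2 : ℝ) • I f)) g)

lemma continuous_hcd (ψ : TF) : Continuous fun p : L1 × L1 => hcd ψ p.1 p.2 := by
  have h1 := continuous_hc
  have h2 := continuous_expB
  have h3 : Continuous fun p : L1 × L1 => mul (expB ((1/2 : ℝ) • I p.1)) p.2 :=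
    (mul.continuous.comp (h2.comp (by fun_prop))).clm_apply continuous_snd
  unfold hcd
  fun_prop

lemma tendsto_of_continuous_uncurry {X Y Z : Type*} [TopologicalSpace X] [TopologicalSpace Y]
    [TopologicalSpace Z] {F : X → Y → Z} (h : Continuous fun p : X × Y => F p.1 p.2) {f : ℕ → X}
    {g : ℕ → Y} {x : X} {y : Y} (hf : Tendsto f atTop (𝓝 x)) (hg : Tendsto g atTop (𝓝 y)) :
    Tendsto (fun n => F (f n) (g n)) atTop (𝓝 (F x y)) :=
  (h.tendsto (x, y)).comp (hf.prodMk_nhds hg)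

lemma tendsto_hcd (ψ : TF) {f g : ℕ → L1} {x y : L1} (hf : Tendsto f atTop (𝓝 x))
    (hg : Tendsto g atTop (𝓝 y)) : Tendsto (fun n => hcd ψ (f n) (g n)) atTop (𝓝 (hcd ψ x y)) :=
  tendsto_of_continuous_uncurry (F := hcd ψ) (continuous_hcd ψ) hf hg

lemma abs_hcd_le (ψ : TF) {M B : ℝ} {f g : L1} (hf : ‖f‖ ≤ M) (hg : ‖g‖ ≤ M) (hb : ‖ψ.b‖ ≤ B)
    (hd : ‖ψ.d.b‖ ≤ B) : |hcd ψ f g| ≤ 2 * (B * (Real.exp (M / 2) * M)) := by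
  have hB : 0 ≤ B := (norm_nonneg _).trans hb
  have hM : 0 ≤ M := (norm_nonneg _).trans hf
  have hE := Real.exp_pos (M / 2)
  have hq : ‖hc f‖ ≤ Real.exp (M / 2) * M :=
    (hc_mem_Nset hf).1.trans (mul_le_mul_of_nonneg_left (by linarith) hE.le)
  have h1 : |pB ψ.d.b (hc f)| ≤ B * (Real.exp (M / 2) * M) :=
    (abs_pB_le _ _).trans (mul_le_mul hd hq (norm_nonneg _) hB)
  have h2 : |pB ψ.b (hc f)| ≤ B * (Real.exp (M / 2) * (M / 2)) :=
    (abs_pB_le _ _).trans (mul_le_mul hb (hc_mem_Nset hf).1 (norm_nonneg _) hB)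
  have h3 : |pB ψ.b (mul (expB ((1/2 : ℝ) • I f)) g)| ≤ B * (Real.exp (M / 2) * M) :=
    (abs_pB_le _ _).trans (mul_le_mul hb ((norm_mul_le' _ _).trans
      (mul_le_mul (norm_expB_le hf) hg (norm_nonneg _) hE.le)) (norm_nonneg _) hB)
  rw [hcd, abs_le]
  rw [abs_le] at h1 h2 h3
  constructor <;> linarith

lemma TF.exists_radius (ψ : TF) : ∃ R : ℝ, 1 ≤ R ∧ ∀ x, R ≤ |x| → ψ.f x = 0 := by
  obtain ⟨R, hR⟩ := ψ.compact.isCompact.isBounded.exists_norm_le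
  refine ⟨max 1 (R + 1), le_max_left _ _, fun x hx => image_eq_zero_of_notMem_tsupport fun h => ?_⟩
  have := hR x h
  rw [Real.norm_eq_abs] at this
  linarith [le_max_right 1 (R + 1)]

/-- Let `n → ∞` in `WeakSol.chain`. The defect vanishes at almost every time and is dominated by a
multiple of `‖sqc R (u r)‖`, integrable on `[s, t]` since `s > 0`. -/
theorem WeakSol.exp_potential {u : ℝ → L1} (h : WeakSol u) {C : ℝ → ℝ} (hC : ContinuousOn C (Ioi 0))
    (hpot : ∀ R, 1 ≤ R → ∀ ψ : TF, (∀ x, R ≤ |x| → ψ.f x = 0) → ∀ s t, 0 < s → s ≤ t →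
      pB (I (u t)) ψ.l - pB (I (u s)) ψ.l =
        (C t - C s) * (∫ x, ψ.f x) + ∫ r in s..t, gd R ψ (u r))
    (ψ : TF) {s t : ℝ} (hs : 0 < s) (hst : s ≤ t) :
    Real.exp (-(1/2) * C t) * pB (expB ((1/2 : ℝ) • I (u t))) ψ.l -
      Real.exp (-(1/2) * C s) * pB (expB ((1/2 : ℝ) • I (u s))) ψ.l =
    ∫ r in s..t, Real.exp (-(1/2) * C r) * hcd ψ (u r) (Kc (u r)) := by
  obtain ⟨R', hR'1, hR'⟩ := ψ.exists_radius
  set R := R' + 1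
  have hR : 1 ≤ R := by linarith
  have hψ : ∀ x, R - 1 ≤ |x| → ψ.f x = 0 := fun x hx => hR' x (by linarith)
  have hch := fun n => h.chain hC hpot hR n hψ hs hst
  have hsub : uIcc s t ⊆ Ioi 0 := by
    rw [uIcc_of_le hst]; exact fun r hr => hs.trans_le hr.1
  have hcc : ContinuousOn (fun r => Real.exp (-(1/2) * C r)) (uIcc s t) :=
    Real.continuous_exp.comp_continuousOn (continuousOn_const.mul (hC.mono hsub))
  obtain ⟨c₀, hc₀⟩ := isCompact_uIcc.exists_bound_of_continuousOn hcc
  obtain ⟨M, hM⟩ := isCompact_uIcc.exists_bound_of_continuousOn (h.cont.continuousOn (s := uIcc s t))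
  set B := max ‖ψ.b‖ ‖ψ.d.b‖
  have hlim : ∀ f, Tendsto (fun n => pB (expB ((1/2 : ℝ) • I ((mol n).moll f))) ψ.l) atTop
      (𝓝 (pB (expB ((1/2 : ℝ) • I f)) ψ.l)) := fun f => by
    have h2 := continuous_expB
    have : Continuous fun f => pB (expB ((1/2 : ℝ) • I f)) ψ.l :=
      (pB.flip ψ.l).continuous.comp (h2.comp (by fun_prop))
    exact (this.tendsto f).comp (tendsto_moll f)
  have hL := ((hlim (u t)).const_mul (Real.exp (-(1/2) * C t))).sub
    ((hlim (u s)).const_mul (Real.exp (-(1/2) * C s)))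
  refine tendsto_nhds_unique (hL.congr fun n => (hch n).2) ?_
  have hmem : ∀ r ∈ uIoc s t, r ∈ uIcc s t := fun r hr => uIoc_subset_uIcc hr
  have hae : ∀ᵐ r ∂volume, r ∈ uIoc s t → Integrable fun x => chi R x * u r x ^ 2 := by
    have := ae_restrict_of_ae_restrict_of_subset (fun r hr => hsub (hmem r hr)) (h.ae R)
    rwa [ae_restrict_iff' measurableSet_uIoc] at this
  have hsplit : ∀ n f, pB ((1/2 : ℝ) • (expB ((1/2 : ℝ) • I ((mol n).moll f)) * GB R (mol n) f)) ψ.l =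
      hcd ψ ((mol n).moll f) ((mol n).moll (Kc f)) +
        (1/4) * pB (expB ((1/2 : ℝ) • I ((mol n).moll f)) * defect R n f) ψ.l := fun n f =>
    inner_chain R (mol n) f ψ
  have hθ : HasCompactSupport fun x => |ψ.f x| := ψ.compact.comp_left abs_zero
  refine intervalIntegral.tendsto_integral_filter_of_dominated_convergence
    (bound := fun r => c₀ * (2 * (B * (Real.exp (M / 2) * M)) +
      (1/4) * (Real.exp (M / 2) * (B * ‖sqc R (u r)‖))))
    (Eventually.of_forall fun n => ?_) (Eventually.of_forall fun n => ?_) ?_ ?_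
  · exact (intervalIntegrable_iff.1 (hch n).1).1
  · filter_upwards [hae] with r hr hrm
    have hf := hr hrm
    have hMr := hM r (hmem r hrm)
    rw [hsplit, norm_mul]
    refine mul_le_mul (hc₀ r (hmem r hrm)) ?_ (norm_nonneg _) ((norm_nonneg _).trans (hc₀ r (hmem r hrm)))
    refine (norm_add_le _ _).trans (add_le_add ?_ ?_)
    · exact abs_hcd_le ψ ((norm_mol_moll_le n _).trans hMr)
        ((norm_mol_moll_le n _).trans ((norm_Kc_le _).trans hMr)) (le_max_left _ _) (le_max_right _ _)
    · rw [norm_mul, Real.norm_eq_abs, abs_of_pos (by norm_num : (0:ℝ) < 1/4)]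
      refine mul_le_mul_of_nonneg_left ?_ (by norm_num)
      refine (abs_pB_mul_defect_le hf n hψ _).trans ?_
      have h1 := integral_defect_le_norm (R := R) (f := u r) n ψ.smooth.continuous.abs
        (fun _ => abs_nonneg _) hθ (B := B)
        fun x => by rw [Real.norm_eq_abs, abs_abs]; exact (ψ.b.norm_coe_le_norm x).trans (le_max_left _ _)
      refine (mul_le_mul_of_nonneg_left h1 (norm_nonneg _)).trans ?_
      refine mul_le_mul_of_nonneg_right (norm_expB_le ((norm_mol_moll_le n _).trans hMr)) ?_
      exact mul_nonneg ((norm_nonneg _).trans (le_max_left ‖ψ.b‖ ‖ψ.d.b‖)) (norm_nonneg _)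
  · have h1 : IntervalIntegrable (fun r => ‖sqc R (u r)‖) volume s t := by
      rw [intervalIntegrable_iff_integrableOn_Icc_of_le hst]
      exact (h.sq R s t hs).norm
    exact (intervalIntegrable_const.add (((h1.const_mul _).const_mul _).const_mul _)).const_mul _
  · filter_upwards [hae] with r hr hrm
    have hf := hr hrm
    simp only [hsplit]
    refine Tendsto.const_mul _ ?_
    have h1 : Tendsto (fun n => hcd ψ ((mol n).moll (u r)) ((mol n).moll (Kc (u r)))) atTop
        (𝓝 (hcd ψ (u r) (Kc (u r)))) := tendsto_hcd ψ (tendsto_moll _) (tendsto_moll _)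
    have h2 : Tendsto (fun n => pB (expB ((1/2 : ℝ) • I ((mol n).moll (u r))) * defect R n (u r)) ψ.l)
        atTop (𝓝 0) := by
      refine squeeze_zero_norm (a := fun n => Real.exp (M / 2) * ∫ x, |ψ.f x| * defect R n (u r) x)
        (fun n => ?_) ?_
      · refine (abs_pB_mul_defect_le hf n hψ _).trans (mul_le_mul_of_nonneg_right
          (norm_expB_le ((norm_mol_moll_le n _).trans (hM r (hmem r hrm)))) (integral_nonneg fun x => ?_))
        rcases le_or_gt (R - 1) |x| with hx | hx
        · show (0 : ℝ) ≤ |ψ.f x| * defect R n (u r) x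
          rw [hψ x hx, abs_zero, zero_mul]
        · exact mul_nonneg (abs_nonneg _) (defect_nonneg hf n hx)
      · have := tendsto_defect hf ψ.smooth.continuous.abs (fun _ => abs_nonneg _) hθ
          (fun x hx => by rw [hψ x hx, abs_zero])
        have := this.const_mul (Real.exp (M / 2))
        rwa [mul_zero] at this
    have := h1.add (h2.const_mul (1/4))
    rwa [mul_zero, add_zero] at this

/-! ### Normalization of the Hopf–Cole transform at minus infinity -/

lemma TF.tendsto_shift (ψ : TF) (f : L1) : Tendsto (fun k : ℕ => pB (ψ.shift k).b f) atTop (𝓝 0) := by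
  obtain ⟨R, -, hR⟩ := ψ.exists_radius
  have h0 : (0 : ℝ) = ∫ _x : ℝ, (0:ℝ) := integral_zero _ _ |>.symm
  rw [h0]
  simp only [pB_apply]
  refine tendsto_integral_of_dominated_convergence (fun x => ‖ψ.b‖ * ‖f x‖) (fun k => ?_)
    ((L1.integrable f).norm.const_mul _) (fun k => Eventually.of_forall fun x => ?_)
    (Eventually.of_forall fun x => ?_)
  · exact (ψ.shift k).b.continuous.aestronglyMeasurable.mul (L1.integrable f).aestronglyMeasurable
  · rw [norm_mul]
    exact mul_le_mul_of_nonneg_right (ψ.b.norm_coe_le_norm (x + k)) (norm_nonneg _)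
  · refine tendsto_const_nhds.congr' ?_
    filter_upwards [tendsto_natCast_atTop_atTop.eventually_ge_atTop (R - x)] with k hk
    show (0:ℝ) = ψ.f (x + k) * f x
    rw [hR (x + k) ((by linarith : R ≤ x + k).trans (le_abs_self _)), zero_mul]

/-- Shifting by `k` moves the test function towards `-∞`, where the potential vanishes and its
exponential tends to `1`. -/
lemma TF.tendsto_shift_l (ψ : TF) (f : L1) :
    Tendsto (fun k : ℕ => pB (expB ((1/2 : ℝ) • I f)) (ψ.shift k).l) atTop (𝓝 (∫ x, ψ.f x)) := by
  have h0 : ∀ k : ℕ, pB (expB ((1/2 : ℝ) • I f)) (ψ.shift k).l =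
      ∫ x, expB ((1/2 : ℝ) • I f) (x - k) * ψ.f x := fun k => by
    rw [TF.pB_l, ← integral_add_right_eq_self (μ := volume)
      (fun x => expB ((1/2 : ℝ) • I f) (x - k) * ψ.f x) (k : ℝ)]
    refine integral_congr_ae (Eventually.of_forall fun x => ?_)
    show expB ((1/2 : ℝ) • I f) x * ψ.f (x + k) = expB ((1/2 : ℝ) • I f) (x + k - k) * ψ.f (x + k)
    rw [add_sub_cancel_right]
  simp only [h0]
  refine tendsto_integral_of_dominated_convergence (fun x => ‖expB ((1/2 : ℝ) • I f)‖ * ‖ψ.f x‖)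
    (fun k => ?_) (ψ.integrable.norm.const_mul _) (fun k => Eventually.of_forall fun x => ?_)
    (Eventually.of_forall fun x => ?_)
  · exact (((expB ((1/2 : ℝ) • I f)).continuous.comp (continuous_id.sub continuous_const)).mul
      ψ.smooth.continuous).aestronglyMeasurable
  · rw [norm_mul]
    exact mul_le_mul_of_nonneg_right (BoundedContinuousFunction.norm_coe_le_norm _ _) (norm_nonneg _)
  · have h1 : Tendsto (fun k : ℕ => x - (k : ℝ)) atTop atBot :=
      tendsto_atBot_add_const_left _ x (tendsto_neg_atTop_atBot.comp tendsto_natCast_atTop_atTop)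
    have h2 : Tendsto (fun k : ℕ => Real.exp (1/2 * I f (x - k))) atTop (𝓝 (Real.exp (1/2 * 0))) :=
      (Real.continuous_exp.tendsto _).comp (((tendsto_I_atBot f).comp h1).const_mul (1/2))
    rw [mul_zero, Real.exp_zero] at h2
    have h3 := h2.mul_const (ψ.f x)
    rw [one_mul] at h3
    exact h3.congr fun k => by rw [expB_apply]; rfl

lemma TF.tendsto_shift_hcd (ψ : TF) (f g : L1) :
    Tendsto (fun k : ℕ => hcd (ψ.shift k) f g) atTop (𝓝 0) := by
  have h1 : Tendsto (fun k : ℕ => pB (ψ.shift k).d.b (hc f)) atTop (𝓝 0) :=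
    (ψ.d.tendsto_shift (hc f)).congr fun k => by rw [TF.shift_d, TF.shift_b]
  have := (h1.neg.add (ψ.tendsto_shift (hc f))).sub
    ((ψ.tendsto_shift (mul (expB ((1/2 : ℝ) • I f)) g)).const_mul (1/2))
  rw [mul_zero, neg_zero, add_zero, sub_zero] at this
  exact this

lemma continuous_of_uncurry {X Y Z W : Type*} [TopologicalSpace X] [TopologicalSpace Y]
    [TopologicalSpace Z] [TopologicalSpace W] {F : X → Y → Z}
    (h : Continuous fun p : X × Y => F p.1 p.2) {f : W → X} {g : W → Y} (hf : Continuous f)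
    (hg : Continuous g) : Continuous fun w => F (f w) (g w) :=
  h.comp (hf.prodMk hg)

lemma norm_trB_le (y : ℝ) (b : BC) : ‖trB y b‖ ≤ ‖b‖ :=
  (BoundedContinuousFunction.norm_le (norm_nonneg b)).2 fun x => by
    rw [trB_apply]; exact b.norm_coe_le_norm _

lemma WeakSol.continuous_hcd {u : ℝ → L1} (h : WeakSol u) (ψ : TF) :
    Continuous fun r => hcd ψ (u r) (Kc (u r)) :=
  continuous_of_uncurry (F := hcd ψ) (AugmentedBurgers.continuous_hcd ψ) h.cont
    (Kc.continuous.comp h.cont)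

/-- With test functions of mass one moving to `-∞`, the right side of `hexp` vanishes and the left
side tends to `exp (-C t / 2) - exp (-C s / 2)`. -/
lemma WeakSol.potential_const {u : ℝ → L1} (h : WeakSol u) {C : ℝ → ℝ} (hC : ContinuousOn C (Ioi 0))
    (hexp : ∀ (ψ : TF) (s t : ℝ), 0 < s → s ≤ t →
      Real.exp (-(1/2) * C t) * pB (expB ((1/2 : ℝ) • I (u t))) ψ.l -
        Real.exp (-(1/2) * C s) * pB (expB ((1/2 : ℝ) • I (u s))) ψ.l =
      ∫ r in s..t, Real.exp (-(1/2) * C r) * hcd ψ (u r) (Kc (u r)))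
    {s t : ℝ} (hs : 0 < s) (hst : s ≤ t) : C t = C s := by
  have hcont := h.continuous_hcd
  have h1 := (((mol 0).tendsto_shift_l (u t)).const_mul (Real.exp (-(1/2) * C t))).sub
    (((mol 0).tendsto_shift_l (u s)).const_mul (Real.exp (-(1/2) * C s)))
  have h2 : Tendsto (fun k : ℕ => ∫ r in s..t, Real.exp (-(1/2) * C r) *
      hcd ((mol 0).shift k) (u r) (Kc (u r))) atTop (𝓝 (∫ _r in s..t, (0:ℝ))) := by
    have hsub : uIcc s t ⊆ Ioi 0 := by
      rw [uIcc_of_le hst]; exact fun r hr => hs.trans_le hr.1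
    have hcc : ContinuousOn (fun r => Real.exp (-(1/2) * C r)) (uIcc s t) :=
      Real.continuous_exp.comp_continuousOn (continuousOn_const.mul (hC.mono hsub))
    obtain ⟨c₀, hc₀⟩ := isCompact_uIcc.exists_bound_of_continuousOn hcc
    obtain ⟨M, hM⟩ := isCompact_uIcc.exists_bound_of_continuousOn (h.cont.continuousOn (s := uIcc s t))
    set B := max ‖(mol 0).b‖ ‖(mol 0).d.b‖
    refine intervalIntegral.tendsto_integral_filter_of_dominated_convergence
      (bound := fun _ => c₀ * (2 * (B * (Real.exp (M / 2) * M))))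
      (Eventually.of_forall fun k => ?_) (Eventually.of_forall fun k => ?_)
      intervalIntegrable_const ?_
    · exact (ContinuousOn.mono (hcc.mul (hcont _).continuousOn)
        uIoc_subset_uIcc).aestronglyMeasurable measurableSet_uIoc
    · refine Eventually.of_forall fun r hr => ?_
      have hr' := uIoc_subset_uIcc hr
      rw [norm_mul]
      refine mul_le_mul (hc₀ r hr') (abs_hcd_le _ (hM r hr') ((norm_Kc_le _).trans (hM r hr')) ?_ ?_)
        (norm_nonneg _) ((norm_nonneg _).trans (hc₀ r hr'))
      · rw [TF.shift_b]
        exact (norm_trB_le _ _).trans (le_max_left _ _)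
      · rw [TF.shift_d]
        exact (norm_trB_le _ _).trans (le_max_right _ _)
    · refine Eventually.of_forall fun r _ => ?_
      have := ((mol 0).tendsto_shift_hcd (u r) (Kc (u r))).const_mul (Real.exp (-(1/2) * C r))
      rwa [mul_zero] at this
  have h3 := tendsto_nhds_unique (h1.congr fun k => hexp _ s t hs hst) h2
  rw [intervalIntegral.integral_zero, integral_mol, mul_one, mul_one, sub_eq_zero] at h3
  linarith [Real.exp_injective h3]

/-- With `C` constant the factors cancel. The square has disappeared from the density, which is now
continuous in `u` for the `L¹` norm, so the initial time is reached by a limit. -/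
theorem WeakSol.exp_identity {u : ℝ → L1} (h : WeakSol u) (ψ : TF) {s t : ℝ} (hs : 0 ≤ s) (hst : s ≤ t) :
    pB (expB ((1/2 : ℝ) • I (u t))) ψ.l - pB (expB ((1/2 : ℝ) • I (u s))) ψ.l =
      ∫ r in s..t, hcd ψ (u r) (Kc (u r)) := by
  obtain ⟨C, hC, hpot⟩ := h.potential
  have hexp := fun (ψ : TF) (s t : ℝ) => h.exp_potential hC hpot ψ (s := s) (t := t)
  have hcont := h.continuous_hcd
  have hconst := fun s t => h.potential_const hC hexp (s := s) (t := t)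
  have hpos : ∀ s t, 0 < s → s ≤ t →
      pB (expB ((1/2 : ℝ) • I (u t))) ψ.l - pB (expB ((1/2 : ℝ) • I (u s))) ψ.l =
        ∫ r in s..t, hcd ψ (u r) (Kc (u r)) := fun s t hs hst => by
    have h1 := hexp ψ s t hs hst
    have h2 : ∫ r in s..t, Real.exp (-(1/2) * C r) * hcd ψ (u r) (Kc (u r)) =
        Real.exp (-(1/2) * C s) * ∫ r in s..t, hcd ψ (u r) (Kc (u r)) := by
      rw [← intervalIntegral.integral_const_mul]
      refine intervalIntegral.integral_congr fun r hr => ?_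
      rw [uIcc_of_le hst] at hr
      show _ * _ = _ * _
      rw [hconst s r hs hr.1]
    rw [h2, hconst s t hs hst, ← mul_sub] at h1
    exact mul_left_cancel₀ (Real.exp_pos _).ne' h1
  rcases hs.eq_or_lt with rfl | hs'
  · rcases hst.eq_or_lt with rfl | ht
    · rw [sub_self, intervalIntegral.integral_same]
    have h2 := continuous_expB
    have hw : Continuous fun r => pB (expB ((1/2 : ℝ) • I (u r))) ψ.l := by
      have : Continuous fun f => pB (expB ((1/2 : ℝ) • I f)) ψ.l :=
        (pB.flip ψ.l).continuous.comp (h2.comp ((1/2 : ℝ) • I).continuous)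
      exact this.comp h.cont
    have hii : ∀ a b : ℝ, IntervalIntegrable (fun r => hcd ψ (u r) (Kc (u r))) volume a b :=
      fun a b => (hcont ψ).intervalIntegrable a b
    have hi : Continuous fun s : ℝ => ∫ r in s..t, hcd ψ (u r) (Kc (u r)) := by
      simp only [intervalIntegral.integral_symm t]
      exact (intervalIntegral.continuous_primitive hii t).neg
    have hl : Tendsto (fun s => pB (expB ((1/2 : ℝ) • I (u t))) ψ.l - pB (expB ((1/2 : ℝ) • I (u s))) ψ.l)
        (𝓝[>] (0:ℝ)) (𝓝 (pB (expB ((1/2 : ℝ) • I (u t))) ψ.l - pB (expB ((1/2 : ℝ) • I (u 0))) ψ.l)) :=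
      ((hw.tendsto 0).const_sub (pB (expB ((1/2 : ℝ) • I (u t))) ψ.l)).mono_left nhdsWithin_le_nhds
    refine tendsto_nhds_unique hl (((hi.tendsto 0).mono_left nhdsWithin_le_nhds).congr' ?_)
    filter_upwards [Ioc_mem_nhdsGT ht] with s hs
    exact (hpos s t hs.1 hs.2).symm
  · exact hpos s t hs' hst

/-! ### Weak solutions are mild after the Hopf–Cole transformation -/

lemma continuous_nonlin_hc : Continuous fun f => nonlin (hc f) :=
  contDiffOn_nonlin.continuousOn.comp_continuous continuous_hc hc_mem

/-- With `w = exp (I f / 2)` and `r = f / 2`, this tests `N = -(w (K * r))_x`; it holds on the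
domain of `D` by parts, and in general by density. -/
lemma pB_nonlin_hc (ψ : TF) (f : L1) :
    (1/2) * pB ψ.d.b (mul (expB ((1/2 : ℝ) • I f)) (Kc f)) = pB ψ.b (nonlin (hc f)) := by
  obtain ⟨v, v', hv, hlim⟩ := dense_isD f
  have key : ∀ n, (1/2) * pB ψ.d.b (mul (expB ((1/2 : ℝ) • I (v n))) (Kc (v n))) =
      pB ψ.b (nonlin (hc (v n))) := fun n => by
    have h1 : IsD trB ((1/2 : ℝ) • I (v n)) ((1/2 : ℝ) • I (v' n)) := by
      have := (isD_I (hv n)).const_smul (1/2 : ℝ)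
      exact this.congr_of_eventuallyEq (Eventually.of_forall fun y => (trB y).map_smul _ _)
    have h2 : IsD trL.τ ((1/2 : ℝ) • v n) ((1/2 : ℝ) • v' n) := by
      have := HasDerivAt.const_smul (1/2 : ℝ) (hv n)
      exact this.congr_of_eventuallyEq (Eventually.of_forall fun y => (trL.τ y).map_smul _ _)
    have h3 := isD_neg_nonlin (hc_mem (v n)) (isD_mul (isD_expB h1) h2)
    have hr : rL (hc (v n)) = (1/2 : ℝ) • v n := by
      have := two_rL_hc (v n)
      rw [← this, smul_smul, this]; norm_num
    rw [wB_hc, hr] at h3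
    have h4 := ψ.pB_d h3
    rw [map_neg, neg_inj, map_smul, map_smul, map_smul, smul_eq_mul] at h4
    exact h4.symm
  have c1 : Tendsto (fun n => pB ψ.b (nonlin (hc (v n)))) atTop (𝓝 (pB ψ.b (nonlin (hc f)))) :=
    ((pB ψ.b).continuous.tendsto _).comp ((continuous_nonlin_hc.tendsto f).comp hlim)
  have h2 := continuous_expB
  have c3 : Continuous fun g : L1 => expB ((1/2 : ℝ) • I g) := h2.comp ((1/2 : ℝ) • I).continuous
  have c4 : Continuous fun p : BC × L1 => pB ψ.d.b (mul p.1 p.2) :=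
    (pB ψ.d.b).continuous.comp mul.isBoundedBilinearMap.continuous
  have c2 : Continuous fun g : L1 => pB ψ.d.b (mul (expB ((1/2 : ℝ) • I g)) (Kc g)) :=
    continuous_of_uncurry (F := fun b g => pB ψ.d.b (mul b g)) c4 c3 Kc.continuous
  exact tendsto_nhds_unique ((((c2.tendsto f).comp hlim).const_mul (1/2)).congr key) c1

/-- Testing the equation for `w` with `ψ'` gives the equation for `q = w_x`; the constant in `w = 1
+ I q` cancels between the two times. -/
theorem WeakSol.hc_identity {u : ℝ → L1} (h : WeakSol u) (ψ : TF) {s t : ℝ} (hs : 0 ≤ s) (hst : s ≤ t) :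
    pB ψ.b (hc (u t) - hc (u s) - ∫ r in s..t, nonlin (hc (u r))) =
      pB (ψ.d.d.b - ψ.d.b) (∫ r in s..t, hc (u r)) := by
  have hq : Continuous fun r => hc (u r) := continuous_hc.comp h.cont
  have hN : Continuous fun r => nonlin (hc (u r)) := continuous_nonlin_hc.comp h.cont
  have h1 := h.exp_identity ψ.d hs hst
  have hw : ∀ f, pB (expB ((1/2 : ℝ) • I f)) ψ.d.l = pB 1 ψ.d.l - pB ψ.b (hc f) := fun f => by
    rw [← wB_hc, wB, map_add, add_apply, TF.pB_I_d, sub_eq_add_neg]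
  have hd : ∀ f, hcd ψ.d f (Kc f) = -(pB (ψ.d.d.b - ψ.d.b) (hc f) + pB ψ.b (nonlin (hc f))) := fun f => by
    rw [hcd, pB_nonlin_hc, map_sub, sub_apply]; ring
  simp only [hw, hd] at h1
  have c1 : Continuous fun r => pB (ψ.d.d.b - ψ.d.b) (hc (u r)) := (pB _).continuous.comp hq
  have c2 : Continuous fun r => pB ψ.b (nonlin (hc (u r))) := (pB _).continuous.comp hN
  rw [intervalIntegral.integral_neg, intervalIntegral.integral_add (c1.intervalIntegrable _ _)
    (c2.intervalIntegrable _ _),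
    ContinuousLinearMap.intervalIntegral_comp_comm _ (hq.intervalIntegrable _ _),
    ContinuousLinearMap.intervalIntegral_comp_comm _ (hN.intervalIntegrable _ _)] at h1
  rw [map_sub, map_sub]
  linarith

lemma TF.pB_shift_neg (ψ : TF) (y : ℝ) (f : L1) : pB (ψ.shift (-y)).b f = pB ψ.b (trL.τ y f) := by
  rw [TF.shift_b, ← pB_τ y]
  congr 2
  ext x
  rw [trB_apply, trB_apply, add_neg_cancel_right]

lemma TF.pB_heat (ψ : TF) (ε : ℝ) (f : L1) :
    pB ψ.b (trL.heat ε f) = ∫ z, pB (ψ.shift (-(ε + √(2 * ε) * z))).b f ∂stdGauss := by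
  have hi : Integrable (fun z => trL.τ (ε + √(2 * ε) * z) f) stdGauss := by
    simpa only [one_smul] using
      trL.integrable_avg (k := fun _ => 1) (integrable_const _) ε (√(2 * ε)) f
  rw [TransGroup.heat_apply, ← ContinuousLinearMap.integral_comp_comm _ hi]
  refine integral_congr_ae (Eventually.of_forall fun z => ?_)
  exact (ψ.pB_shift_neg _ f).symm

lemma TF.integrable_pB_shift (ψ : TF) (a b : ℝ) (f : L1) :
    Integrable (fun z => pB (ψ.shift (-(a + b * z))).b f) stdGauss := by
  have hc : Continuous fun z => pB ψ.b (trL.τ (a + b * z) f) :=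
    (pB ψ.b).continuous.comp ((trL.cont f).comp (by fun_prop))
  simp only [TF.pB_shift_neg]
  refine (integrable_const (‖ψ.b‖ * ‖f‖)).mono' hc.aestronglyMeasurable (Eventually.of_forall fun z => ?_)
  rw [Real.norm_eq_abs]
  exact (abs_pB_le _ _).trans (mul_le_mul_of_nonneg_left (trL.norm_le _ _) (norm_nonneg _))

/-- The operator `D² + D` after smoothing. -/
def heatGen (ε : ℝ) : L1 →L[ℝ] L1 :=
  (trL.dheat (ε / 2)).comp (trL.dheat (ε / 2)) + trL.dheat ε

lemma isD_dheat {ε : ℝ} (hε : 0 < ε) (f : L1) :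
    IsD trL.τ (trL.dheat ε f) (trL.dheat (ε / 2) (trL.dheat (ε / 2) f)) := by
  have h2 := half_pos hε
  have h := trL.isD_heat_of_isD (ε / 2) (trL.isD_heat h2 f)
  rw [← trL.heat_add _ _ h2.le h2.le, add_halves] at h
  rw [TransGroup.isD_unique (trL.isD_heat hε f) h]
  exact trL.isD_heat h2 _

/-- A weak solution of the resolvent type equation `z = D² Q + D Q` is a classical one after
smoothing. -/
lemma heat_eq_heatGen {z Q : L1} (h : ∀ ψ : TF, pB ψ.b z = pB (ψ.d.d.b - ψ.d.b) Q) {ε : ℝ}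
    (hε : 0 < ε) : trL.heat ε z = heatGen ε Q := by
  rw [← sub_eq_zero]
  refine eq_zero_of_pB fun ψ => ?_
  have h1 : pB ψ.b (trL.heat ε z) = pB (ψ.d.d.b - ψ.d.b) (trL.heat ε Q) := by
    rw [map_sub, sub_apply, TF.pB_heat, TF.pB_heat, TF.pB_heat,
      ← integral_sub (ψ.d.d.integrable_pB_shift _ _ Q) (ψ.d.integrable_pB_shift _ _ Q)]
    refine integral_congr_ae (Eventually.of_forall fun y => ?_)
    show pB _ z = pB _ Q - pB _ Q
    rw [h, map_sub, sub_apply, TF.shift_d, ← TF.shift_b]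
    congr 3
    rw [show (ψ.shift (-(ε + √(2 * ε) * y))).d = ψ.d.shift (-(ε + √(2 * ε) * y)) from
      TF.ext' (congrArg DFunLike.coe (TF.shift_d ψ _)), TF.shift_d, TF.shift_b]

  have h2 : pB (ψ.d.d.b - ψ.d.b) (trL.heat ε Q) = pB ψ.b (heatGen ε Q) := by
    rw [heatGen, add_apply, map_add, ContinuousLinearMap.comp_apply,
      ψ.pB_d (isD_dheat hε Q), ψ.d.pB_d (trL.isD_heat hε Q), ψ.pB_d (trL.isD_heat hε Q),
      map_sub, sub_apply]
    ring
  rw [map_sub, h1, h2, sub_self]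

/-- Product rule for a strongly differentiable family of contractions. -/
lemma hasDerivAt_clm_apply_strong {E : Type*} [NormedAddCommGroup E] [NormedSpace ℝ E]
    {T : ℝ → E →L[ℝ] E} {v : ℝ → E} {a v' : E} {s : ℝ} (hb : ∀ r f, ‖T r f‖ ≤ ‖f‖)
    (hT : HasDerivAt (fun r => T r (v s)) a s) (hc : ContinuousAt (fun r => T r v') s)
    (hv : HasDerivAt v v' s) : HasDerivAt (fun r => T r (v r)) (a + T s v') s := by
  rw [hasDerivAt_iff_isLittleO] at hT hv ⊢
  have h1 : (fun r => T r (v r - v s - (r - s) • v')) =o[𝓝 s] fun r => r - s :=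
    (Asymptotics.IsBigO.of_bound 1 (Eventually.of_forall fun r => by
      rw [one_mul]; exact hb r _)).trans_isLittleO hv
  have h2 : (fun r => (r - s) • (T r v' - T s v')) =o[𝓝 s] fun r => r - s := by
    have hz : (fun r => T r v' - T s v') =o[𝓝 s] fun _ => (1 : ℝ) := by
      rw [Asymptotics.isLittleO_one_iff]
      have := hc.tendsto.sub_const (T s v')
      rwa [sub_self] at this
    have := (Asymptotics.isBigO_refl (fun r : ℝ => r - s) (𝓝 s)).smul_isLittleO hz
    simpa only [smul_eq_mul, mul_one] using this
  refine ((hT.add h1).add h2).congr_left fun r => ?_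
  rw [map_sub, map_sub, map_smul, smul_sub, smul_add]
  abel

/-- So far `q` solves its equation only against test functions. After applying `heat ε` it is
differentiable in time with values in the domain of `D²`, and `s ↦ heat (t - s) (heat ε (q s))` has
derivative `heat ε (heat (t - s) (N s))`. Integrate over `[0, t]` and let `ε → 0`. -/
theorem WeakSol.mildSol {u : ℝ → L1} (h : WeakSol u) (T : ℝ) : MildSol T fun t => hc (u t) := by
  set q : ℝ → L1 := fun t => hc (u t)
  set N : ℝ → L1 := fun t => nonlin (hc (u t))
  have hq : Continuous q := continuous_hc.comp h.cont
  have hN : Continuous N := continuous_nonlin_hc.comp h.cont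
  refine ⟨hq.continuousOn, fun t _ => hc_mem _, fun t ht => ?_⟩
  have ht0 := ht.1
  rw [sub_zero]
  have hh : Continuous fun s => trL.heat (t - s) (N s) :=
    trL.continuous_heat.comp (f := fun s => (t - s, N s)) (by fun_prop)
  have hcz : ∀ f, Continuous fun s => trL.heat s f := fun f =>
    trL.continuous_heat.comp (f := fun s => (s, f)) (by fun_prop)
  have key : ∀ ε : ℝ, 0 < ε →
      trL.heat ε (q t - (trL.heat t (q 0) + ∫ s in (0:ℝ)..t, trL.heat (t - s) (N s))) = 0 := by
    intro ε hε
    set g : ℝ → L1 := fun r => heatGen ε (q r) + trL.heat ε (N r)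
    have hg : Continuous g := ((heatGen ε).continuous.comp hq).add ((trL.heat ε).continuous.comp hN)
    have hqε : ∀ s, 0 ≤ s → trL.heat ε (q s) = trL.heat ε (q 0) + ∫ r in (0:ℝ)..s, g r := fun s hs => by
      have h1 := heat_eq_heatGen (fun ψ => h.hc_identity ψ le_rfl hs) hε
      rw [map_sub, map_sub, sub_eq_iff_eq_add, sub_eq_iff_eq_add] at h1
      have e := intervalIntegral.integral_add (μ := volume) (a := 0) (b := s)
        (f := fun r => heatGen ε (q r)) (g := fun r => trL.heat ε (N r))
        (((heatGen ε).continuous.comp hq).intervalIntegrable _ _)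
        (((trL.heat ε).continuous.comp hN).intervalIntegrable _ _)
      rw [ContinuousLinearMap.intervalIntegral_comp_comm _ (hq.intervalIntegrable _ _),
        ContinuousLinearMap.intervalIntegral_comp_comm _ (hN.intervalIntegrable _ _)] at e
      exact h1.trans ((add_comm _ _).trans (congrArg (trL.heat ε (q 0) + ·) e.symm))
    have hder : ∀ s, 0 < s → HasDerivAt (fun s => trL.heat ε (q s)) (g s) s := fun s hs => by
      have := (intervalIntegral.integral_hasDerivAt_right (hg.intervalIntegrable 0 s)
        (hg.stronglyMeasurableAtFilter _ _) hg.continuousAt).const_add (trL.heat ε (q 0))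
      refine this.congr_of_eventuallyEq ?_
      filter_upwards [Ioi_mem_nhds hs] with r hr using hqε r (le_of_lt hr)
    have hφ : ∀ s ∈ Ioo 0 t, HasDerivAt (fun s => trL.heat (t - s) (trL.heat ε (q s)))
        (trL.heat ε (trL.heat (t - s) (N s))) s := fun s hs => by
      have hp : 0 < t - s := sub_pos.2 hs.2
      have h1 := (trL.hasDerivAt_heat hp (trL.isD_heat hε (q s)) (isD_dheat hε (q s))).scomp s
        ((hasDerivAt_id s).const_sub t)
      have h2 := hasDerivAt_clm_apply_strong (T := fun r => trL.heat (t - r))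
        (v := fun s => trL.heat ε (q s)) (fun r f => trL.norm_heat_le _ f) h1
        ((hcz (g s)).comp (continuous_const.sub continuous_id)).continuousAt (hder s hs.1)
      have he : (-1 : ℝ) • trL.heat (t - s) (heatGen ε (q s)) + trL.heat (t - s) (g s) =
          trL.heat ε (trL.heat (t - s) (N s)) := by
        rw [← trL.heat_add _ _ hε.le hp.le, add_comm ε, trL.heat_add _ _ hp.le hε.le, map_add,
          neg_one_smul, neg_add_cancel_left]
      exact he ▸ h2
    have hφc : ContinuousOn (fun s => trL.heat (t - s) (trL.heat ε (q s))) (Icc 0 t) :=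
      (trL.continuous_heat.comp (f := fun s => (t - s, trL.heat ε (q s))) (by fun_prop)).continuousOn
    have := intervalIntegral.integral_eq_sub_of_hasDerivAt_of_le ht0 hφc hφ
      (((trL.heat ε).continuous.comp hh).intervalIntegrable _ _)
    rw [ContinuousLinearMap.intervalIntegral_comp_comm _ (hh.intervalIntegrable _ _), sub_self,
      sub_zero, trL.heat_zero, ← trL.heat_add _ _ ht0 hε.le, add_comm t, trL.heat_add _ _ hε.le ht0] at this
    rw [map_sub, map_add, this]
    abel
  have hl := ((hcz (q t - (trL.heat t (q 0) + ∫ s in (0:ℝ)..t, trL.heat (t - s) (N s)))).tendsto 0).mono_left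
    (nhdsWithin_le_nhds (s := Ioi 0))
  rw [trL.heat_zero] at hl
  have h0 : Tendsto (fun _ : ℝ => (0 : L1)) (𝓝[>] 0) (𝓝 0) := tendsto_const_nhds
  refine sub_eq_zero.1 (tendsto_nhds_unique hl (h0.congr' ?_))
  filter_upwards [self_mem_nhdsWithin] with ε hε using (key ε hε).symm

/-! ### Uniqueness, time shifts and the theorem -/

/-- Distributional solutions are unique. -/
theorem IsSolution.unique {u₀ : L1} {u v : ℝ≥0 → L1} (hu : IsSolution u₀ u) (hv : IsSolution u₀ v) :
    u = v := by
  funext t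
  have h : hc (u (t : ℝ).toNNReal) = hc (v (t : ℝ).toNNReal) :=
    (hu.weakSol.mildSol t).unique (hv.weakSol.mildSol t)
      (by simp only [Real.toNNReal_zero, hu.initial, hv.initial]) ⟨t.2, le_rfl⟩
  rw [Real.toNNReal_coe] at h
  rw [← two_rL_hc (u t), h, two_rL_hc]

lemma GlobalSol.shift {u u1 u2 u3 : ℝ → L1} (h : GlobalSol u u1 u2 u3) {a : ℝ} (ha : 0 ≤ a) :
    GlobalSol (fun t => u (t + a)) (fun t => u1 (t + a)) (fun t => u2 (t + a)) fun t => u3 (t + a) := by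
  have hc : ∀ s : Set ℝ, ContinuousOn (fun t : ℝ => t + a) s := fun s => by fun_prop
  have hm : MapsTo (fun t : ℝ => t + a) (Ioi 0) (Ioi 0) := fun t ht => add_pos_of_pos_of_nonneg ht ha
  have hd : ∀ {f f' : ℝ → L1}, DCurve trL.τ (Ioi 0) f f' →
      DCurve trL.τ (Ioi 0) (fun t => f (t + a)) fun t => f' (t + a) := fun hf =>
    ⟨hf.cont.comp (hc _) hm, hf.cont'.comp (hc _) hm, fun t ht => hf.isD _ (hm ht)⟩
  exact ⟨h.cont.comp (hc _) fun t ht => add_nonneg ht ha, hd h.d1, hd h.d2, hd h.d3,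
    fun t ht => (h.time _ (hm ht)).comp_add_const t a⟩

end AugmentedBurgers

end

theorem theorem2p1 :
    (∀ u₀ : AugmentedBurgers.L1, ∃! u : ℝ≥0 → AugmentedBurgers.L1,
      AugmentedBurgers.IsSolution u₀ u) ∧
    (∀ (u₀ : AugmentedBurgers.L1) (u : ℝ≥0 → AugmentedBurgers.L1),
      AugmentedBurgers.IsSolution u₀ u →
        ∀ (p : ℝ≥0∞) [Fact (1 ≤ p)], 1 < p → p < ⊤ →
          AugmentedBurgers.IsContinuousIntoW2 u p ∧ AugmentedBurgers.IsC1IntoLp u p) ∧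
    (∃ S : ℝ≥0 → AugmentedBurgers.L1 → AugmentedBurgers.L1,
      AugmentedBurgers.IsContractionSemigroup S ∧
        ∀ u₀ : AugmentedBurgers.L1, AugmentedBurgers.IsSolution u₀ (fun t => S t u₀)) := by
  refine ⟨fun u₀ => ?_, fun u₀ u hu p _ _ hp => ?_, ?_⟩
  · obtain ⟨u, u1, u2, u3, h, h0⟩ := AugmentedBurgers.exists_globalSol u₀
    exact ⟨fun t => u t, h0 ▸ h.isSolution, fun v hv => hv.unique (h0 ▸ h.isSolution)⟩
  · obtain ⟨v, v1, v2, v3, h, h0⟩ := AugmentedBurgers.exists_globalSol u₀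
    rw [hu.unique (h0 ▸ h.isSolution : AugmentedBurgers.IsSolution u₀ fun t : ℝ≥0 => v t)]
    exact ⟨h.isContinuousIntoW2 p hp.ne, h.isC1IntoLp p hp.ne⟩
  · choose u u1 u2 u3 h h0 using AugmentedBurgers.exists_globalSol
    have hs : ∀ f, AugmentedBurgers.IsSolution f fun t : ℝ≥0 => u f t := fun f => by
      have := (h f).isSolution
      rwa [h0 f] at this
    refine ⟨fun t f => u f t, ⟨h0, fun s t f => ?_, fun f => (hs f).continuous, fun t f g => ?_⟩, hs⟩
    · have h1 : ‖u f ((s : ℝ) + t) - u (u f t) s‖ ≤ ‖u f t - u f t‖ := by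
        have := ((h f).shift t.coe_nonneg).contraction (h (u f t)) s.coe_nonneg
        rwa [zero_add, h0] at this
      rw [sub_self, norm_zero] at h1
      exact sub_eq_zero.1 (norm_le_zero_iff.1 h1)
    · have := (h f).contraction (h g) t.2
      rwa [h0, h0] at this
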